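/- **Conventions.** Let $M$ be a complex manifold of dimension $n$ with sheaf $\mathcal F$ of holomorphic functions. A supermanifold $(M,\mathcal O)$ of dimension $n|m$ with underlying manifold $M$ is a sheaf $\mathcal O$ of $\mathbb Z_2$-graded commutative $\mathbb C$-algebras on $M$ that is locally isomorphic to $\mathcal F\otimes_{\mathbb C}\bigwedge(\xi_1,\dots,\xi_m)$. Let $\mathcal J\subset\mathcal O$ be the ideal sheaf generated by the odd elements, and let $\operatorname{gr}\mathcal O=\bigoplus_{r\ge 0}\mathcal J^r/\mathcal J^{r+1}$. A locally free sheaf $\mathcal E$ of rank $p|q$ on $(M,\mathcal O)$ is a sheaf of $\mathbb Z_2$-graded $\mathcal O$-modules that locally has a homogeneous basis of $p$ even and $q$ odd sections; $\operatorname{gr}\mathcal E=\bigoplus_{r\ge 0}\mathcal J^r\mathcal E/\mathcal J^{r+1}\mathcal E$. All isomorphisms of sheaves of superalgebras or supermodules preserve parity and cover $\mathrm{id}_M$. A quasi-isomorphism $\Phi_\Psi:\mathcal E\to\mathcal E'$ of locally free sheaves on $(M,\mathcal O)$ and $(M,\mathcal O')$ consists of an isomorphism $\Psi:\mathcal O\to\mathcal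 O'$ of sheaves of superalgebras and a parity-preserving isomorphism $\Phi$ of sheaves of vector spaces with $\Phi(fv)=\Psi(f)\Phi(v)$. Write $[\mathcal E]$ for the quasi-isomorphism class of $\mathcal E$, and $[(M,\mathcal O)]$ for the isomorphism class of $(M,\mathcal O)$. Fix a split supermanifold $(M,\mathcal O_{\rm gr})$, $\mathcal O_{\rm gr}=\bigwedge_{\mathcal F}\mathcal G$ with $\mathcal G$ a locally free sheaf of $\mathcal F$-modules of rank $m$, and locally free sheaves of $\mathcal F$-modules $\mathcal S_{\bar 0},\mathcal S_{\bar 1}$ of ranks $p,q$. Put $\mathcal S=\mathcal S_{\bar 0}\oplus\mathcal S_{\bar 1}$ (with $\mathcal S_{\bar 0}$ even and $\mathcal S_{\bar 1}$ odd) and $\mathcal E_{\rm gr}=\mathcal O_{\rm gr}\otimes_{\mathcal F}\mathcal S$, with the $\mathbb Z$-grading coming from $\mathcal O_{\rm gr}$, in which $\mathcal S$ has degree $0$. Below, $\operatorname{gr}\mathcal O=\mathcal O_{\rm gr}$ means that the two are isomorphic as $\mathbb Z$- and $\mathbb Z_2$-graded sheaves of algebras, and "$\operatorname{gr}\mathcal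 O=\mathcal O_{\rm gr}$, $\operatorname{gr}\mathcal E=\mathcal E_{\rm gr}$" means that there is a quasi-isomorphism $\operatorname{gr}\mathcal E\to\mathcal E_{\rm gr}$ over an isomorphism $\operatorname{gr}\mathcal O\to\mathcal O_{\rm gr}$, both compatible with the $\mathbb Z$- and $\mathbb Z_2$-gradings. Let $\mathcal Aut_{(2)}\mathcal O_{\rm gr}$ be the sheaf of automorphisms $\Psi$ of $\mathcal O_{\rm gr}$ with $\Psi(f)\equiv f \bmod \mathcal J^2$ for all $f$, and let $\mathcal Aut_0\mathcal O_{\rm gr}$ be the sheaf of automorphisms preserving the $\mathbb Z$-grading. Let $\mathcal{QA}ut_{(1)(2)}\mathcal E_{\rm gr}$ be the sheaf of quasi-automorphisms $\Phi_\Psi$ of $\mathcal E_{\rm gr}$ with $\Phi(v)\equiv v\bmod \mathcal J\mathcal E_{\rm gr}$ and $\Psi\in\mathcal Aut_{(2)}\mathcal O_{\rm gr}$, and let $\mathcal{QA}ut_0\mathcal E_{\rm gr}$ be the sheaf of quasi-automorphisms for which $\Phi$ and $\Psi$ preserve the $\mathbb Z$-gradings. The groups $H^0(M,\mathcal{QA}ut_0\mathcal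 E_{\rm gr})$ and $H^0(M,\mathcal Aut_0\mathcal O_{\rm gr})$ act by conjugation on the non-abelian Čech cohomology sets $H^1(M,\mathcal{QA}ut_{(1)(2)}\mathcal E_{\rm gr})$ and $H^1(M,\mathcal Aut_{(2)}\mathcal O_{\rm gr})$, respectively, and $\Phi_\Psi\mapsto\Psi$ induces a map of orbit sets $$\widetilde F:\;H^1(M,\mathcal{QA}ut_{(1)(2)}\mathcal E_{\rm gr})/H^0(M,\mathcal{QA}ut_0\mathcal E_{\rm gr})\longrightarrow H^1(M,\mathcal Aut_{(2)}\mathcal O_{\rm gr})/H^0(M,\mathcal Aut_0\mathcal O_{\rm gr}).$$ **Theorem.** 1) There is a bijection $$\beta:\;\{[\mathcal E]\mid \operatorname{gr}\mathcal O=\mathcal O_{\rm gr},\ \operatorname{gr}\mathcal E=\mathcal E_{\rm gr}\}\;\stackrel{1:1}{\longleftrightarrow}\;H^1(M,\mathcal{QA}ut_{(1)(2)}\mathcal E_{\rm gr})/H^0(M,\mathcal{QA}ut_0\mathcal E_{\rm gr}),$$ where $\mathcal E$ runs over the locally free sheaves of rank $p|q$ on supermanifolds $(M,\mathcal O)$ of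 dimension $n|m$. It is given as follows: for every such $\mathcal E$ there are an open cover $(U_i)$ of $M$ and quasi-isomorphisms $\delta_i:\mathcal E|_{U_i}\to\mathcal E_{\rm gr}|_{U_i}$ with all $\delta_i\circ\delta_j^{-1}$ in $\mathcal{QA}ut_{(1)(2)}\mathcal E_{\rm gr}$ over $U_i\cap U_j$, and for every such choice $\beta([\mathcal E])$ is the orbit of the class of the cocycle $(\delta_i\circ\delta_j^{-1})$. The unit $\epsilon\in H^1(M,\mathcal{QA}ut_{(1)(2)}\mathcal E_{\rm gr})$ is fixed by the action of $H^0(M,\mathcal{QA}ut_0\mathcal E_{\rm gr})$. 2) Let $a\in H^1(M,\mathcal Aut_{(2)}\mathcal O_{\rm gr})/H^0(M,\mathcal Aut_0\mathcal O_{\rm gr})$, and let $[(M,\mathcal O)]$ be the class that corresponds to $a$ under the (Green) bijection $$\{[(M,\mathcal O)]\mid\operatorname{gr}\mathcal O=\mathcal O_{\rm gr}\}\stackrel{1:1}{\longleftrightarrow}H^1(M,\mathcal Aut_{(2)}\mathcal O_{\rm gr})/H^0(M,\mathcal Aut_0\mathcal O_{\rm gr}),$$ which sends $[(M,\mathcal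 O)]$ to the orbit of the class of the cocycle $(\sigma_i\circ\sigma_j^{-1})$, for any local isomorphisms $\sigma_i:\mathcal O|_{U_i}\to\mathcal O_{\rm gr}|_{U_i}$ over an open cover with all $\sigma_i\circ\sigma_j^{-1}$ in $\mathcal Aut_{(2)}\mathcal O_{\rm gr}$; such $\sigma_i$ exist. Then $\beta$ restricts to a bijection between the set of those classes $[\mathcal E]$ in 1) for which $\mathcal E$ is a locally free sheaf on a supermanifold contained in $[(M,\mathcal O)]$, and the fibre $\widetilde F^{-1}(a)$. -/

import Mathlib

open scoped Manifold ContDiff TensorProduct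
open TopologicalSpace CategoryTheory Opposite

universe u

set_option linter.unusedVariables false

namespace SuperGeom

/-! ## Presheaves of superalgebras and of supermodules -/

/-- A presheaf of complex superalgebras on `M`. The `ZMod 2`-grading of the algebra of sections is
recorded by its parity involution `σ`, which is `1` on even and `-1` on odd sections (over `ℂ`,
a `ZMod 2`-grading of an algebra is the same thing as an involutive algebra automorphism). -/
structure SuperAlg (M : Type u) [TopologicalSpace M] where
  sec : Opens M → Type u
  [ring : ∀ U, Ring (sec U)]
  [algebra : ∀ U, Algebra ℂ (sec U)]
  res : ∀ {U V : Opens M}, U ≤ V → (sec V →ₐ[ℂ] sec U)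
  res_self : ∀ (U : Opens M) (f : sec U), res (le_refl U) f = f
  res_res : ∀ {U V W : Opens M} (h : U ≤ V) (k : V ≤ W) (f : sec W),
    res h (res k f) = res (h.trans k) f
  σ : ∀ U, sec U →ₐ[ℂ] sec U
  σ_σ : ∀ (U : Opens M) (f : sec U), σ U (σ U f) = f
  res_σ : ∀ {U V : Opens M} (h : U ≤ V) (f : sec V), res h (σ V f) = σ U (res h f)

attribute [instance] SuperAlg.ring SuperAlg.algebra

/-- A presheaf of `ZMod 2`-graded left modules over a presheaf of superalgebras; the grading is again
recorded by its parity involution. -/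
structure SuperMod {M : Type u} [TopologicalSpace M] (A : SuperAlg M) where
  sec : Opens M → Type u
  [addCommGroup : ∀ U, AddCommGroup (sec U)]
  [module : ∀ U, Module (A.sec U) (sec U)]
  res : ∀ {U V : Opens M}, U ≤ V → (sec V →+ sec U)
  res_self : ∀ (U : Opens M) (v : sec U), res (le_refl U) v = v
  res_res : ∀ {U V W : Opens M} (h : U ≤ V) (k : V ≤ W) (v : sec W),
    res h (res k v) = res (h.trans k) v
  res_smul : ∀ {U V : Opens M} (h : U ≤ V) (f : A.sec V) (v : sec V),
    res h (f • v) = A.res h f • res h v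
  σ : ∀ U, sec U →+ sec U
  σ_σ : ∀ (U : Opens M) (v : sec U), σ U (σ U v) = v
  σ_smul : ∀ (U : Opens M) (f : A.sec U) (v : sec U), σ U (f • v) = A.σ U f • σ U v
  res_σ : ∀ {U V : Opens M} (h : U ≤ V) (v : sec V), res h (σ V v) = σ U (res h v)

attribute [instance] SuperMod.addCommGroup SuperMod.module

/-- A presheaf of superalgebras together with a presheaf of modules over it. -/
structure SuperPair (M : Type u) [TopologicalSpace M] where
  alg : SuperAlg M
  mod : SuperMod alg

section Filtration

variable {M : Type u} [TopologicalSpace M]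

namespace SuperAlg

variable (A : SuperAlg M)

/-- The sheaf condition. -/
def IsSheaf : Prop :=
  ∀ (ι : Type u) (U : ι → Opens M) (s : ∀ i, A.sec (U i)),
    (∀ i j, A.res (inf_le_left : U i ⊓ U j ≤ U i) (s i) =
      A.res (inf_le_right : U i ⊓ U j ≤ U j) (s j)) →
    ∃! f : A.sec (⨆ i, U i), ∀ i, A.res (le_iSup U i) f = s i

/-- The odd sections. -/
def odd (U : Opens M) : Submodule ℂ (A.sec U) where
  carrier := {f | A.σ U f = -f}
  add_mem' {f g} hf hg := by
    simp only [Set.mem_ofPred_eq] at hf hg ⊢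
    rw [map_add, hf, hg, neg_add]
  zero_mem' := by simp
  smul_mem' c f hf := by
    simp only [Set.mem_ofPred_eq] at hf ⊢
    rw [map_smul, hf, smul_neg]

/-- The two-sided ideal of `A.sec U` generated by the odd sections. -/
def oddIdeal (U : Opens M) : Submodule ℂ (A.sec U) := ⊤ * A.odd U * ⊤

/-- The `p`-th power of that ideal, the zeroth power being the whole algebra. -/
def oddIdealPow (p : ℕ) (U : Opens M) : Submodule ℂ (A.sec U) := ⊤ * A.oddIdeal U ^ p

lemma map_oddIdealPow_le {A B : SuperAlg M} {U V : Opens M} (φ : A.sec U →ₐ[ℂ] B.sec V)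
    (hφ : ∀ f, φ (A.σ U f) = B.σ V (φ f)) (p : ℕ) :
    (A.oddIdealPow p U).map φ.toLinearMap ≤ B.oddIdealPow p V := by
  have h1 : (A.odd U).map φ.toLinearMap ≤ B.odd V := by
    rintro _ ⟨f, hf, rfl⟩
    change B.σ V (φ f) = -φ f
    rw [← hφ, show A.σ U f = -f from hf, map_neg]
  have h2 : (A.oddIdeal U).map φ.toLinearMap ≤ B.oddIdeal V := by
    unfold oddIdeal
    rw [Submodule.map_mul, Submodule.map_mul]
    exact mul_le_mul' (mul_le_mul' le_top h1) le_top
  unfold oddIdealPow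
  rw [Submodule.map_mul, Submodule.map_pow]
  exact mul_le_mul' le_top (pow_le_pow_left' h2 p)

lemma oddIdealPow_mul_le (p q : ℕ) (U : Opens M) :
    A.oddIdealPow p U * A.oddIdealPow q U ≤ A.oddIdealPow (p + q) U := by
  have htt : (⊤ : Submodule ℂ (A.sec U)) * ⊤ = ⊤ :=
    top_le_iff.1 fun x _ => by
      have := Submodule.mul_mem_mul (Submodule.mem_top (x := x) (R := ℂ))
        (Submodule.mem_top (x := (1 : A.sec U)) (R := ℂ))
      rwa [mul_one] at this
  have hI : A.oddIdeal U * ⊤ = A.oddIdeal U := by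
    unfold oddIdeal; rw [mul_assoc, htt]
  unfold oddIdealPow
  cases p with
  | zero => rw [pow_zero, mul_one, ← mul_assoc, htt, zero_add]
  | succ p =>
    apply le_of_eq
    rw [pow_add (A.oddIdeal U) (p + 1) q, pow_succ]
    calc _ = ⊤ * (A.oddIdeal U ^ p * (A.oddIdeal U * ⊤) * A.oddIdeal U ^ q) := by
          simp only [mul_assoc]
      _ = _ := by rw [hI]

/-- The sections over `U` of the sheaf of ideals `𝒥 ^ p`, where `𝒥` is the sheaf of ideals generated
by the odd sections (`𝒥 ^ 0` is the whole algebra). -/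
def Jpow (p : ℕ) (U : Opens M) : Submodule ℂ (A.sec U) where
  carrier := {f | ∀ x ∈ U, ∃ (V : Opens M) (h : V ≤ U), x ∈ V ∧ A.res h f ∈ A.oddIdealPow p V}
  add_mem' {f g} hf hg x hx := by
    obtain ⟨V, hV, hxV, hfV⟩ := hf x hx
    obtain ⟨W, hW, hxW, hgW⟩ := hg x hx
    refine ⟨V ⊓ W, inf_le_left.trans hV, ⟨hxV, hxW⟩, ?_⟩
    rw [map_add]
    refine add_mem ?_ ?_
    · rw [← A.res_res inf_le_left hV]
      exact map_oddIdealPow_le (A.res inf_le_left) (fun f => A.res_σ _ f) p ⟨_, hfV, rfl⟩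
    · rw [← A.res_res inf_le_right hW]
      exact map_oddIdealPow_le (A.res inf_le_right) (fun f => A.res_σ _ f) p ⟨_, hgW, rfl⟩
  zero_mem' x hx := ⟨U, le_rfl, hx, by rw [map_zero]; exact zero_mem _⟩
  smul_mem' c f hf x hx := by
    obtain ⟨V, hV, hxV, hfV⟩ := hf x hx
    exact ⟨V, hV, hxV, by rw [map_smul]; exact Submodule.smul_mem _ c hfV⟩

variable {A}

lemma one_mem_Jpow (U : Opens M) : (1 : A.sec U) ∈ A.Jpow 0 U := fun x hx =>
  ⟨U, le_rfl, hx, by simp [oddIdealPow]⟩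

lemma Jpow_res {p : ℕ} {U V : Opens M} (h : U ≤ V) {f : A.sec V} (hf : f ∈ A.Jpow p V) :
    A.res h f ∈ A.Jpow p U := fun x hx => by
  obtain ⟨W, hW, hxW, hfW⟩ := hf x (h hx)
  refine ⟨W ⊓ U, inf_le_right, ⟨hxW, hx⟩, ?_⟩
  rw [A.res_res, ← A.res_res inf_le_left hW]
  exact map_oddIdealPow_le (A.res inf_le_left) (fun f => A.res_σ _ f) p ⟨_, hfW, rfl⟩

lemma Jpow_mul {p q : ℕ} {U : Opens M} {f g : A.sec U} (hf : f ∈ A.Jpow p U)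
    (hg : g ∈ A.Jpow q U) : f * g ∈ A.Jpow (p + q) U := fun x hx => by
  obtain ⟨V, hV, hxV, hfV⟩ := hf x hx
  obtain ⟨W, hW, hxW, hgW⟩ := hg x hx
  refine ⟨V ⊓ W, inf_le_left.trans hV, ⟨hxV, hxW⟩, ?_⟩
  rw [map_mul]
  refine A.oddIdealPow_mul_le p q _ (Submodule.mul_mem_mul ?_ ?_)
  · rw [← A.res_res inf_le_left hV]
    exact map_oddIdealPow_le (A.res inf_le_left) (fun f => A.res_σ _ f) p ⟨_, hfV, rfl⟩
  · rw [← A.res_res inf_le_right hW]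
    exact map_oddIdealPow_le (A.res inf_le_right) (fun f => A.res_σ _ f) q ⟨_, hgW, rfl⟩

lemma Jpow_σ {p : ℕ} {U : Opens M} {f : A.sec U} (hf : f ∈ A.Jpow p U) :
    A.σ U f ∈ A.Jpow p U := fun x hx => by
  obtain ⟨V, hV, hxV, hfV⟩ := hf x hx
  refine ⟨V, hV, hxV, ?_⟩
  rw [A.res_σ]
  exact map_oddIdealPow_le (A.σ V) (fun f => rfl) p ⟨_, hfV, rfl⟩

variable (A)

/-- The presheaf quotient `𝒥 ^ p / 𝒥 ^ (p + 1)`; its associated sheaf is the `p`-th graded piece of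
the retract `gr A`. -/
abbrev preGr (p : ℕ) (U : Opens M) : Type u :=
  (A.Jpow p U) ⧸ (A.Jpow (p + 1) U).submoduleOf (A.Jpow p U)

variable {A}

/-- The class in `𝒥 ^ p / 𝒥 ^ (p + 1)` of a section of `𝒥 ^ p`. -/
def symb {p : ℕ} {U : Opens M} (f : A.sec U) (hf : f ∈ A.Jpow p U) : A.preGr p U :=
  Submodule.Quotient.mk ⟨f, hf⟩

end SuperAlg

namespace SuperMod

variable {A : SuperAlg M} (E : SuperMod A)

/-- The sheaf condition. -/
def IsSheaf : Prop :=
  ∀ (ι : Type u) (U : ι → Opens M) (s : ∀ i, E.sec (U i)),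
    (∀ i j, E.res (inf_le_left : U i ⊓ U j ≤ U i) (s i) =
      E.res (inf_le_right : U i ⊓ U j ≤ U j) (s j)) →
    ∃! f : E.sec (⨆ i, U i), ∀ i, E.res (le_iSup U i) f = s i

/-- The subgroup of `E.sec U` generated by the products of sections of `𝒥 ^ p` and of `E`. -/
def preFilt (p : ℕ) (U : Opens M) : AddSubgroup (E.sec U) :=
  AddSubgroup.closure {y | ∃ f ∈ A.Jpow p U, ∃ v : E.sec U, y = f • v}

lemma res_preFilt {p : ℕ} {U V : Opens M} (h : U ≤ V) {v : E.sec V} (hv : v ∈ E.preFilt p V) :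
    E.res h v ∈ E.preFilt p U := by
  have : E.preFilt p V ≤ (E.preFilt p U).comap (E.res h) := by
    refine (AddSubgroup.closure_le _).2 ?_
    rintro _ ⟨f, hf, v, rfl⟩
    refine AddSubgroup.subset_closure ⟨A.res h f, SuperAlg.Jpow_res h hf, E.res h v, ?_⟩
    exact E.res_smul h f v
  exact this hv

/-- The sections over `U` of the subsheaf `E_(p) = 𝒥 ^ p E`. -/
def filt (p : ℕ) (U : Opens M) : AddSubgroup (E.sec U) where
  carrier := {v | ∀ x ∈ U, ∃ (V : Opens M) (h : V ≤ U), x ∈ V ∧ E.res h v ∈ E.preFilt p V}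
  add_mem' {v w} hv hw x hx := by
    obtain ⟨V, hV, hxV, hvV⟩ := hv x hx
    obtain ⟨W, hW, hxW, hwW⟩ := hw x hx
    refine ⟨V ⊓ W, inf_le_left.trans hV, ⟨hxV, hxW⟩, ?_⟩
    rw [map_add]
    refine add_mem ?_ ?_
    · rw [← E.res_res inf_le_left hV]
      exact E.res_preFilt _ hvV
    · rw [← E.res_res inf_le_right hW]
      exact E.res_preFilt _ hwW
  zero_mem' x hx := ⟨U, le_rfl, hx, by rw [map_zero]; exact zero_mem _⟩
  neg_mem' {v} hv x hx := by
    obtain ⟨V, hV, hxV, hvV⟩ := hv x hx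
    exact ⟨V, hV, hxV, by rw [map_neg]; exact neg_mem hvV⟩

variable {E}

lemma filt_res {p : ℕ} {U V : Opens M} (h : U ≤ V) {v : E.sec V} (hv : v ∈ E.filt p V) :
    E.res h v ∈ E.filt p U := fun x hx => by
  obtain ⟨W, hW, hxW, hvW⟩ := hv x (h hx)
  refine ⟨W ⊓ U, inf_le_right, ⟨hxW, hx⟩, ?_⟩
  rw [E.res_res, ← E.res_res inf_le_left hW]
  exact E.res_preFilt _ hvW

lemma filt_smul {p q : ℕ} {U : Opens M} {f : A.sec U} {v : E.sec U} (hf : f ∈ A.Jpow p U)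
    (hv : v ∈ E.filt q U) : f • v ∈ E.filt (p + q) U := fun x hx => by
  obtain ⟨V, hV, hxV, hvV⟩ := hv x hx
  refine ⟨V, hV, hxV, ?_⟩
  rw [E.res_smul]
  have : E.preFilt q V ≤
      (E.preFilt (p + q) V).comap (DistribSMul.toAddMonoidHom (E.sec V) (A.res hV f)) := by
    refine (AddSubgroup.closure_le _).2 ?_
    rintro _ ⟨g, hg, v, rfl⟩
    exact AddSubgroup.subset_closure
      ⟨A.res hV f * g, SuperAlg.Jpow_mul (SuperAlg.Jpow_res hV hf) hg, v, (mul_smul _ _ _).symm⟩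
  exact this hvV

lemma filt_σ {p : ℕ} {U : Opens M} {v : E.sec U} (hv : v ∈ E.filt p U) :
    E.σ U v ∈ E.filt p U := fun x hx => by
  obtain ⟨V, hV, hxV, hvV⟩ := hv x hx
  refine ⟨V, hV, hxV, ?_⟩
  rw [E.res_σ]
  have : E.preFilt p V ≤ (E.preFilt p V).comap (E.σ V) := by
    refine (AddSubgroup.closure_le _).2 ?_
    rintro _ ⟨f, hf, v, rfl⟩
    exact AddSubgroup.subset_closure ⟨A.σ V f, SuperAlg.Jpow_σ hf, E.σ V v, E.σ_smul V f v⟩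
  exact this hvV

variable (E)

/-- The presheaf quotient `E_(p) / E_(p + 1)`; its associated sheaf is the `p`-th graded piece of
the retract `gr E`. -/
abbrev preGr (p : ℕ) (U : Opens M) : Type u :=
  (E.filt p U) ⧸ (E.filt (p + 1) U).addSubgroupOf (E.filt p U)

variable {E}

/-- The class in `E_(p) / E_(p + 1)` of a section of `E_(p)`. -/
def symb {p : ℕ} {U : Opens M} (v : E.sec U) (hv : v ∈ E.filt p U) : E.preGr p U :=
  QuotientAddGroup.mk ⟨v, hv⟩

end SuperMod

/-- A family of subgroups, one for each degree and each open set: the homogeneous sections of a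
`ℤ`-grading (concentrated in non-negative degrees). -/
abbrev AlgGrading (A : SuperAlg M) : Type u := ℕ → ∀ U : Opens M, Submodule ℂ (A.sec U)

/-- The same for modules. -/
abbrev ModGrading {A : SuperAlg M} (E : SuperMod A) : Type u :=
  ℕ → ∀ U : Opens M, AddSubgroup (E.sec U)

/-- An isomorphism of sheaves of `ℤ`-graded superalgebras from the retract `gr A = ⨁ 𝒥^p / 𝒥^(p+1)`
to a sheaf of superalgebras `B` with `ℤ`-grading `g`. A morphism from the quotient sheaf
`𝒥^p / 𝒥^(p+1)` to the sheaf `B_p` is the same as a morphism `toGr` from the presheaf quotient, and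
it is an isomorphism if and only if `toGr` is injective and locally surjective (the presheaf quotient
is separated, since `𝒥^(p+1)` is a subsheaf). The ring structure of `gr A` is given by the products
of representatives. -/
structure AlgRetractIso (A B : SuperAlg M) (g : AlgGrading B) where
  toGr : ∀ (p : ℕ) (U : Opens M), A.preGr p U →ₗ[ℂ] B.sec U
  toGr_mem : ∀ p U s, toGr p U s ∈ g p U
  toGr_res : ∀ (p : ℕ) {U V : Opens M} (h : U ≤ V) (f : A.sec V) (hf : f ∈ A.Jpow p V),
    B.res h (toGr p V (SuperAlg.symb f hf)) =
      toGr p U (SuperAlg.symb (A.res h f) (SuperAlg.Jpow_res h hf))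
  toGr_injective : ∀ p U, Function.Injective (toGr p U)
  toGr_surjective : ∀ (p : ℕ) (U : Opens M), ∀ b ∈ g p U, ∀ x ∈ U,
    ∃ (V : Opens M) (h : V ≤ U), x ∈ V ∧ ∃ s : A.preGr p V, toGr p V s = B.res h b
  toGr_one : ∀ U : Opens M, toGr 0 U (SuperAlg.symb 1 (SuperAlg.one_mem_Jpow U)) = 1
  toGr_mul : ∀ (p q : ℕ) (U : Opens M) (f f' : A.sec U) (hf : f ∈ A.Jpow p U)
    (hf' : f' ∈ A.Jpow q U),
    toGr (p + q) U (SuperAlg.symb (f * f') (SuperAlg.Jpow_mul hf hf')) =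
      toGr p U (SuperAlg.symb f hf) * toGr q U (SuperAlg.symb f' hf')
  toGr_σ : ∀ (p : ℕ) (U : Opens M) (f : A.sec U) (hf : f ∈ A.Jpow p U),
    B.σ U (toGr p U (SuperAlg.symb f hf)) = toGr p U (SuperAlg.symb (A.σ U f) (SuperAlg.Jpow_σ hf))

/-- An isomorphism of the retract `(gr 𝒪, gr E)` of a pair `X = (𝒪, E)` with a `ℤ`-graded pair `Y`:
an isomorphism of sheaves of graded superalgebras from `gr 𝒪` to the algebra of `Y`, and over it an
isomorphism of sheaves of graded modules from `gr E = ⨁ E_(p) / E_(p+1)` to the module of `Y`, which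
respects parities. -/
structure RetractIso (X Y : SuperPair M) (g : AlgGrading Y.alg) (e : ModGrading Y.mod) extends
    AlgRetractIso X.alg Y.alg g where
  toGrMod : ∀ (p : ℕ) (U : Opens M), X.mod.preGr p U →+ Y.mod.sec U
  toGrMod_mem : ∀ p U s, toGrMod p U s ∈ e p U
  toGrMod_res : ∀ (p : ℕ) {U V : Opens M} (h : U ≤ V) (v : X.mod.sec V) (hv : v ∈ X.mod.filt p V),
    Y.mod.res h (toGrMod p V (SuperMod.symb v hv)) =
      toGrMod p U (SuperMod.symb (X.mod.res h v) (SuperMod.filt_res h hv))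
  toGrMod_injective : ∀ p U, Function.Injective (toGrMod p U)
  toGrMod_surjective : ∀ (p : ℕ) (U : Opens M), ∀ b ∈ e p U, ∀ x ∈ U,
    ∃ (V : Opens M) (h : V ≤ U), x ∈ V ∧ ∃ s : X.mod.preGr p V, toGrMod p V s = Y.mod.res h b
  toGrMod_smul : ∀ (p q : ℕ) (U : Opens M) (f : X.alg.sec U) (v : X.mod.sec U)
    (hf : f ∈ X.alg.Jpow p U) (hv : v ∈ X.mod.filt q U),
    toGrMod (p + q) U (SuperMod.symb (f • v) (SuperMod.filt_smul hf hv)) =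
      toGr p U (SuperAlg.symb f hf) • toGrMod q U (SuperMod.symb v hv)
  toGrMod_σ : ∀ (p : ℕ) (U : Opens M) (v : X.mod.sec U) (hv : v ∈ X.mod.filt p U),
    Y.mod.σ U (toGrMod p U (SuperMod.symb v hv)) =
      toGrMod p U (SuperMod.symb (X.mod.σ U v) (SuperMod.filt_σ hv))

end Filtration

/-! ## Isomorphisms over an open set -/

section Isomorphisms

variable {M : Type u} [TopologicalSpace M]

/-- An isomorphism `A|_U → B|_U` of sheaves of superalgebras. -/
@[ext]
structure AlgIso (U : Opens M) (A B : SuperAlg M) where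
  toEquiv : ∀ V : Opens M, V ≤ U → (A.sec V ≃ₐ[ℂ] B.sec V)
  map_res : ∀ {V W : Opens M} (h : W ≤ V) (k : V ≤ U) (f : A.sec V),
    B.res h (toEquiv V k f) = toEquiv W (h.trans k) (A.res h f)
  map_σ : ∀ (V : Opens M) (k : V ≤ U) (f : A.sec V),
    B.σ V (toEquiv V k f) = toEquiv V k (A.σ V f)

namespace AlgIso

variable {U : Opens M} {A B C : SuperAlg M}

/-- The identity. -/
def refl (U : Opens M) (A : SuperAlg M) : AlgIso U A A where
  toEquiv _ _ := AlgEquiv.refl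
  map_res _ _ _ := rfl
  map_σ _ _ _ := rfl

/-- The inverse isomorphism. -/
def symm (φ : AlgIso U A B) : AlgIso U B A where
  toEquiv V k := (φ.toEquiv V k).symm
  map_res h k f := by
    rw [AlgEquiv.eq_symm_apply, ← φ.map_res h k, AlgEquiv.apply_symm_apply]
  map_σ V k f := by
    rw [AlgEquiv.eq_symm_apply, ← φ.map_σ V k, AlgEquiv.apply_symm_apply]

/-- The composition: first `φ`, then `ψ`. -/
def trans (φ : AlgIso U A B) (ψ : AlgIso U B C) : AlgIso U A C where
  toEquiv V k := (φ.toEquiv V k).trans (ψ.toEquiv V k)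
  map_res h k f := by
    simp only [AlgEquiv.trans_apply, ψ.map_res, φ.map_res]
  map_σ V k f := by
    simp only [AlgEquiv.trans_apply, ψ.map_σ, φ.map_σ]

/-- Restriction to a smaller open set. -/
def restrict {W : Opens M} (h : W ≤ U) (φ : AlgIso U A B) : AlgIso W A B where
  toEquiv V k := φ.toEquiv V (k.trans h)
  map_res i k f := φ.map_res i (k.trans h) f
  map_σ V k f := φ.map_σ V (k.trans h) f

lemma ext' {φ ψ : AlgIso U A B} (h : ∀ V k f, φ.toEquiv V k f = ψ.toEquiv V k f) : φ = ψ :=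
  AlgIso.ext (funext fun V => funext fun k => AlgEquiv.ext (h V k))

/-- The group of automorphisms of the sheaf of superalgebras `A|_U`; the product is the
composition of maps. -/
instance : Group (AlgIso U A A) where
  mul φ ψ := ψ.trans φ
  one := refl U A
  inv φ := φ.symm
  mul_assoc _ _ _ := rfl
  one_mul _ := rfl
  mul_one _ := rfl
  inv_mul_cancel φ := ext' fun V k f => (φ.toEquiv V k).symm_apply_apply f

lemma mul_apply (φ ψ : AlgIso U A A) (V : Opens M) (k : V ≤ U) (f : A.sec V) :
    (φ * ψ).toEquiv V k f = φ.toEquiv V k (ψ.toEquiv V k f) := rfl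

lemma inv_apply (φ : AlgIso U A A) (V : Opens M) (k : V ≤ U) (f : A.sec V) :
    (φ⁻¹).toEquiv V k f = (φ.toEquiv V k).symm f := rfl

lemma one_apply (V : Opens M) (k : V ≤ U) (f : A.sec V) :
    (1 : AlgIso U A A).toEquiv V k f = f := rfl

/-- An isomorphism respects the powers of `𝒥`. -/
lemma map_Jpow (φ : AlgIso U A B) (p : ℕ) (V : Opens M) (k : V ≤ U) {f : A.sec V}
    (hf : f ∈ A.Jpow p V) : φ.toEquiv V k f ∈ B.Jpow p V := fun x hx => by
  obtain ⟨W, hW, hxW, hfW⟩ := hf x hx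
  refine ⟨W, hW, hxW, ?_⟩
  rw [φ.map_res]
  exact SuperAlg.map_oddIdealPow_le (φ.toEquiv W (hW.trans k)).toAlgHom
    (fun f => (φ.map_σ W _ f).symm) p ⟨_, hfW, rfl⟩

end AlgIso

/-- A quasi-isomorphism `X|_U → Y|_U` of pairs `X = (𝒪, E)`, `Y = (𝒪', E')`: an isomorphism
`Ψ : 𝒪|_U → 𝒪'|_U` of sheaves of superalgebras and a parity preserving additive isomorphism
`Φ : E|_U → E'|_U` with `Φ (f v) = Ψ f Φ v` (so that `Φ` is `ℂ`-linear). -/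
@[ext]
structure QuasiIso (U : Opens M) (X Y : SuperPair M) extends AlgIso U X.alg Y.alg where
  toModEquiv : ∀ V : Opens M, V ≤ U → (X.mod.sec V ≃+ Y.mod.sec V)
  mod_res : ∀ {V W : Opens M} (h : W ≤ V) (k : V ≤ U) (v : X.mod.sec V),
    Y.mod.res h (toModEquiv V k v) = toModEquiv W (h.trans k) (X.mod.res h v)
  mod_σ : ∀ (V : Opens M) (k : V ≤ U) (v : X.mod.sec V),
    Y.mod.σ V (toModEquiv V k v) = toModEquiv V k (X.mod.σ V v)
  mod_smul : ∀ (V : Opens M) (k : V ≤ U) (f : X.alg.sec V) (v : X.mod.sec V),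
    toModEquiv V k (f • v) = toEquiv V k f • toModEquiv V k v

namespace QuasiIso

variable {U : Opens M} {X Y Z : SuperPair M}

/-- The identity. -/
def refl (U : Opens M) (X : SuperPair M) : QuasiIso U X X where
  toAlgIso := AlgIso.refl U X.alg
  toModEquiv _ _ := AddEquiv.refl _
  mod_res _ _ _ := rfl
  mod_σ _ _ _ := rfl
  mod_smul _ _ _ _ := rfl

/-- The inverse quasi-isomorphism. -/
def symm (φ : QuasiIso U X Y) : QuasiIso U Y X where
  toAlgIso := φ.toAlgIso.symm
  toModEquiv V k := (φ.toModEquiv V k).symm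
  mod_res h k v := by
    rw [AddEquiv.eq_symm_apply, ← φ.mod_res h k, AddEquiv.apply_symm_apply]
  mod_σ V k v := by
    rw [AddEquiv.eq_symm_apply, ← φ.mod_σ V k, AddEquiv.apply_symm_apply]
  mod_smul V k f v := by
    rw [AddEquiv.symm_apply_eq, φ.mod_smul, AddEquiv.apply_symm_apply]
    exact congrArg (· • v) ((φ.toEquiv V k).apply_symm_apply f).symm

/-- The composition: first `φ`, then `ψ`. -/
def trans (φ : QuasiIso U X Y) (ψ : QuasiIso U Y Z) : QuasiIso U X Z where
  toAlgIso := φ.toAlgIso.trans ψ.toAlgIso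
  toModEquiv V k := (φ.toModEquiv V k).trans (ψ.toModEquiv V k)
  mod_res h k v := by
    simp only [AddEquiv.trans_apply, ψ.mod_res, φ.mod_res]
  mod_σ V k v := by
    simp only [AddEquiv.trans_apply, ψ.mod_σ, φ.mod_σ]
  mod_smul V k f v := by
    simp only [AddEquiv.trans_apply, φ.mod_smul, ψ.mod_smul]
    rfl

/-- Restriction to a smaller open set. -/
def restrict {W : Opens M} (h : W ≤ U) (φ : QuasiIso U X Y) : QuasiIso W X Y where
  toAlgIso := φ.toAlgIso.restrict h
  toModEquiv V k := φ.toModEquiv V (k.trans h)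
  mod_res i k v := φ.mod_res i (k.trans h) v
  mod_σ V k v := φ.mod_σ V (k.trans h) v
  mod_smul V k f v := φ.mod_smul V (k.trans h) f v

lemma ext' {φ ψ : QuasiIso U X Y} (h : ∀ V k f, φ.toEquiv V k f = ψ.toEquiv V k f)
    (h' : ∀ V k v, φ.toModEquiv V k v = ψ.toModEquiv V k v) : φ = ψ :=
  QuasiIso.ext (funext fun V => funext fun k => AlgEquiv.ext (h V k))
    (funext fun V => funext fun k => AddEquiv.ext (h' V k))

/-- The group of quasi-automorphisms of `X|_U`; the product is the composition of maps. -/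
instance : Group (QuasiIso U X X) where
  mul φ ψ := ψ.trans φ
  one := refl U X
  inv φ := φ.symm
  mul_assoc _ _ _ := rfl
  one_mul _ := rfl
  mul_one _ := rfl
  inv_mul_cancel φ := ext' (fun V k f => (φ.toEquiv V k).symm_apply_apply f)
    (fun V k v => (φ.toModEquiv V k).symm_apply_apply v)

lemma mul_apply (φ ψ : QuasiIso U X X) (V : Opens M) (k : V ≤ U) (v : X.mod.sec V) :
    (φ * ψ).toModEquiv V k v = φ.toModEquiv V k (ψ.toModEquiv V k v) := rfl

lemma inv_apply (φ : QuasiIso U X X) (V : Opens M) (k : V ≤ U) (v : X.mod.sec V) :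
    (φ⁻¹).toModEquiv V k v = (φ.toModEquiv V k).symm v := rfl

lemma one_apply (V : Opens M) (k : V ≤ U) (v : X.mod.sec V) :
    (1 : QuasiIso U X X).toModEquiv V k v = v := rfl

/-- A quasi-isomorphism respects the filtrations. -/
lemma map_filt (φ : QuasiIso U X Y) (p : ℕ) (V : Opens M) (k : V ≤ U) {v : X.mod.sec V}
    (hv : v ∈ X.mod.filt p V) : φ.toModEquiv V k v ∈ Y.mod.filt p V := fun x hx => by
  obtain ⟨W, hW, hxW, hvW⟩ := hv x hx
  refine ⟨W, hW, hxW, ?_⟩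
  rw [φ.mod_res]
  have : X.mod.preFilt p W ≤
      (Y.mod.preFilt p W).comap (φ.toModEquiv W (hW.trans k)).toAddMonoidHom := by
    refine (AddSubgroup.closure_le _).2 ?_
    rintro _ ⟨f, hf, v, rfl⟩
    exact AddSubgroup.subset_closure ⟨φ.toEquiv W (hW.trans k) f,
      φ.toAlgIso.map_Jpow p W _ hf, φ.toModEquiv W (hW.trans k) v, φ.mod_smul W _ f v⟩
  exact this hvW

/-- The homomorphism `Φ_Ψ ↦ Ψ`. -/
def baseHom (U : Opens M) (X : SuperPair M) : QuasiIso U X X →* AlgIso U X.alg X.alg where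
  toFun φ := φ.toAlgIso
  map_one' := rfl
  map_mul' _ _ := rfl

end QuasiIso

/-! ## The sheaves of groups -/

/-- The automorphisms `a` of `A|_U` with `a f ≡ f` modulo `𝒥 ^ q`. -/
def autFilt (A : SuperAlg M) (q : ℕ) (U : Opens M) : Subgroup (AlgIso U A A) where
  carrier := {a | ∀ (V : Opens M) (k : V ≤ U) (f : A.sec V), a.toEquiv V k f - f ∈ A.Jpow q V}
  one_mem' V k f := by
    rw [AlgIso.one_apply, sub_self]; exact zero_mem _
  mul_mem' {a b} ha hb V k f := by
    have := add_mem (ha V k (b.toEquiv V k f)) (hb V k f)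
    rwa [sub_add_sub_cancel] at this
  inv_mem' {a} ha V k f := by
    have := neg_mem (ha V k ((a.toEquiv V k).symm f))
    rwa [neg_sub, AlgEquiv.apply_symm_apply] at this

/-- The quasi-automorphisms `Φ_Ψ` of `X|_U` with `Φ v ≡ v` modulo `E_(p)` and `Ψ f ≡ f` modulo
`𝒥 ^ q`. -/
def qautFilt (X : SuperPair M) (p q : ℕ) (U : Opens M) : Subgroup (QuasiIso U X X) where
  carrier := {a | (∀ (V : Opens M) (k : V ≤ U) (v : X.mod.sec V),
      a.toModEquiv V k v - v ∈ X.mod.filt p V) ∧ a.toAlgIso ∈ autFilt X.alg q U}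
  one_mem' := ⟨fun V k v => by rw [QuasiIso.one_apply, sub_self]; exact zero_mem _, one_mem _⟩
  mul_mem' {a b} ha hb := ⟨fun V k v => by
    have := add_mem (ha.1 V k (b.toModEquiv V k v)) (hb.1 V k v)
    rwa [sub_add_sub_cancel] at this, mul_mem ha.2 hb.2⟩
  inv_mem' {a} ha := ⟨fun V k v => by
    have := neg_mem (ha.1 V k ((a.toModEquiv V k).symm v))
    rwa [neg_sub, AddEquiv.apply_symm_apply] at this, inv_mem ha.2⟩

/-- The sheaf of groups `𝒜ut_(q) A`. -/
def autSheaf (A : SuperAlg M) (q : ℕ) : (Opens M)ᵒᵖ ⥤ GrpCat.{u} where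
  obj U := GrpCat.of (autFilt A q U.unop)
  map {U V} i := GrpCat.ofHom
    { toFun := fun a => ⟨a.1.restrict (leOfHom i.unop), fun W k f => a.2 W _ f⟩
      map_one' := rfl
      map_mul' := fun _ _ => rfl }
  map_id _ := rfl
  map_comp _ _ := rfl

/-- The sheaf of groups `𝒬𝒜ut_(p)(q)` of the pair `X`. -/
def qautSheaf (X : SuperPair M) (p q : ℕ) : (Opens M)ᵒᵖ ⥤ GrpCat.{u} where
  obj U := GrpCat.of (qautFilt X p q U.unop)
  map {U V} i := GrpCat.ofHom
    { toFun := fun a => ⟨a.1.restrict (leOfHom i.unop),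
        fun W k v => a.2.1 W _ v, fun W k f => a.2.2 W _ f⟩
      map_one' := rfl
      map_mul' := fun _ _ => rfl }
  map_id _ := rfl
  map_comp _ _ := rfl

/-- The homomorphism `F : 𝒬𝒜ut_(p)(q) → 𝒜ut_(q)`, `Φ_Ψ ↦ Ψ`. -/
def baseMap (X : SuperPair M) (p q : ℕ) : qautSheaf X p q ⟶ autSheaf X.alg q where
  app U := GrpCat.ofHom
    { toFun := fun a => ⟨a.1.toAlgIso, a.2.2⟩
      map_one' := rfl
      map_mul' := fun _ _ => rfl }
  naturality _ _ _ := rfl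

/-- The group of global automorphisms of `A` that preserve the `ℤ`-grading `g`. -/
def autZero (A : SuperAlg M) (g : AlgGrading A) : Subgroup (AlgIso ⊤ A A) where
  carrier := {a | ∀ (p : ℕ) (V : Opens M) (f : A.sec V),
    a.toEquiv V le_top f ∈ g p V ↔ f ∈ g p V}
  one_mem' _ _ _ := Iff.rfl
  mul_mem' {a b} ha hb p V f := (ha p V _).trans (hb p V f)
  inv_mem' {a} ha p V f := by
    rw [← ha p V, AlgIso.inv_apply, AlgEquiv.apply_symm_apply]

/-- The group of global quasi-automorphisms `Φ_Ψ` of `X` that preserve the `ℤ`-gradings. -/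
def qautZero (X : SuperPair M) (g : AlgGrading X.alg) (e : ModGrading X.mod) :
    Subgroup (QuasiIso ⊤ X X) where
  carrier := {a | (∀ (p : ℕ) (V : Opens M) (v : X.mod.sec V),
    a.toModEquiv V le_top v ∈ e p V ↔ v ∈ e p V) ∧ a.toAlgIso ∈ autZero X.alg g}
  one_mem' := ⟨fun _ _ _ => Iff.rfl, one_mem _⟩
  mul_mem' {a b} ha hb := ⟨fun p V v => (ha.1 p V _).trans (hb.1 p V v), mul_mem ha.2 hb.2⟩
  inv_mem' {a} ha := ⟨fun p V v => by
    rw [← ha.1 p V, QuasiIso.inv_apply, AddEquiv.apply_symm_apply], inv_mem ha.2⟩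

/-- The homomorphism `Φ_Ψ ↦ Ψ` on the grading preserving global sections. -/
def baseZero (X : SuperPair M) (g : AlgGrading X.alg) (e : ModGrading X.mod) :
    qautZero X g e →* autZero X.alg g where
  toFun a := ⟨a.1.toAlgIso, a.2.2⟩
  map_one' := rfl
  map_mul' _ _ := rfl

/-- Conjugation `δ ↦ a ∘ δ ∘ a⁻¹` by a global automorphism `a`, on `𝒜ut_(q) A`. -/
def autConj (A : SuperAlg M) (q : ℕ) (a : AlgIso ⊤ A A) : autSheaf A q ⟶ autSheaf A q where
  app U := GrpCat.ofHom
    { toFun := fun d => ⟨a.restrict le_top * d.1 * (a.restrict le_top)⁻¹, fun V k f => by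
        have h := a.map_Jpow q V le_top (d.2 V k ((a.toEquiv V le_top).symm f))
        rw [map_sub, AlgEquiv.apply_symm_apply] at h
        exact h⟩
      map_one' := Subtype.ext (by simp)
      map_mul' := fun x y => Subtype.ext (by simp [mul_assoc]) }
  naturality _ _ _ := rfl

/-- Conjugation `δ ↦ a ∘ δ ∘ a⁻¹` by a global quasi-automorphism `a`, on `𝒬𝒜ut_(p)(q)`. -/
def qautConj (X : SuperPair M) (p q : ℕ) (a : QuasiIso ⊤ X X) :
    qautSheaf X p q ⟶ qautSheaf X p q where
  app U := GrpCat.ofHom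
    { toFun := fun d => ⟨a.restrict le_top * d.1 * (a.restrict le_top)⁻¹, fun V k v => by
          have h := a.map_filt p V le_top (d.2.1 V k ((a.toModEquiv V le_top).symm v))
          rw [map_sub, AddEquiv.apply_symm_apply] at h
          exact h, fun V k f => by
          have h := a.toAlgIso.map_Jpow q V le_top (d.2.2 V k ((a.toEquiv V le_top).symm f))
          rw [map_sub, AlgEquiv.apply_symm_apply] at h
          exact h⟩
      map_one' := Subtype.ext (by simp)
      map_mul' := fun x y => Subtype.ext (by simp [mul_assoc]) }
  naturality _ _ _ := rfl

end Isomorphisms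

/-! ## Non-abelian cohomology in degree one -/

section Cohomology

variable {M : Type u} [TopologicalSpace M]

open PresheafOfGroups

/-- A 1-cocycle with values in a presheaf of groups, on some open covering of `M`. -/
structure Cocycle (P : (Opens M)ᵒᵖ ⥤ GrpCat.{u}) where
  ι : Type u
  U : ι → Opens M
  cover : ∀ x : M, ∃ i, x ∈ U i
  z : OneCocycle P U

namespace Cocycle

variable {P Q R : (Opens M)ᵒᵖ ⥤ GrpCat.{u}}

/-- The cocycle induced on a refinement. -/
def refine {ι κ : Type u} {U : ι → Opens M} {W : κ → Opens M} (a : κ → ι)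
    (h : ∀ k, W k ≤ U (a k)) (z : OneCocycle P U) : OneCocycle P W where
  ev k l _ s t := z.ev (a k) (a l) (s ≫ homOfLE (h k)) (t ≫ homOfLE (h l))
  ev_precomp k l _ _ φ s t := z.ev_precomp _ _ φ _ _
  ev_trans i j k _ s t r := z.ev_trans _ _ _ _ _ _

/-- Two cocycles represent the same class if they become cohomologous on a common refinement of
their coverings. -/
def Rel (c d : Cocycle P) : Prop :=
  ∃ (κ : Type u) (W : κ → Opens M) (_ : ∀ x : M, ∃ k, x ∈ W k)
    (a : κ → c.ι) (ha : ∀ k, W k ≤ c.U (a k)) (b : κ → d.ι) (hb : ∀ k, W k ≤ d.U (b k)),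
    (refine a ha c.z).IsCohomologous (refine b hb d.z)

/-- The image of a cocycle under a homomorphism of presheaves of groups. -/
def map (α : P ⟶ Q) (c : Cocycle P) : Cocycle Q where
  ι := c.ι
  U := c.U
  cover := c.cover
  z :=
    { ev := fun i j T s t => α.app (op T) (c.z.ev i j s t)
      ev_precomp := fun i j T T' φ s t => by
        rw [← c.z.ev_precomp i j φ s t]
        exact (ConcreteCategory.congr_hom (α.naturality φ.op) (c.z.ev i j s t)).symm
      ev_trans := fun i j k T s t r => by
        rw [← map_mul, c.z.ev_trans] }

lemma Rel.map (α : P ⟶ Q) {c d : Cocycle P} (h : Rel c d) : Rel (c.map α) (d.map α) := by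
  obtain ⟨κ, W, hW, a, ha, b, hb, γ, hγ⟩ := h
  refine ⟨κ, W, hW, a, ha, b, hb, fun k => α.app _ (γ k), fun i j T s t => ?_⟩
  have h1 := congrArg (α.app (op T)) (hγ i j s t)
  rw [map_mul, map_mul] at h1
  have h2 := ConcreteCategory.congr_hom (α.naturality s.op) (γ i)
  have h3 := ConcreteCategory.congr_hom (α.naturality t.op) (γ j)
  simp only [ConcreteCategory.comp_apply] at h2 h3
  rw [← h2, ← h3]
  exact h1

/-- The unit cocycle, on the covering of `M` by itself. -/
def unit (P : (Opens M)ᵒᵖ ⥤ GrpCat.{u}) : Cocycle P where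
  ι := PUnit
  U _ := ⊤
  cover _ := ⟨PUnit.unit, trivial⟩
  z := 1

end Cocycle

/-- The cohomology set `H¹(M, P)`: the colimit over the open coverings of `M` of the sets of classes
of cohomologous cocycles. -/
def H1 (P : (Opens M)ᵒᵖ ⥤ GrpCat.{u}) : Type (u + 1) := Quot (Cocycle.Rel (P := P))

namespace H1

variable {P Q R : (Opens M)ᵒᵖ ⥤ GrpCat.{u}}

/-- The class of a cocycle. -/
def mk (c : Cocycle P) : H1 P := Quot.mk _ c

/-- The unit class `ε`. -/
def unit (P : (Opens M)ᵒᵖ ⥤ GrpCat.{u}) : H1 P := mk (Cocycle.unit P)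

/-- The map of cohomology sets induced by a homomorphism of presheaves of groups. -/
def map (α : P ⟶ Q) : H1 P → H1 Q :=
  Quot.map (Cocycle.map α) fun _ _ h => h.map α

lemma map_id (x : H1 P) : map (𝟙 P) x = x := by
  induction x using Quot.ind
  rfl

lemma map_comp (α : P ⟶ Q) (β : Q ⟶ R) (x : H1 P) : map (α ≫ β) x = map β (map α x) := by
  induction x using Quot.ind
  rfl

end H1

/-- The action of the global automorphisms of `A` on `H¹(M, 𝒜ut_(q) A)` by conjugation. -/
instance autAction (A : SuperAlg M) (q : ℕ) : MulAction (AlgIso ⊤ A A) (H1 (autSheaf A q)) where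
  smul a x := H1.map (autConj A q a) x
  one_smul x := H1.map_id x
  mul_smul a b x := by
    change H1.map _ x = H1.map _ (H1.map _ x)
    rw [← H1.map_comp]
    rfl

/-- The action of the global quasi-automorphisms of `X` on `H¹(M, 𝒬𝒜ut_(p)(q))` by conjugation. -/
instance qautAction (X : SuperPair M) (p q : ℕ) :
    MulAction (QuasiIso ⊤ X X) (H1 (qautSheaf X p q)) where
  smul a x := H1.map (qautConj X p q a) x
  one_smul x := H1.map_id x
  mul_smul a b x := by
    change H1.map _ x = H1.map _ (H1.map _ x)
    rw [← H1.map_comp]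
    rfl

/-- The orbit set `H¹(M, 𝒜ut_(2) A) / H⁰(M, 𝒜ut_0 A)`. -/
abbrev AutOrbits (A : SuperAlg M) (g : AlgGrading A) : Type (u + 1) :=
  MulAction.orbitRel.Quotient (autZero A g) (H1 (autSheaf A 2))

/-- The orbit set `H¹(M, 𝒬𝒜ut_(1)(2)) / H⁰(M, 𝒬𝒜ut_0)` of the pair `X`. -/
abbrev QautOrbits (X : SuperPair M) (g : AlgGrading X.alg) (e : ModGrading X.mod) : Type (u + 1) :=
  MulAction.orbitRel.Quotient (qautZero X g e) (H1 (qautSheaf X 1 2))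

lemma map_baseMap_smul (X : SuperPair M) (g : AlgGrading X.alg) (e : ModGrading X.mod)
    (a : qautZero X g e) (x : H1 (qautSheaf X 1 2)) :
    H1.map (baseMap X 1 2) (a • x) = baseZero X g e a • H1.map (baseMap X 1 2) x := by
  change H1.map _ (H1.map _ x) = H1.map _ (H1.map _ x)
  rw [← H1.map_comp, ← H1.map_comp]
  rfl

/-- The map of orbit sets induced by `F`. -/
def orbitBase (X : SuperPair M) (g : AlgGrading X.alg) (e : ModGrading X.mod) :
    QautOrbits X g e → AutOrbits X.alg g :=
  Quotient.map (H1.map (baseMap X 1 2)) fun x y h => by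
    obtain ⟨a, rfl⟩ := MulAction.mem_orbit_iff.1 (MulAction.orbitRel_apply.1 h)
    exact MulAction.orbitRel_apply.2
      (MulAction.mem_orbit_iff.2 ⟨baseZero X g e a, (map_baseMap_smul X g e a y).symm⟩)

/-- An open covering `U i` of `M` with isomorphisms `σ i : A|_{U i} → B|_{U i}` whose transition
automorphisms `σ i ∘ (σ j)⁻¹` lie in `𝒜ut_(2) B`, that is, such that `σ i` and `σ j` induce the same
map `gr A → gr B` over `U i ∩ U j`. -/
structure AlgAtlas (A B : SuperAlg M) where
  ι : Type u
  U : ι → Opens M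
  cover : ∀ x : M, ∃ i, x ∈ U i
  chart : ∀ i, AlgIso (U i) A B
  transition : ∀ (i j : ι) (T : Opens M) (hi : T ≤ U i) (hj : T ≤ U j),
    ((chart j).restrict hj).symm.trans ((chart i).restrict hi) ∈ autFilt B 2 T

/-- The cocycle `γ i j = σ i ∘ (σ j)⁻¹`. -/
def AlgAtlas.cocycle {A B : SuperAlg M} (t : AlgAtlas A B) : Cocycle (autSheaf B 2) where
  ι := t.ι
  U := t.U
  cover := t.cover
  z :=
    { ev := fun i j T a b =>
        ⟨((t.chart j).restrict (leOfHom b)).symm.trans ((t.chart i).restrict (leOfHom a)),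
          t.transition i j T (leOfHom a) (leOfHom b)⟩
      ev_precomp := fun _ _ _ _ _ _ _ => rfl
      ev_trans := fun i j k T a b c => Subtype.ext (AlgIso.ext' fun V h f => by
        change (t.chart i).toEquiv V _ ((t.chart j).toEquiv V _ |>.symm
          ((t.chart j).toEquiv V _ ((t.chart k).toEquiv V _ |>.symm f))) =
          (t.chart i).toEquiv V _ ((t.chart k).toEquiv V _ |>.symm f)
        rw [AlgEquiv.symm_apply_apply]) }

/-- An open covering `U i` of `M` with quasi-isomorphisms `δ i : X|_{U i} → Y|_{U i}` whose
transition quasi-automorphisms `δ i ∘ (δ j)⁻¹` lie in `𝒬𝒜ut_(1)(2) Y`, that is, such that `δ i` and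
`δ j` induce the same map `gr X → gr Y` over `U i ∩ U j`. -/
structure Atlas (X Y : SuperPair M) where
  ι : Type u
  U : ι → Opens M
  cover : ∀ x : M, ∃ i, x ∈ U i
  chart : ∀ i, QuasiIso (U i) X Y
  transition : ∀ (i j : ι) (T : Opens M) (hi : T ≤ U i) (hj : T ≤ U j),
    ((chart j).restrict hj).symm.trans ((chart i).restrict hi) ∈ qautFilt Y 1 2 T

/-- The cocycle `g i j = δ i ∘ (δ j)⁻¹`. -/
def Atlas.cocycle {X Y : SuperPair M} (t : Atlas X Y) : Cocycle (qautSheaf Y 1 2) where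
  ι := t.ι
  U := t.U
  cover := t.cover
  z :=
    { ev := fun i j T a b =>
        ⟨((t.chart j).restrict (leOfHom b)).symm.trans ((t.chart i).restrict (leOfHom a)),
          t.transition i j T (leOfHom a) (leOfHom b)⟩
      ev_precomp := fun _ _ _ _ _ _ _ => rfl
      ev_trans := fun i j k T a b c => Subtype.ext (QuasiIso.ext' (fun V h f => by
        change (t.chart i).toEquiv V _ ((t.chart j).toEquiv V _ |>.symm
          ((t.chart j).toEquiv V _ ((t.chart k).toEquiv V _ |>.symm f))) =
          (t.chart i).toEquiv V _ ((t.chart k).toEquiv V _ |>.symm f)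
        rw [AlgEquiv.symm_apply_apply]) (fun V h f => by
        change (t.chart i).toModEquiv V _ ((t.chart j).toModEquiv V _ |>.symm
          ((t.chart j).toModEquiv V _ ((t.chart k).toModEquiv V _ |>.symm f))) =
          (t.chart i).toModEquiv V _ ((t.chart k).toModEquiv V _ |>.symm f)
        rw [AddEquiv.symm_apply_apply])) }

end Cohomology
/-! ## Holomorphic functions, locally free sheaves, split objects -/

section Split

/-- The ring of holomorphic functions on an open subset of a complex manifold of dimension `n`. -/
def Hol (n : ℕ) {M : Type u} [TopologicalSpace M] [ChartedSpace (EuclideanSpace ℂ (Fin n)) M]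
    (U : Opens M) : Type u :=
  C^ω⟮𝓘(ℂ, EuclideanSpace ℂ (Fin n)), U; 𝓘(ℂ), ℂ⟯

variable {n : ℕ} {M : Type u} [TopologicalSpace M] [ChartedSpace (EuclideanSpace ℂ (Fin n)) M]

noncomputable instance Hol.instCommRing (U : Opens M) : CommRing (Hol n U) :=
  inferInstanceAs (CommRing C^ω⟮𝓘(ℂ, EuclideanSpace ℂ (Fin n)), U; 𝓘(ℂ), ℂ⟯)

noncomputable instance Hol.instAlgebra (U : Opens M) : Algebra ℂ (Hol n U) :=
  inferInstanceAs (Algebra ℂ C^ω⟮𝓘(ℂ, EuclideanSpace ℂ (Fin n)), U; 𝓘(ℂ), ℂ⟯)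

/-- Restriction of holomorphic functions. -/
noncomputable def Hol.res {U V : Opens M} (h : U ≤ V) : Hol n V →ₐ[ℂ] Hol n U where
  toRingHom := ContMDiffMap.restrictRingHom 𝓘(ℂ, EuclideanSpace ℂ (Fin n)) 𝓘(ℂ) ℂ h
  commutes' _ := rfl

variable (n M) in
/-- A presheaf of modules over the sheaf `ℱ` of holomorphic functions on `M`. -/
structure HolMod where
  sec : Opens M → Type u
  [addCommGroup : ∀ U, AddCommGroup (sec U)]
  [module : ∀ U, Module (Hol n U) (sec U)]
  res : ∀ {U V : Opens M}, U ≤ V → (sec V →+ sec U)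
  res_self : ∀ (U : Opens M) (v : sec U), res (le_refl U) v = v
  res_res : ∀ {U V W : Opens M} (h : U ≤ V) (k : V ≤ W) (v : sec W),
    res h (res k v) = res (h.trans k) v
  res_smul : ∀ {U V : Opens M} (h : U ≤ V) (f : Hol n V) (v : sec V),
    res h (f • v) = Hol.res h f • res h v

attribute [instance] HolMod.addCommGroup HolMod.module

namespace HolMod

variable (G S S₀ S₁ : HolMod n M)

/-- The sheaf condition. -/
def IsSheaf : Prop :=
  ∀ (ι : Type u) (U : ι → Opens M) (s : ∀ i, G.sec (U i)),
    (∀ i j, G.res (inf_le_left : U i ⊓ U j ≤ U i) (s i) =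
      G.res (inf_le_right : U i ⊓ U j ≤ U j) (s j)) →
    ∃! f : G.sec (⨆ i, U i), ∀ i, G.res (le_iSup U i) f = s i

/-- `G|_U` is isomorphic to `(ℱ|_U)^r`. -/
def IsFreeOn (r : ℕ) (U : Opens M) : Prop :=
  ∃ e : ∀ V : Opens M, V ≤ U → (G.sec V ≃ₗ[Hol n V] (Fin r → Hol n V)),
    ∀ (V W : Opens M) (h : W ≤ V) (k : V ≤ U) (v : G.sec V) (i : Fin r),
      e W (h.trans k) (G.res h v) i = Hol.res h (e V k v i)

/-- `G` is a locally free sheaf of `ℱ`-modules of rank `r`. -/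
def IsLocallyFree (r : ℕ) : Prop :=
  G.IsSheaf ∧ ∀ x : M, ∃ U : Opens M, x ∈ U ∧ G.IsFreeOn r U

/-- The open sets on which `G` is free. -/
def IsTriv (U : Opens M) : Prop := ∃ r, G.IsFreeOn r U

/-- The exterior algebra of the module of sections over `U`. -/
abbrev Ext (U : Opens M) : Type u := ExteriorAlgebra (Hol n U) (G.sec U)

noncomputable instance instAlgebraExt (U : Opens M) : Algebra ℂ (G.Ext U) :=
  ((algebraMap (Hol n U) (G.Ext U)).comp (algebraMap ℂ (Hol n U))).toAlgebra'
    fun c x => Algebra.commutes (algebraMap ℂ (Hol n U) c) x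

instance instIsScalarTowerExt (U : Opens M) : IsScalarTower ℂ (Hol n U) (G.Ext U) :=
  IsScalarTower.of_algebraMap_eq fun c => rfl

variable {G} in
/-- The restriction homomorphism `⋀ G(V) → ⋀ G(U)`, `v₁ ∧ … ∧ v_k ↦ v₁|_U ∧ … ∧ v_k|_U`. -/
noncomputable def extRes {U V : Opens M} (h : U ≤ V) : G.Ext V →ₐ[ℂ] G.Ext U :=
  letI : Algebra (Hol n V) (G.Ext U) :=
    ((algebraMap (Hol n U) (G.Ext U)).comp (Hol.res h).toRingHom).toAlgebra'
      fun c x => Algebra.commutes (Hol.res h c) x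
  let f : G.sec V →ₗ[Hol n V] G.Ext U :=
    { toFun := fun v => ExteriorAlgebra.ι (Hol n U) (G.res h v)
      map_add' := fun v w => by rw [map_add, map_add]
      map_smul' := fun a v => by
        rw [G.res_smul, map_smul, Algebra.smul_def]
        rfl }
  let φ : G.Ext V →ₐ[Hol n V] G.Ext U :=
    ExteriorAlgebra.lift (Hol n V) ⟨f, fun v => ExteriorAlgebra.ι_sq_zero _⟩
  { φ.toRingHom with
    commutes' := fun c =>
      (φ.commutes (algebraMap ℂ (Hol n V) c)).trans
        (congrArg (algebraMap (Hol n U) (G.Ext U)) ((Hol.res h).commutes c)) }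

lemma extRes_ι {U V : Opens M} (h : U ≤ V) (v : G.sec V) :
    extRes h (ExteriorAlgebra.ι (Hol n V) v) = ExteriorAlgebra.ι (Hol n U) (G.res h v) := by
  let : Algebra (Hol n V) (G.Ext U) :=
    ((algebraMap (Hol n U) (G.Ext U)).comp (Hol.res h).toRingHom).toAlgebra'
      fun c x => Algebra.commutes (Hol.res h c) x
  exact ExteriorAlgebra.lift_ι_apply (Hol n V) _ _ v

lemma extRes_algebraMap {U V : Opens M} (h : U ≤ V) (f : Hol n V) :
    (extRes h (algebraMap (Hol n V) (G.Ext V) f)) =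
      algebraMap (Hol n U) (G.Ext U) (Hol.res h f) := by
  let : Algebra (Hol n V) (G.Ext U) :=
    ((algebraMap (Hol n U) (G.Ext U)).comp (Hol.res h).toRingHom).toAlgebra'
      fun c x => Algebra.commutes (Hol.res h c) x
  exact (ExteriorAlgebra.lift (Hol n V) (A := G.Ext U) _).commutes f

/-- The grade involution, `(-1)^p` on `⋀^p`. -/
noncomputable def extσ (U : Opens M) : G.Ext U →ₐ[Hol n U] G.Ext U := CliffordAlgebra.involute

lemma extσ_extσ (U : Opens M) (a : G.Ext U) : G.extσ U (G.extσ U a) = a :=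
  CliffordAlgebra.involute_involute a

lemma extRes_extσ {U V : Opens M} (h : U ≤ V) (a : G.Ext V) :
    extRes h (G.extσ V a) = G.extσ U (extRes h a) := by
  induction a using ExteriorAlgebra.induction with
  | algebraMap r => rw [AlgHom.commutes, extRes_algebraMap, AlgHom.commutes]
  | ι v =>
    have h1 : ∀ (W : Opens M) (w : G.sec W), G.extσ W (ExteriorAlgebra.ι (Hol n W) w) =
      -ExteriorAlgebra.ι (Hol n W) w := fun W w => CliffordAlgebra.involute_ι w
    rw [h1, map_neg, extRes_ι, h1]
  | mul a b ha hb => rw [map_mul, map_mul, ha, hb, map_mul, map_mul]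
  | add a b ha hb => rw [map_add, map_add, ha, hb, map_add, map_add]

/-- The sections of `⋀_ℱ G` over `U`: for a locally free sheaf `G` the sheaf `⋀_ℱ G` is the sheaf
whose sections over an open set `V` on which `G` is free are the elements of the exterior algebra of
the `ℱ(V)`-module `G(V)`, and a section over an arbitrary `U` is a compatible family of such
elements, for all these `V ⊆ U`. -/
noncomputable def splitSec (U : Opens M) :
    Subalgebra ℂ (∀ V : {V : Opens M // V ≤ U ∧ G.IsTriv V}, G.Ext V.1) where
  carrier := {s | ∀ (V W : {V : Opens M // V ≤ U ∧ G.IsTriv V}) (h : W.1 ≤ V.1),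
    extRes h (s V) = s W}
  mul_mem' {s t} hs ht V W h := by
    rw [Pi.mul_apply, Pi.mul_apply, map_mul, hs V W h, ht V W h]
  add_mem' {s t} hs ht V W h := by
    rw [Pi.add_apply, Pi.add_apply, map_add, hs V W h, ht V W h]
  algebraMap_mem' c V W h := by
    rw [Pi.algebraMap_apply, Pi.algebraMap_apply, AlgHom.commutes]

/-- Restriction of sections. -/
noncomputable def splitRes {U V : Opens M} (h : U ≤ V) : G.splitSec V →ₐ[ℂ] G.splitSec U where
  toFun s := ⟨fun W => s.1 ⟨W.1, W.2.1.trans h, W.2.2⟩, fun W W' k =>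
    s.2 ⟨W.1, W.2.1.trans h, W.2.2⟩ ⟨W'.1, W'.2.1.trans h, W'.2.2⟩ k⟩
  map_one' := rfl
  map_mul' _ _ := rfl
  map_zero' := rfl
  map_add' _ _ := rfl
  commutes' _ := rfl

/-- The parity involution, `(-1)^p` on `⋀^p`. -/
noncomputable def splitσ (U : Opens M) : G.splitSec U →ₐ[ℂ] G.splitSec U where
  toFun s := ⟨fun V => G.extσ V.1 (s.1 V), fun V W k => by rw [extRes_extσ, s.2 V W k]⟩
  map_one' := Subtype.ext (funext fun V => map_one (G.extσ V.1))
  map_mul' s t := Subtype.ext (funext fun V => map_mul (G.extσ V.1) (s.1 V) (t.1 V))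
  map_zero' := Subtype.ext (funext fun V => map_zero (G.extσ V.1))
  map_add' s t := Subtype.ext (funext fun V => map_add (G.extσ V.1) (s.1 V) (t.1 V))
  commutes' c := Subtype.ext (funext fun V => (G.extσ V.1).commutes (algebraMap ℂ (Hol n V.1) c))

/-- The structure sheaf `⋀_ℱ G` of a split supermanifold, as a sheaf of superalgebras. -/
noncomputable def splitAlg : SuperAlg M where
  sec U := G.splitSec U
  res h := G.splitRes h
  res_self _ _ := rfl
  res_res _ _ _ := rfl
  σ U := G.splitσ U
  σ_σ U s := Subtype.ext (funext fun V => G.extσ_extσ V.1 (s.1 V))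
  res_σ _ _ := rfl

/-- The sections of `⋀^p_ℱ G`. -/
noncomputable def splitAlgGr (p : ℕ) (U : Opens M) : Submodule ℂ (G.splitSec U) where
  carrier := {s | ∀ V, s.1 V ∈ ⋀[Hol n V.1]^p (G.sec V.1)}
  add_mem' {s t} hs ht V := add_mem (hs V) (ht V)
  zero_mem' V := zero_mem (⋀[Hol n V.1]^p (G.sec V.1))
  smul_mem' c s hs V := by
    have h := Submodule.smul_mem (⋀[Hol n V.1]^p (G.sec V.1)) (algebraMap ℂ (Hol n V.1) c) (hs V)
    rwa [algebraMap_smul] at h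

/-- The `ℤ`-grading `⋀_ℱ G = ⨁ ⋀^p_ℱ G`. -/
noncomputable def splitAlgGrading : AlgGrading G.splitAlg := fun p U => G.splitAlgGr p U

/-- `⋀ G(U) ⊗ (S₀(U) ⊕ S₁(U))`, tensor product over `ℱ(U)`. -/
abbrev Tens (U : Opens M) : Type u := G.Ext U ⊗[Hol n U] (S₀.sec U × S₁.sec U)

variable {G S₀ S₁} in
/-- The restriction homomorphism `a ⊗ (s₀, s₁) ↦ a|_U ⊗ (s₀|_U, s₁|_U)`. -/
noncomputable def tensRes {U V : Opens M} (h : U ≤ V) : G.Tens S₀ S₁ V →+ G.Tens S₀ S₁ U :=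
  TensorProduct.liftAddHom
    { toFun := fun a =>
        { toFun := fun s => extRes h a ⊗ₜ (S₀.res h s.1, S₁.res h s.2)
          map_zero' := by
            rw [Prod.fst_zero, Prod.snd_zero, map_zero, map_zero, Prod.mk_zero_zero,
              TensorProduct.tmul_zero]
          map_add' := fun s t => by
            rw [Prod.fst_add, Prod.snd_add, map_add, map_add, ← Prod.mk_add_mk,
              TensorProduct.tmul_add] }
      map_zero' := by ext s; simp
      map_add' := fun a b => by
        ext s
        change extRes h (a + b) ⊗ₜ _ = extRes h a ⊗ₜ _ + extRes h b ⊗ₜ _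
        rw [map_add, TensorProduct.add_tmul] }
    fun r a s => by
      change extRes h (r • a) ⊗ₜ _ = extRes h a ⊗ₜ (S₀.res h (r • s.1), S₁.res h (r • s.2))
      rw [Algebra.smul_def, map_mul, extRes_algebraMap, ← Algebra.smul_def, S₀.res_smul,
        S₁.res_smul, ← Prod.smul_mk, TensorProduct.smul_tmul]

lemma tensRes_tmul {U V : Opens M} (h : U ≤ V) (a : G.Ext V) (s : S₀.sec V × S₁.sec V) :
    tensRes h (a ⊗ₜ[Hol n V] s : G.Tens S₀ S₁ V) =
      extRes h a ⊗ₜ (S₀.res h s.1, S₁.res h s.2) := rfl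

lemma tensRes_smul {U V : Opens M} (h : U ≤ V) (a : G.Ext V) (t : G.Tens S₀ S₁ V) :
    tensRes h (a • t) = extRes h a • tensRes h t := by
  induction t using TensorProduct.induction_on with
  | zero => simp
  | tmul b s =>
    rw [TensorProduct.smul_tmul', smul_eq_mul, tensRes_tmul, tensRes_tmul, map_mul,
      TensorProduct.smul_tmul', smul_eq_mul]
  | add x y hx hy => rw [smul_add, map_add, map_add, hx, hy, smul_add]

/-- The parity involution of `⋀ G(U) ⊗ (S₀(U) ⊕ S₁(U))`, where `S₀` is even and `S₁` is odd. -/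
noncomputable def tensσ (U : Opens M) : G.Tens S₀ S₁ U →ₗ[Hol n U] G.Tens S₀ S₁ U :=
  TensorProduct.map (G.extσ U).toLinearMap (LinearMap.prodMap LinearMap.id (-LinearMap.id))

lemma tensσ_tmul {U : Opens M} (a : G.Ext U) (s : S₀.sec U × S₁.sec U) :
    G.tensσ S₀ S₁ U (a ⊗ₜ s) = G.extσ U a ⊗ₜ (s.1, -s.2) := rfl

lemma tensσ_tensσ (U : Opens M) (t : G.Tens S₀ S₁ U) :
    G.tensσ S₀ S₁ U (G.tensσ S₀ S₁ U t) = t := by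
  induction t using TensorProduct.induction_on with
  | zero => simp
  | tmul b s => rw [tensσ_tmul, tensσ_tmul, extσ_extσ, neg_neg]
  | add x y hx hy => rw [map_add, map_add, hx, hy]

lemma tensσ_smul (U : Opens M) (a : G.Ext U) (t : G.Tens S₀ S₁ U) :
    G.tensσ S₀ S₁ U (a • t) = G.extσ U a • G.tensσ S₀ S₁ U t := by
  induction t using TensorProduct.induction_on with
  | zero => simp
  | tmul b s =>
    rw [TensorProduct.smul_tmul', smul_eq_mul, tensσ_tmul, tensσ_tmul, map_mul,
      TensorProduct.smul_tmul', smul_eq_mul]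
  | add x y hx hy => rw [smul_add, map_add, map_add, hx, hy, smul_add]

lemma tensRes_tensσ {U V : Opens M} (h : U ≤ V) (t : G.Tens S₀ S₁ V) :
    tensRes h (G.tensσ S₀ S₁ V t) = G.tensσ S₀ S₁ U (tensRes h t) := by
  induction t using TensorProduct.induction_on with
  | zero => simp
  | tmul b s => rw [tensσ_tmul, tensRes_tmul, tensRes_tmul, tensσ_tmul, extRes_extσ, map_neg]
  | add x y hx hy => rw [map_add, map_add, map_add, map_add, hx, hy]

/-- The open subsets of `U` on which `G`, `S₀` and `S₁` are free. -/
abbrev TrivIn (U : Opens M) : Type u :=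
  {V : Opens M // V ≤ U ∧ G.IsTriv V ∧ S₀.IsTriv V ∧ S₁.IsTriv V}

/-- The sections of `(⋀_ℱ G) ⊗_ℱ (S₀ ⊕ S₁)` over `U`, for locally free `G`, `S₀`, `S₁`: compatible
families of elements of `⋀ G(V) ⊗ (S₀(V) ⊕ S₁(V))`, for all open `V ⊆ U` on which `G`, `S₀` and `S₁`
are free. -/
noncomputable def splitModSec (U : Opens M) :
    AddSubgroup (∀ V : G.TrivIn S₀ S₁ U, G.Tens S₀ S₁ V.1) where
  carrier := {s | ∀ (V W : G.TrivIn S₀ S₁ U) (h : W.1 ≤ V.1), tensRes h (s V) = s W}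
  add_mem' {s t} hs ht V W h := by
    rw [Pi.add_apply, Pi.add_apply, map_add, hs V W h, ht V W h]
  zero_mem' V W h := by rw [Pi.zero_apply, Pi.zero_apply, map_zero]
  neg_mem' {s} hs V W h := by
    rw [Pi.neg_apply, Pi.neg_apply, map_neg, hs V W h]

noncomputable instance instModuleSplitModSec (U : Opens M) :
    Module (G.splitSec U) (G.splitModSec S₀ S₁ U) where
  smul a s := ⟨fun V => a.1 ⟨V.1, V.2.1, V.2.2.1⟩ • s.1 V, fun V W h => by
    rw [tensRes_smul, s.2 V W h, a.2 ⟨V.1, V.2.1, V.2.2.1⟩ ⟨W.1, W.2.1, W.2.2.1⟩ h]⟩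
  one_smul s := Subtype.ext (funext fun V => one_smul _ _)
  mul_smul a b s := Subtype.ext (funext fun V => mul_smul _ _ _)
  smul_zero a := Subtype.ext (funext fun V => smul_zero _)
  smul_add a s t := Subtype.ext (funext fun V => smul_add _ _ _)
  add_smul a b s := Subtype.ext (funext fun V => add_smul _ _ _)
  zero_smul s := Subtype.ext (funext fun V => zero_smul _ _)

/-- Restriction of sections. -/
noncomputable def splitModRes {U V : Opens M} (h : U ≤ V) :
    G.splitModSec S₀ S₁ V →+ G.splitModSec S₀ S₁ U where
  toFun s := ⟨fun W => s.1 ⟨W.1, W.2.1.trans h, W.2.2⟩, fun W W' k =>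
    s.2 ⟨W.1, W.2.1.trans h, W.2.2⟩ ⟨W'.1, W'.2.1.trans h, W'.2.2⟩ k⟩
  map_zero' := rfl
  map_add' _ _ := rfl

/-- The parity involution. -/
noncomputable def splitModσ (U : Opens M) :
    G.splitModSec S₀ S₁ U →+ G.splitModSec S₀ S₁ U where
  toFun s := ⟨fun V => G.tensσ S₀ S₁ V.1 (s.1 V), fun V W k => by rw [tensRes_tensσ, s.2 V W k]⟩
  map_zero' := Subtype.ext (funext fun V => map_zero (G.tensσ S₀ S₁ V.1))
  map_add' s t := Subtype.ext (funext fun V => map_add (G.tensσ S₀ S₁ V.1) (s.1 V) (t.1 V))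

/-- The sheaf of `ZMod 2`-graded modules `(⋀_ℱ G) ⊗_ℱ S` with `S = S₀ ⊕ S₁`, over `⋀_ℱ G`. -/
noncomputable def splitMod : SuperMod G.splitAlg where
  sec U := G.splitModSec S₀ S₁ U
  module U := G.instModuleSplitModSec S₀ S₁ U
  res h := G.splitModRes S₀ S₁ h
  res_self _ _ := rfl
  res_res _ _ _ := rfl
  res_smul _ _ _ := rfl
  σ U := G.splitModσ S₀ S₁ U
  σ_σ U s := Subtype.ext (funext fun V => G.tensσ_tensσ S₀ S₁ V.1 (s.1 V))
  σ_smul U a s := Subtype.ext (funext fun V =>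
    G.tensσ_smul S₀ S₁ V.1 (a.1 ⟨V.1, V.2.1, V.2.2.1⟩) (s.1 V))
  res_σ _ _ := rfl

/-- The submodule `⋀^p G(U) ⊗ (S₀(U) ⊕ S₁(U))` (its image in `⋀ G(U) ⊗ (S₀(U) ⊕ S₁(U))`). -/
noncomputable def tensGr (p : ℕ) (U : Opens M) : Submodule (Hol n U) (G.Tens S₀ S₁ U) :=
  LinearMap.range (TensorProduct.map (⋀[Hol n U]^p (G.sec U)).subtype
    (LinearMap.id : (S₀.sec U × S₁.sec U) →ₗ[Hol n U] (S₀.sec U × S₁.sec U)))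

/-- The sections of `(⋀^p_ℱ G) ⊗_ℱ S`. -/
noncomputable def splitModGr (p : ℕ) (U : Opens M) : AddSubgroup (G.splitModSec S₀ S₁ U) where
  carrier := {s | ∀ V, s.1 V ∈ G.tensGr S₀ S₁ p V.1}
  add_mem' {s t} hs ht V := add_mem (hs V) (ht V)
  zero_mem' V := zero_mem (G.tensGr S₀ S₁ p V.1)
  neg_mem' {s} hs V := neg_mem (hs V)

/-- The `ℤ`-grading of `(⋀_ℱ G) ⊗_ℱ S`, with components `(⋀^p_ℱ G) ⊗_ℱ S`. -/
noncomputable def splitModGrading : ModGrading (G.splitMod S₀ S₁) :=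
  fun p U => G.splitModGr S₀ S₁ p U

/-- The pair `(𝒪_gr, E_gr)` with `𝒪_gr = ⋀_ℱ G` and `E_gr = 𝒪_gr ⊗_ℱ S`, where `S = S₀ ⊕ S₁`. -/
noncomputable def splitPair : SuperPair M := ⟨G.splitAlg, G.splitMod S₀ S₁⟩

end HolMod

/-! ## Supermanifolds and locally free sheaves on them -/

variable (n M) in
/-- The sheaf `ℱ ⊗ ⋀(ξ_1, …, ξ_m)` on `M`; over a coordinate domain of `M` this is (the pull-back of)
the structure sheaf of a superdomain in `ℂ^{n|m}`. -/
noncomputable def modelAlg (m : ℕ) : SuperAlg M where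
  sec U := Hol n U ⊗[ℂ] ExteriorAlgebra ℂ (Fin m → ℂ)
  res h := Algebra.TensorProduct.map (Hol.res h) (AlgHom.id ℂ _)
  res_self U f := AlgHom.congr_fun Algebra.TensorProduct.map_id f
  res_res h k f := (AlgHom.congr_fun (Algebra.TensorProduct.map_comp
    (Hol.res h) (Hol.res k) (AlgHom.id ℂ _) (AlgHom.id ℂ _)) f).symm
  σ U := Algebra.TensorProduct.map (AlgHom.id ℂ (Hol n U)) CliffordAlgebra.involute
  σ_σ U f := by
    have h := Algebra.TensorProduct.map_comp (AlgHom.id ℂ (Hol n U)) (AlgHom.id ℂ (Hol n U))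
      (CliffordAlgebra.involute (Q := (0 : QuadraticForm ℂ (Fin m → ℂ)))) CliffordAlgebra.involute
    rw [CliffordAlgebra.involute_comp_involute, AlgHom.comp_id, Algebra.TensorProduct.map_id] at h
    exact (AlgHom.congr_fun h f).symm
  res_σ {U V} h f := by
    have h1 := Algebra.TensorProduct.map_comp (Hol.res (n := n) h) (AlgHom.id ℂ (Hol n V))
      (AlgHom.id ℂ _) (CliffordAlgebra.involute (Q := (0 : QuadraticForm ℂ (Fin m → ℂ))))
    have h2 := Algebra.TensorProduct.map_comp (AlgHom.id ℂ (Hol n U)) (Hol.res (n := n) h)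
      (CliffordAlgebra.involute (Q := (0 : QuadraticForm ℂ (Fin m → ℂ)))) (AlgHom.id ℂ _)
    rw [AlgHom.comp_id, AlgHom.id_comp] at h1 h2
    exact (AlgHom.congr_fun h1 f).symm.trans (AlgHom.congr_fun h2 f)

variable (n) in
/-- `(M, A)` is a supermanifold of dimension `n|m` whose reduction is the complex manifold `M`: the
sheaf of superalgebras `A` is locally isomorphic to `ℱ ⊗ ⋀(ξ_1, …, ξ_m)`. -/
def IsSupermanifold (m : ℕ) (A : SuperAlg M) : Prop :=
  A.IsSheaf ∧ ∀ x : M, ∃ U : Opens M, x ∈ U ∧ Nonempty (AlgIso U A (modelAlg n M m))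

/-- The free sheaf of modules `A^p ⊕ Π(A)^q`. -/
def freeMod (A : SuperAlg M) (p q : ℕ) : SuperMod A where
  sec U := (Fin p → A.sec U) × (Fin q → A.sec U)
  res h :=
    { toFun := fun v => (fun i => A.res h (v.1 i), fun j => A.res h (v.2 j))
      map_zero' := by ext <;> simp
      map_add' := fun v w => by ext <;> simp }
  res_self U v := by ext <;> simp [A.res_self]
  res_res h k v := by ext <;> simp [A.res_res]
  res_smul h f v := by ext <;> simp
  σ U :=
    { toFun := fun v => (fun i => A.σ U (v.1 i), fun j => -A.σ U (v.2 j))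
      map_zero' := by ext <;> simp
      map_add' := fun v w => by ext <;> simp [add_comm] }
  σ_σ U v := by ext <;> simp [A.σ_σ]
  σ_smul U f v := by ext <;> simp
  res_σ h v := by ext <;> simp [A.res_σ]

/-- `E` is a locally free sheaf of `A`-modules of rank `p|q`. -/
def SuperMod.IsLocallyFree {A : SuperAlg M} (p q : ℕ) (E : SuperMod A) : Prop :=
  E.IsSheaf ∧ ∀ x : M, ∃ U : Opens M, x ∈ U ∧
    ∃ φ : QuasiIso U ⟨A, E⟩ ⟨A, freeMod A p q⟩, φ.toAlgIso = AlgIso.refl U A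

/-! ## The sets of isomorphism classes -/

/-- A supermanifold `(M, 𝒪)` of odd dimension `m` with `gr 𝒪 ≅ ⋀_ℱ G`. -/
structure SupermanifoldWithRetract (G : HolMod n M) (m : ℕ) where
  alg : SuperAlg M
  isSupermanifold : IsSupermanifold n m alg
  retract : Nonempty (AlgRetractIso alg G.splitAlg G.splitAlgGrading)

/-- A locally free sheaf `E` of rank `p|q` on a supermanifold `(M, 𝒪)` of odd dimension `m`, with
`(gr 𝒪, gr E) ≅ (𝒪_gr, E_gr)`, where `𝒪_gr = ⋀_ℱ G` and `E_gr = 𝒪_gr ⊗_ℱ (S₀ ⊕ S₁)`. -/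
structure SheafWithRetract (G S₀ S₁ : HolMod n M) (m p q : ℕ) where
  pair : SuperPair M
  isSupermanifold : IsSupermanifold n m pair.alg
  isLocallyFree : pair.mod.IsLocallyFree p q
  retract : Nonempty (RetractIso pair (G.splitPair S₀ S₁) G.splitAlgGrading
    (G.splitModGrading S₀ S₁))

/-- Isomorphism of supermanifolds, inducing the identity of `M`. -/
instance supermanifoldSetoid (G : HolMod n M) (m : ℕ) : Setoid (SupermanifoldWithRetract G m) where
  r A B := Nonempty (AlgIso ⊤ A.alg B.alg)
  iseqv := ⟨fun A => ⟨AlgIso.refl _ _⟩, fun ⟨φ⟩ => ⟨φ.symm⟩, fun ⟨φ⟩ ⟨ψ⟩ => ⟨φ.trans ψ⟩⟩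

/-- Quasi-isomorphism of locally free sheaves. -/
instance sheafSetoid (G S₀ S₁ : HolMod n M) (m p q : ℕ) :
    Setoid (SheafWithRetract G S₀ S₁ m p q) where
  r X Y := Nonempty (QuasiIso ⊤ X.pair Y.pair)
  iseqv := ⟨fun A => ⟨QuasiIso.refl _ _⟩, fun ⟨φ⟩ => ⟨φ.symm⟩, fun ⟨φ⟩ ⟨ψ⟩ => ⟨φ.trans ψ⟩⟩

/-- The set `{[(M, 𝒪)] | gr 𝒪 = 𝒪_gr}`. -/
abbrev SupermanifoldClass (G : HolMod n M) (m : ℕ) : Type (u + 1) :=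
  Quotient (supermanifoldSetoid G m)

/-- The set `{[E] | gr 𝒪 = 𝒪_gr, gr E = E_gr}`. -/
abbrev SheafClass (G S₀ S₁ : HolMod n M) (m p q : ℕ) : Type (u + 1) :=
  Quotient (sheafSetoid G S₀ S₁ m p q)

/-- The class of the supermanifold on which a locally free sheaf lives. -/
def SheafClass.base {G S₀ S₁ : HolMod n M} {m p q : ℕ} :
    SheafClass G S₀ S₁ m p q → SupermanifoldClass G m :=
  Quotient.map (fun X => ⟨X.pair.alg, X.isSupermanifold, X.retract.map RetractIso.toAlgRetractIso⟩)
    fun _ _ ⟨φ⟩ => ⟨φ.toAlgIso⟩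

/-- The orbit set `H¹(M, 𝒜ut_(2) 𝒪_gr) / H⁰(M, 𝒜ut_0 𝒪_gr)`. -/
abbrev GreenSet (G : HolMod n M) : Type (u + 1) := AutOrbits G.splitAlg G.splitAlgGrading

/-- The orbit set `H¹(M, 𝒬𝒜ut_(1)(2) E_gr) / H⁰(M, 𝒬𝒜ut_0 E_gr)`. -/
abbrev SheafOrbits (G S₀ S₁ : HolMod n M) : Type (u + 1) :=
  QautOrbits (G.splitPair S₀ S₁) G.splitAlgGrading (G.splitModGrading S₀ S₁)

/-- The map `F̃ : H¹(M, 𝒬𝒜ut_(1)(2) E_gr) / H⁰(M, 𝒬𝒜ut_0 E_gr) →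
H¹(M, 𝒜ut_(2) 𝒪_gr) / H⁰(M, 𝒜ut_0 𝒪_gr)` induced by `Φ_Ψ ↦ Ψ`. -/
noncomputable def Ftilde (G S₀ S₁ : HolMod n M) : SheafOrbits G S₀ S₁ → GreenSet G :=
  orbitBase (G.splitPair S₀ S₁) G.splitAlgGrading (G.splitModGrading S₀ S₁)

end Split
end SuperGeom

/-! The classification is a torsor argument relative to the graded pair `Y = (𝒪_gr, E_gr)`. If `X =
(𝒪, E)` has retract isomorphic to `Y`, then `X` and `Y` are both locally quasi-isomorphic to the
free module of rank `p|q` over `ℱ ⊗ ⋀(ξ₁, …, ξ_m)`, hence to each other. What has to be arranged is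
that the local quasi-isomorphisms all induce one and the same isomorphism of retracts `r : gr X →
Y`.

The sheaves of `Y` carry a finite grading in which `𝒥 ^ k` and `𝒥 ^ k E` consist exactly of the
sections without components in degrees below `k` (`AlgGradingData.mem_Jpow`,
`ModGradingData.mem_filt`). Hence a section of the `k`-th filtration step of `X` has a leading
component of degree `k` in every chart. Given `φ : Y|_U → X|_U`, sending each homogeneous component
`sᵢ` to the image under `r` of the class of `φ sᵢ` defines a quasi-automorphism of `Y|_U` that
preserves the gradings (`RetractIso.gradedQuasiIso`), and the inverse of `φ` followed by it induces
`r` (`RetractIso.modCompat_gradedQuasiIso`). Charts that induce the same `r` differ by sections of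
`𝒬𝒜ut_(1)(2)` (`RetractIso.ModCompat.transition`), so `X` has an atlas. The level `2` on the algebra
comes from parity: agreement on `𝒥 ^ 0 / 𝒥` and on `𝒥 / 𝒥 ^ 2` already forces agreement modulo `𝒥 ^
2`, because an even section has no component of degree one. Conversely an atlas determines an
isomorphism of retracts, since leading terms seen in different charts agree and glue
(`Atlas.retractIso`).

The orbit is well defined because, for two atlases of the same `X`, the retract isomorphism of one
and the charts of the other give graded local quasi-automorphisms of `Y`; these glue to an element
of `H⁰(𝒬𝒜ut_0)` that carries one cohomology class to the other (`Atlas.exists_smul_eq`). The map is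
injective because a coboundary between two cocycles glues local quasi-isomorphisms to a global one
(`Atlas.nonempty_iso_of_rel`), a conjugating automorphism being absorbed into the charts. It is
surjective because any cocycle glues copies of `Y` to a pair whose tautological atlas has that
cocycle (`Cocycle.gluePair`, `Cocycle.cocycle_glueModAtlas`).

The same argument without modules gives Green's bijection. Forgetting the module part of an atlas of
`E` leaves an atlas of `𝒪`, so `F̃` corresponds to passing from `E` to the supermanifold on which it
lives (`Ftilde_sheafMap`); the description of the fibres of `F̃` is then formal. -/

namespace SuperGeom

/-! ### Gluing of sections, and locality of the filtrations by powers of the odd ideal. -/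

section SheafTools

variable {M : Type u} [TopologicalSpace M]

/-- A presheaf of types on `M`. -/
structure TypePresheaf (M : Type u) [TopologicalSpace M] where
  sec : Opens M → Type u
  res : ∀ {U V : Opens M}, U ≤ V → sec V → sec U
  res_self : ∀ (U : Opens M) (f : sec U), res (le_refl U) f = f
  res_res : ∀ {U V W : Opens M} (h : U ≤ V) (k : V ≤ W) (f : sec W),
    res h (res k f) = res (h.trans k) f

namespace TypePresheaf

variable (P Q : TypePresheaf M)

/-- The sheaf condition for the open set `V`: sections over a covering of `V`, given on all the open
subsets of `V` that are subordinate to the covering, glue uniquely. -/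
def GluesOn (V : Opens M) : Prop :=
  ∀ (ι : Type u) (U : ι → Opens M) (_ : ∀ x ∈ V, ∃ i, x ∈ U i),
    (∀ f g : P.sec V, (∀ i T (h : T ≤ V), T ≤ U i → P.res h f = P.res h g) → f = g) ∧
    ∀ s : ∀ i (T : Opens M), T ≤ V → T ≤ U i → P.sec T,
      (∀ i T T' (h : T ≤ V) (k : T ≤ U i) (l : T' ≤ T),
        P.res l (s i T h k) = s i T' (l.trans h) (l.trans k)) →
      (∀ i j T (h : T ≤ V) (k : T ≤ U i) (k' : T ≤ U j), s i T h k = s j T h k') →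
      ∃ f : P.sec V, ∀ i T (h : T ≤ V) (k : T ≤ U i), P.res h f = s i T h k

/-- The sheaf condition. -/
def IsSheaf : Prop :=
  ∀ (ι : Type u) (U : ι → Opens M) (s : ∀ i, P.sec (U i)),
    (∀ i j, P.res (inf_le_left : U i ⊓ U j ≤ U i) (s i) =
      P.res (inf_le_right : U i ⊓ U j ≤ U j) (s j)) →
    ∃! f : P.sec (⨆ i, U i), ∀ i, P.res (le_iSup U i) f = s i

variable {P Q}

/-- The members of the covering may stick out of `V`; intersecting them with `V` gives a family with
union exactly `V`, to which the sheaf condition applies. -/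
lemma IsSheaf.gluesOn (hP : P.IsSheaf) (V : Opens M) : P.GluesOn V := by
  intro ι U hU
  have hV : (⨆ i, V ⊓ U i) = V := by
    refine le_antisymm (iSup_le fun i => inf_le_left) fun x hx => ?_
    obtain ⟨i, hi⟩ := hU x hx
    exact Opens.mem_iSup.2 ⟨i, hx, hi⟩
  -- The open set is generalised to `V'` so that its equality with the union can be substituted;
  -- sections over the two sets have different types.
  have key : ∀ (V' : Opens M) (_ : V' = ⨆ i, V ⊓ U i) (hle : ∀ i, V ⊓ U i ≤ V')
      (s : ∀ i, P.sec (V ⊓ U i)),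
      (∀ i j, P.res (inf_le_left : (V ⊓ U i) ⊓ (V ⊓ U j) ≤ V ⊓ U i) (s i) =
        P.res (inf_le_right : (V ⊓ U i) ⊓ (V ⊓ U j) ≤ V ⊓ U j) (s j)) →
      ∃! f : P.sec V', ∀ i, P.res (hle i) f = s i := by
    rintro _ rfl _ s hs
    exact hP ι (fun i => V ⊓ U i) s hs
  have key := key V hV.symm fun i => inf_le_left
  refine ⟨fun f g hfg => ?_, fun s hs hs' => ?_⟩
  · obtain ⟨_, _, hu⟩ := key (fun i => P.res inf_le_left f) fun i j => by
      rw [P.res_res, P.res_res]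
    rw [hu f fun i => rfl, hu g fun i => (hfg i _ inf_le_left inf_le_right).symm]
  · obtain ⟨f, hf, _⟩ := key (fun i => s i (V ⊓ U i) inf_le_left inf_le_right) fun i j => by
      rw [hs, hs]; exact hs' _ _ _ _ _ _
    refine ⟨f, fun i T h k => ?_⟩
    rw [← P.res_res (le_inf h k) inf_le_left, hf, hs]

lemma isSheaf_of_gluesOn (hP : ∀ V, P.GluesOn V) : P.IsSheaf := by
  intro ι U s hs
  obtain ⟨h1, h2⟩ := hP (⨆ i, U i) ι U fun x hx => Opens.mem_iSup.1 hx
  obtain ⟨f, hf⟩ := h2 (fun i T h k => P.res k (s i))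
    (fun i T T' h k l => P.res_res _ _ _) (fun i j T h k k' => by
      rw [← P.res_res (le_inf k k') inf_le_left, hs, P.res_res])
  refine ⟨f, fun i => (hf i _ (le_iSup U i) le_rfl).trans (P.res_self _ _), fun g hg => ?_⟩
  refine h1 _ _ fun i T h k => ?_
  rw [hf i T h k, ← hg i, P.res_res]

/-- The sheaf condition can be transported along an isomorphism over `V`. -/
lemma GluesOn.of_equiv {V : Opens M} (e : ∀ W : Opens M, W ≤ V → (P.sec W ≃ Q.sec W))
    (he : ∀ (W W' : Opens M) (h : W' ≤ W) (k : W ≤ V) (f : P.sec W),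
      Q.res h (e W k f) = e W' (h.trans k) (P.res h f)) (hQ : Q.GluesOn V) : P.GluesOn V := by
  intro ι U hU
  obtain ⟨h1, h2⟩ := hQ ι U hU
  refine ⟨fun f g hfg => (e V le_rfl).injective (h1 _ _ fun i T h k => ?_), fun s hs hs' => ?_⟩
  · rw [he, he, hfg i T h k]
  · obtain ⟨f, hf⟩ := h2 (fun i T h k => e T h (s i T h k))
      (fun i T T' h k l => by rw [he, hs]) (fun i j T h k k' => by rw [hs' i j T h k k'])
    refine ⟨(e V le_rfl).symm f, fun i T h k => (e T h).injective ?_⟩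
    rw [← he _ _ h le_rfl, Equiv.apply_symm_apply, hf i T h k]

/-- A presheaf is a sheaf if it glues on the members of a class of open sets that is closed under
passing to smaller sets, and if its sections are the compatible families of sections over the members
of this class. -/
lemma isSheaf_of_basis (B : Opens M → Prop) (hB : ∀ V W : Opens M, W ≤ V → B V → B W)
    (hg : ∀ V, B V → P.GluesOn V)
    (hs : ∀ V (f g : P.sec V), (∀ W (h : W ≤ V), B W → P.res h f = P.res h g) → f = g)
    (hl : ∀ V (s : ∀ W, W ≤ V → B W → P.sec W),
      (∀ W W' (h : W ≤ V) (b : B W) (l : W' ≤ W),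
        P.res l (s W h b) = s W' (l.trans h) (hB W W' l b)) →
      ∃ f : P.sec V, ∀ W (h : W ≤ V) (b : B W), P.res h f = s W h b) : P.IsSheaf := by
  refine isSheaf_of_gluesOn fun V ι U hU => ⟨fun f g hfg => hs V f g fun W h b => ?_, ?_⟩
  · refine (hg W b ι U fun x hx => hU x (h hx)).1 _ _ fun i T h' k => ?_
    rw [P.res_res, P.res_res, hfg i T (h'.trans h) k]
  · intro s h1 h2
    -- Gluing is carried out on each basic open set separately; uniqueness there makes the results
    -- compatible, and `hl` assembles them to a section over `V`.
    have : ∀ W (h : W ≤ V), B W → ∃ f : P.sec W, ∀ i T (h' : T ≤ W) (k : T ≤ U i),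
        P.res h' f = s i T (h'.trans h) k := fun W h b =>
      (hg W b ι U fun x hx => hU x (h hx)).2 (fun i T h' k => s i T (h'.trans h) k)
        (fun i T T' h' k l => h1 _ _ _ _ _ _) (fun i j T h' k k' => h2 _ _ _ _ _ _)
    choose f hf using this
    obtain ⟨F, hF⟩ := hl V f fun W W' h b l => by
      refine (hg W' (hB W W' l b) ι U fun x hx => hU x (h (l hx))).1 _ _ fun i T h' k => ?_
      rw [P.res_res, hf _ _ _ i _ _ k, hf _ _ _ i _ _ k]
    -- A basic subset of `T` is itself subordinate to `U i`, so the local gluing on it is the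
    -- prescribed section.
    refine ⟨F, fun i T h k => hs T _ _ fun W h' b => ?_⟩
    rw [P.res_res, hF W (h'.trans h) b, ← P.res_self W (f W _ b), hf W _ b i W le_rfl (h'.trans k),
      h1]

/-- A product of sheaves is a sheaf. -/
lemma GluesOn.pi {J : Type*} (R : J → TypePresheaf M) {V : Opens M}
    (e : ∀ W : Opens M, P.sec W ≃ ∀ j, (R j).sec W)
    (he : ∀ (W W' : Opens M) (h : W' ≤ W) (f : P.sec W) (j : J),
      e W' (P.res h f) j = (R j).res h (e W f j))
    (hR : ∀ j, (R j).GluesOn V) : P.GluesOn V := by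
  intro ι U hU
  refine ⟨fun f g hfg => (e V).injective (funext fun j => ?_), fun s hs hs' => ?_⟩
  · refine (hR j ι U hU).1 _ _ fun i T h k => ?_
    rw [← he, ← he, hfg i T h k]
  · have := fun j => (hR j ι U hU).2 (fun i T h k => e T (s i T h k) j)
      (fun i T T' h k l => by rw [← he, hs]) (fun i j' T h k k' => by rw [hs' i j' T h k k'])
    choose f hf using this
    refine ⟨(e V).symm f, fun i T h k => (e T).injective (funext fun j => ?_)⟩
    rw [he, Equiv.apply_symm_apply, hf]

end TypePresheaf

namespace SuperAlg

variable {A B : SuperAlg M}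

/-- The underlying presheaf of types. -/
def toTypePresheaf (A : SuperAlg M) : TypePresheaf M where
  sec := A.sec
  res h := A.res h
  res_self := A.res_self
  res_res := A.res_res

lemma isSheaf_iff : A.IsSheaf ↔ A.toTypePresheaf.IsSheaf := Iff.rfl

lemma IsSheaf.sep (hA : A.IsSheaf) {V : Opens M} {ι : Type u} {U : ι → Opens M}
    (hU : ∀ x ∈ V, ∃ i, x ∈ U i) {f g : A.sec V}
    (h : ∀ i T (h : T ≤ V), T ≤ U i → A.res h f = A.res h g) : f = g :=
  ((isSheaf_iff.1 hA).gluesOn V ι U hU).1 f g h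

lemma IsSheaf.glue (hA : A.IsSheaf) {V : Opens M} {ι : Type u} {U : ι → Opens M}
    (hU : ∀ x ∈ V, ∃ i, x ∈ U i) (s : ∀ i (T : Opens M), T ≤ V → T ≤ U i → A.sec T)
    (h1 : ∀ i T T' (h : T ≤ V) (k : T ≤ U i) (l : T' ≤ T),
        A.res l (s i T h k) = s i T' (l.trans h) (l.trans k))
    (h2 : ∀ i j T (h : T ≤ V) (k : T ≤ U i) (k' : T ≤ U j), s i T h k = s j T h k') :
    ∃ f : A.sec V, ∀ i T (h : T ≤ V) (k : T ≤ U i), A.res h f = s i T h k :=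
  ((isSheaf_iff.1 hA).gluesOn V ι U hU).2 s h1 h2

/-- Sections that agree locally are equal. -/
lemma IsSheaf.sep' (hA : A.IsSheaf) {V : Opens M} {f g : A.sec V}
    (h : ∀ x ∈ V, ∃ (W : Opens M) (h : W ≤ V), x ∈ W ∧ A.res h f = A.res h g) : f = g := by
  choose W hW hx hfg using h
  refine hA.sep (ι := V) (U := fun x => W x.1 x.2) (fun x hx' => ⟨⟨x, hx'⟩, hx x hx'⟩) ?_
  intro i T k l
  rw [← A.res_res l (hW i.1 i.2), hfg, A.res_res]

lemma Jpow_of_local {p : ℕ} {V : Opens M} {f : A.sec V}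
    (h : ∀ x ∈ V, ∃ (W : Opens M) (h : W ≤ V), x ∈ W ∧ A.res h f ∈ A.Jpow p W) :
    f ∈ A.Jpow p V := fun x hx => by
  obtain ⟨W, hW, hxW, hf⟩ := h x hx
  obtain ⟨W', hW', hxW', hf'⟩ := hf x hxW
  exact ⟨W', hW'.trans hW, hxW', by rwa [A.res_res] at hf'⟩

lemma mem_Jpow_zero {V : Opens M} (f : A.sec V) : f ∈ A.Jpow 0 V := fun x hx =>
  ⟨V, le_rfl, hx, by simp [oddIdealPow]⟩

lemma oddIdealPow_le_Jpow (p : ℕ) (V : Opens M) : A.oddIdealPow p V ≤ A.Jpow p V :=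
  fun f hf x hx => ⟨V, le_rfl, hx, by rwa [A.res_self]⟩

lemma odd_le_Jpow_one (V : Opens M) : A.odd V ≤ A.Jpow 1 V := fun f hf => by
  refine oddIdealPow_le_Jpow 1 V ?_
  have h1 : (1 : A.sec V) ∈ (⊤ : Submodule ℂ (A.sec V)) := trivial
  have := Submodule.mul_mem_mul h1 (Submodule.mul_mem_mul (Submodule.mul_mem_mul h1 hf) h1)
  rw [one_mul, one_mul, mul_one] at this
  simpa [oddIdealPow, oddIdeal] using this

lemma Jpow_succ_le (p : ℕ) (V : Opens M) : A.Jpow (p + 1) V ≤ A.Jpow p V := fun f hf x hx => by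
  obtain ⟨W, hW, hxW, hfW⟩ := hf x hx
  refine ⟨W, hW, hxW, ?_⟩
  have : A.oddIdealPow (p + 1) W ≤ A.oddIdealPow p W := by
    unfold oddIdealPow
    rw [pow_succ', ← mul_assoc]
    exact mul_le_mul' le_top le_rfl
  exact this hfW

lemma Jpow_antitone {p q : ℕ} (h : p ≤ q) (V : Opens M) : A.Jpow q V ≤ A.Jpow p V :=
  antitone_nat_of_succ_le (f := fun p => A.Jpow p V) (fun p => Jpow_succ_le p V) h

lemma symb_eq_symb {p : ℕ} {V : Opens M} {f g : A.sec V} {hf : f ∈ A.Jpow p V}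
    {hg : g ∈ A.Jpow p V} : symb f hf = symb g hg ↔ f - g ∈ A.Jpow (p + 1) V := by
  unfold symb
  rw [Submodule.Quotient.eq]
  exact Iff.rfl

end SuperAlg

namespace SuperMod

variable {A : SuperAlg M} {E : SuperMod A}

/-- The underlying presheaf of types. -/
def toTypePresheaf (E : SuperMod A) : TypePresheaf M where
  sec := E.sec
  res h := E.res h
  res_self := E.res_self
  res_res := E.res_res

lemma isSheaf_iff : E.IsSheaf ↔ E.toTypePresheaf.IsSheaf := Iff.rfl

lemma IsSheaf.sep (hE : E.IsSheaf) {V : Opens M} {ι : Type u} {U : ι → Opens M}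
    (hU : ∀ x ∈ V, ∃ i, x ∈ U i) {f g : E.sec V}
    (h : ∀ i T (h : T ≤ V), T ≤ U i → E.res h f = E.res h g) : f = g :=
  ((isSheaf_iff.1 hE).gluesOn V ι U hU).1 f g h

lemma IsSheaf.glue (hE : E.IsSheaf) {V : Opens M} {ι : Type u} {U : ι → Opens M}
    (hU : ∀ x ∈ V, ∃ i, x ∈ U i) (s : ∀ i (T : Opens M), T ≤ V → T ≤ U i → E.sec T)
    (h1 : ∀ i T T' (h : T ≤ V) (k : T ≤ U i) (l : T' ≤ T),
        E.res l (s i T h k) = s i T' (l.trans h) (l.trans k))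
    (h2 : ∀ i j T (h : T ≤ V) (k : T ≤ U i) (k' : T ≤ U j), s i T h k = s j T h k') :
    ∃ f : E.sec V, ∀ i T (h : T ≤ V) (k : T ≤ U i), E.res h f = s i T h k :=
  ((isSheaf_iff.1 hE).gluesOn V ι U hU).2 s h1 h2

/-- Sections that agree locally are equal. -/
lemma IsSheaf.sep' (hE : E.IsSheaf) {V : Opens M} {f g : E.sec V}
    (h : ∀ x ∈ V, ∃ (W : Opens M) (h : W ≤ V), x ∈ W ∧ E.res h f = E.res h g) : f = g := by
  choose W hW hx hfg using h
  refine hE.sep (ι := V) (U := fun x => W x.1 x.2) (fun x hx' => ⟨⟨x, hx'⟩, hx x hx'⟩) ?_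
  intro i T k l
  rw [← E.res_res l (hW i.1 i.2), hfg, E.res_res]

lemma filt_of_local {p : ℕ} {V : Opens M} {v : E.sec V}
    (h : ∀ x ∈ V, ∃ (W : Opens M) (h : W ≤ V), x ∈ W ∧ E.res h v ∈ E.filt p W) :
    v ∈ E.filt p V := fun x hx => by
  obtain ⟨W, hW, hxW, hf⟩ := h x hx
  obtain ⟨W', hW', hxW', hf'⟩ := hf x hxW
  exact ⟨W', hW'.trans hW, hxW', by rwa [E.res_res] at hf'⟩

lemma preFilt_le_filt (p : ℕ) (V : Opens M) : E.preFilt p V ≤ E.filt p V :=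
  fun f hf x hx => ⟨V, le_rfl, hx, by rwa [E.res_self]⟩

lemma mem_filt_zero {V : Opens M} (v : E.sec V) : v ∈ E.filt 0 V :=
  preFilt_le_filt 0 V (AddSubgroup.subset_closure
    ⟨1, SuperAlg.mem_Jpow_zero _, v, (one_smul _ v).symm⟩)

lemma smul_mem_filt {p : ℕ} {V : Opens M} {f : A.sec V} (hf : f ∈ A.Jpow p V) (v : E.sec V) :
    f • v ∈ E.filt p V := by
  have := filt_smul (q := 0) hf (mem_filt_zero v)
  rwa [add_zero] at this

lemma filt_succ_le (p : ℕ) (V : Opens M) : E.filt (p + 1) V ≤ E.filt p V := fun f hf x hx => by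
  obtain ⟨W, hW, hxW, hfW⟩ := hf x hx
  refine ⟨W, hW, hxW, ?_⟩
  have : E.preFilt (p + 1) W ≤ E.preFilt p W := by
    refine AddSubgroup.closure_mono ?_
    rintro _ ⟨f, hf, v, rfl⟩
    exact ⟨f, SuperAlg.Jpow_succ_le p W hf, v, rfl⟩
  exact this hfW

lemma filt_antitone {p q : ℕ} (h : p ≤ q) (V : Opens M) : E.filt q V ≤ E.filt p V :=
  antitone_nat_of_succ_le (f := fun p => E.filt p V) (fun p => filt_succ_le p V) h

lemma symb_eq_symb {p : ℕ} {V : Opens M} {v w : E.sec V} {hv : v ∈ E.filt p V}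
    {hw : w ∈ E.filt p V} : symb v hv = symb w hw ↔ v - w ∈ E.filt (p + 1) V := by
  unfold symb
  rw [QuotientAddGroup.eq, ← neg_mem_iff]
  change -(-v + w) ∈ E.filt (p + 1) V ↔ _
  rw [neg_add, neg_neg, ← sub_eq_add_neg]

end SuperMod

end SheafTools

/-! ### Graded sheaves of superalgebras: leading terms, graded automorphisms and retracts. -/

section GradedAlgebras

/-- Two is invertible in `ℂ`; this is what lets the parity involution kill components of the wrong
parity. -/
lemma eq_zero_of_eq_neg {E : Type*} [AddCommGroup E] [Module ℂ E] {x : E} (h : x = -x) : x = 0 := by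
  have h2 : (2 : ℂ) • x = 0 := by
    rw [two_smul]; nth_rewrite 2 [h]; exact add_neg_cancel x
  exact (smul_eq_zero_iff_right two_ne_zero).1 h2

variable {M : Type u} [TopologicalSpace M]

/-- The structure of a sheaf of superalgebras `B` with a finite grading `g` for which the powers of
the ideal generated by the odd sections are the steps of the associated filtration. -/
structure AlgGradingData (B : SuperAlg M) (g : AlgGrading B) (N : ℕ) where
  isSheaf : B.IsSheaf
  proj : ∀ (k : ℕ) (U : Opens M), B.sec U →ₗ[ℂ] B.sec U
  proj_res : ∀ (k : ℕ) {U V : Opens M} (h : U ≤ V) (f : B.sec V),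
    B.res h (proj k V f) = proj k U (B.res h f)
  proj_mem : ∀ (k : ℕ) (U : Opens M) (f : B.sec U), proj k U f ∈ g k U
  proj_self : ∀ (k : ℕ) (U : Opens M), ∀ f ∈ g k U, proj k U f = f
  proj_ne : ∀ (j k : ℕ) (U : Opens M), j ≠ k → ∀ f ∈ g k U, proj j U f = 0
  sum_proj : ∀ (U : Opens M) (f : B.sec U), ∑ k ∈ Finset.range N, proj k U f = f
  one_mem : ∀ U : Opens M, 1 ∈ g 0 U
  mul_mem : ∀ (p q : ℕ) (U : Opens M), ∀ f ∈ g p U, ∀ f' ∈ g q U, f * f' ∈ g (p + q) U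
  σ_eq : ∀ (k : ℕ) (U : Opens M), ∀ f ∈ g k U, B.σ U f = (-1 : ℂ) ^ k • f
  le_Jpow : ∀ (k : ℕ) (U : Opens M), g k U ≤ B.Jpow k U

namespace AlgGradingData

variable {B : SuperAlg M} {g : AlgGrading B} {N : ℕ} (D : AlgGradingData B g N)
include D

lemma induction {U : Opens M} {P : B.sec U → Prop} (h : ∀ k, ∀ f ∈ g k U, P f)
    (hadd : ∀ f f', P f → P f' → P (f + f')) (f : B.sec U) : P f := by
  rw [← D.sum_proj U f]
  exact Finset.sum_induction _ P hadd (h 0 0 (zero_mem _)) fun k _ => h k _ (D.proj_mem k U f)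

lemma ext {U : Opens M} {f f' : B.sec U} (h : ∀ k, D.proj k U f = D.proj k U f') : f = f' := by
  rw [← D.sum_proj U f, ← D.sum_proj U f']
  exact Finset.sum_congr rfl fun k _ => h k

lemma mem_iff {k : ℕ} {U : Opens M} {f : B.sec U} : f ∈ g k U ↔ D.proj k U f = f :=
  ⟨D.proj_self k U f, fun h => h ▸ D.proj_mem k U f⟩

lemma res_mem {k : ℕ} {U V : Opens M} (h : U ≤ V) {f : B.sec V} (hf : f ∈ g k V) :
    B.res h f ∈ g k U := by
  rw [D.mem_iff, ← D.proj_res, D.proj_self k V f hf]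

/-- A section is the sum of its components in degrees below `N`, and all of these vanish if its
degree is at least `N`. -/
lemma eq_zero_of_le {k : ℕ} (hk : N ≤ k) {U : Opens M} {f : B.sec U} (hf : f ∈ g k U) : f = 0 := by
  rw [← D.sum_proj U f]
  exact Finset.sum_eq_zero fun j hj =>
    D.proj_ne j k U (by have := Finset.mem_range.1 hj; omega) f hf

/-- Homogeneity of degree `k` is the equation `proj k f = f`, and equations between sections of a
sheaf are local. -/
lemma mem_of_local {k : ℕ} {V : Opens M} {f : B.sec V}
    (h : ∀ x ∈ V, ∃ (W : Opens M) (h : W ≤ V), x ∈ W ∧ B.res h f ∈ g k W) : f ∈ g k V := by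
  refine D.mem_iff.2 (D.isSheaf.sep' fun x hx => ?_)
  obtain ⟨W, hW, hxW, hf⟩ := h x hx
  exact ⟨W, hW, hxW, by rw [D.proj_res, D.proj_self _ _ _ hf]⟩

lemma proj_σ (k : ℕ) (U : Opens M) (f : B.sec U) : D.proj k U (B.σ U f) = B.σ U (D.proj k U f) := by
  induction f using D.induction with
  | h j f hf =>
    rw [D.σ_eq j U f hf, map_smul]
    by_cases h : k = j
    · subst h; rw [D.proj_self k U f hf, D.σ_eq k U f hf]
    · rw [D.proj_ne k j U h f hf, smul_zero, map_zero]
  | hadd f f' hf hf' => rw [map_add, map_add, hf, hf', map_add, map_add]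

/-- In the double sum over components, a term either has a vanishing factor or is of degree at least
`p + q`, which exceeds `k`. -/
lemma proj_mul_eq_zero {p q k : ℕ} (hk : k < p + q) {U : Opens M} {f f' : B.sec U}
    (hf : ∀ i < p, D.proj i U f = 0) (hf' : ∀ i < q, D.proj i U f' = 0) :
    D.proj k U (f * f') = 0 := by
  rw [← D.sum_proj U f, ← D.sum_proj U f', Finset.sum_mul_sum, map_sum]
  refine Finset.sum_eq_zero fun i _ => ?_
  rw [map_sum]
  refine Finset.sum_eq_zero fun j _ => ?_
  by_cases hi : i < p
  · rw [hf i hi, zero_mul, map_zero]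
  by_cases hj : j < q
  · rw [hf' j hj, mul_zero, map_zero]
  exact D.proj_ne k (i + j) U (by omega) _ (D.mul_mem i j U _ (D.proj_mem i U f) _
    (D.proj_mem j U f'))

lemma proj_zero_odd {U : Opens M} {f : B.sec U} (hf : f ∈ B.odd U) : D.proj 0 U f = 0 := by
  have h1 := D.proj_σ 0 U f
  rw [show B.σ U f = -f from hf, map_neg, D.σ_eq 0 U _ (D.proj_mem 0 U f), pow_zero, one_smul] at h1
  exact eq_zero_of_eq_neg h1.symm

lemma proj_one_even {U : Opens M} {f : B.sec U} (hf : B.σ U f = f) : D.proj 1 U f = 0 := by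
  have h1 := D.proj_σ 1 U f
  rw [hf, D.σ_eq 1 U _ (D.proj_mem 1 U f), pow_one, neg_one_smul] at h1
  exact eq_zero_of_eq_neg h1

/-- The `p`-th power of the ideal generated by the odd sections consists of the sections without
components in degrees less than `p`. -/
lemma mem_Jpow {p : ℕ} {U : Opens M} {f : B.sec U} :
    f ∈ B.Jpow p U ↔ ∀ k < p, D.proj k U f = 0 := by
  constructor
  -- The sections without components below degree `p` form a multiplicative filtration, and odd
  -- sections lie in its first step. It therefore contains the corresponding powers of the ideal
  -- that odd sections generate.
  · let F : ℕ → ∀ U : Opens M, Submodule ℂ (B.sec U) := fun p U => ⨅ k : Fin p, (D.proj k U).ker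
    have hF : ∀ p U (f : B.sec U), f ∈ F p U ↔ ∀ k < p, D.proj k U f = 0 := fun p U f => by
      simp only [F, Submodule.mem_iInf, LinearMap.mem_ker]
      exact ⟨fun h k hk => h ⟨k, hk⟩, fun h k => h k k.2⟩
    have hmul : ∀ p q U, F p U * F q U ≤ F (p + q) U := fun p q U =>
      Submodule.mul_le.2 fun f hf f' hf' => (hF _ _ _).2 fun k hk =>
        D.proj_mul_eq_zero hk ((hF _ _ _).1 hf) ((hF _ _ _).1 hf')
    have htop : ∀ U, ⊤ ≤ F 0 U := fun U f _ => (hF _ _ _).2 fun k hk => absurd hk (by omega)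
    have hodd : ∀ U, B.odd U ≤ F 1 U := fun U f hf => (hF _ _ _).2 fun k hk => by
      obtain rfl : k = 0 := by omega
      exact D.proj_zero_odd hf
    have hI : ∀ U, B.oddIdeal U ≤ F 1 U := fun U =>
      (mul_le_mul' ((mul_le_mul' (htop U) (hodd U)).trans (hmul _ _ _)) (htop U)).trans (hmul _ _ _)
    have hp : ∀ p U, B.oddIdeal U ^ p ≤ F p U := by
      intro p U
      induction p with
      | zero => rw [pow_zero]; exact le_top.trans (htop U)
      | succ p ih => rw [pow_succ]; exact (mul_le_mul' ih (hI U)).trans (hmul _ _ _)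
    intro hf k hk
    refine D.isSheaf.sep' fun x hx => ?_
    obtain ⟨W, hW, hxW, hfW⟩ := hf x hx
    have h0 : ⊤ * B.oddIdeal W ^ p ≤ F (0 + p) W :=
      (mul_le_mul' (htop W) (hp p W)).trans (hmul 0 p W)
    exact ⟨W, hW, hxW, by rw [D.proj_res, map_zero, (hF _ _ _).1 (h0 hfW) k (by omega)]⟩
  · intro h
    rw [← D.sum_proj U f]
    refine Submodule.sum_mem _ fun k _ => ?_
    by_cases hk : k < p
    · rw [h k hk]; exact zero_mem _
    · exact SuperAlg.Jpow_antitone (by omega) U (D.le_Jpow k U (D.proj_mem k U f))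

lemma sub_proj_mem {p : ℕ} {U : Opens M} {f : B.sec U} (hf : f ∈ B.Jpow p U) :
    f - D.proj p U f ∈ B.Jpow (p + 1) U := by
  refine D.mem_Jpow.2 fun k hk => ?_
  rw [map_sub]
  by_cases h : k = p
  · rw [h, D.proj_self p U _ (D.proj_mem p U f), sub_self]
  · rw [D.mem_Jpow.1 hf k (by omega), D.proj_ne k p U h _ (D.proj_mem p U f), sub_zero]

lemma proj_eq_of_sub_mem {p : ℕ} {U : Opens M} {f f' : B.sec U}
    (h : f - f' ∈ B.Jpow (p + 1) U) : D.proj p U f = D.proj p U f' := by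
  rw [← sub_eq_zero, ← map_sub]
  exact D.mem_Jpow.1 h p (by omega)

/-- Leading terms multiply: replacing either factor by its leading component alters the product only
by an element of `𝒥 ^ (p + q + 1)`. -/
lemma proj_mul {p q : ℕ} {U : Opens M} {f f' : B.sec U} (hf : f ∈ B.Jpow p U)
    (hf' : f' ∈ B.Jpow q U) : D.proj (p + q) U (f * f') = D.proj p U f * D.proj q U f' := by
  rw [← D.proj_self (p + q) U (D.proj p U f * D.proj q U f')
    (D.mul_mem p q U _ (D.proj_mem p U f) _ (D.proj_mem q U f'))]
  refine D.proj_eq_of_sub_mem ?_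
  have h1 := SuperAlg.Jpow_mul (D.sub_proj_mem hf) hf'
  have h2 := SuperAlg.Jpow_mul (D.le_Jpow p U (D.proj_mem p U f)) (D.sub_proj_mem hf')
  rw [show p + 1 + q = p + q + 1 by omega] at h1
  rw [show f * f' - D.proj p U f * D.proj q U f' =
    (f - D.proj p U f) * f' + D.proj p U f * (f' - D.proj q U f') by noncomm_ring]
  exact add_mem h1 h2

lemma eq_zero_of_mem {p : ℕ} {U : Opens M} {f : B.sec U} (hf : f ∈ g p U)
    (h : f ∈ B.Jpow (p + 1) U) : f = 0 := by
  rw [← D.proj_self p U f hf]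
  exact D.mem_Jpow.1 h p (by omega)

end AlgGradingData

/-- An automorphism which is the identity modulo `𝒥 ^ 2` is the identity on `𝒥 ^ p / 𝒥 ^ (p + 1)`. -/
lemma sub_mem_Jpow_of_mem_autFilt {A : SuperAlg M} {U : Opens M} {a : AlgIso U A A}
    (ha : a ∈ autFilt A 2 U) {p : ℕ} {V : Opens M} (k : V ≤ U) {f : A.sec V}
    (hf : f ∈ A.Jpow p V) : a.toEquiv V k f - f ∈ A.Jpow (p + 1) V := by
  -- `F p` collects the sections of `𝒥 ^ p` that `a` fixes modulo `𝒥 ^ (p + 1)`. A Leibniz-type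
  -- identity makes it multiplicative, so only arbitrary sections (degree `0`) and odd sections
  -- (degree `1`) have to be tested.
  let F : ∀ (p : ℕ) (W : Opens M), W ≤ U → Submodule ℂ (A.sec W) := fun p W k =>
    A.Jpow p W ⊓ (A.Jpow (p + 1) W).comap ((a.toEquiv W k).toLinearMap - LinearMap.id)
  have hF : ∀ p W k (f : A.sec W), f ∈ F p W k ↔
      f ∈ A.Jpow p W ∧ a.toEquiv W k f - f ∈ A.Jpow (p + 1) W := fun _ _ _ _ => Iff.rfl
  have hmul : ∀ p q W k, F p W k * F q W k ≤ F (p + q) W k := fun p q W k =>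
    Submodule.mul_le.2 fun f hf f' hf' => by
      rw [hF] at hf hf' ⊢
      refine ⟨SuperAlg.Jpow_mul hf.1 hf'.1, ?_⟩
      have h1 := SuperAlg.Jpow_mul hf.2 (a.map_Jpow q W k hf'.1)
      have h2 := SuperAlg.Jpow_mul hf.1 hf'.2
      rw [show p + 1 + q = p + q + 1 by omega] at h1
      rw [map_mul, show a.toEquiv W k f * a.toEquiv W k f' - f * f' =
        (a.toEquiv W k f - f) * a.toEquiv W k f' + f * (a.toEquiv W k f' - f') by noncomm_ring]
      exact add_mem h1 h2
  have htop : ∀ W k, ⊤ ≤ F 0 W k := fun W k f _ =>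
    ⟨SuperAlg.mem_Jpow_zero f, SuperAlg.Jpow_succ_le 1 W (ha W k f)⟩
  -- Here the full strength of congruence modulo `𝒥 ^ 2` is needed; in degree `0` congruence modulo
  -- `𝒥` was enough.
  have hodd : ∀ W k, A.odd W ≤ F 1 W k := fun W k f hf =>
    ⟨SuperAlg.odd_le_Jpow_one W hf, ha W k f⟩
  have hI : ∀ W k, A.oddIdeal W ≤ F 1 W k := fun W k =>
    (mul_le_mul' ((mul_le_mul' (htop W k) (hodd W k)).trans (hmul _ _ _ _)) (htop W k)).trans
      (hmul _ _ _ _)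
  have hp : ∀ p W k, A.oddIdeal W ^ p ≤ F p W k := by
    intro p W k
    induction p with
    | zero => rw [pow_zero]; exact le_top.trans (htop W k)
    | succ p ih => rw [pow_succ]; exact (mul_le_mul' ih (hI W k)).trans (hmul _ _ _ _)
  refine SuperAlg.Jpow_of_local fun x hx => ?_
  obtain ⟨W, hW, hxW, hfW⟩ := hf x hx
  have h0 : ⊤ * A.oddIdeal W ^ p ≤ F (0 + p) W (hW.trans k) :=
    (mul_le_mul' (htop W _) (hp p W _)).trans (hmul 0 p W _)
  have := ((hF _ _ _ _).1 (h0 hfW)).2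
  rw [zero_add] at this
  exact ⟨W, hW, hxW, by rwa [map_sub, a.map_res]⟩

namespace AlgRetractIso

variable {A B : SuperAlg M} {g : AlgGrading B} {N : ℕ}

/-- The leading term of a section of `𝒥 ^ p`. -/
def lead (r : AlgRetractIso A B g) (p : ℕ) (V : Opens M) : A.Jpow p V →ₗ[ℂ] B.sec V :=
  r.toGr p V ∘ₗ Submodule.mkQ _

lemma lead_apply (r : AlgRetractIso A B g) {p : ℕ} {V : Opens M} (f : A.Jpow p V) :
    r.lead p V f = r.toGr p V (SuperAlg.symb f.1 f.2) := rfl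

lemma lead_eq_lead (r : AlgRetractIso A B g) {p : ℕ} {V : Opens M} {f f' : A.Jpow p V} :
    r.lead p V f = r.lead p V f' ↔ f.1 - f'.1 ∈ A.Jpow (p + 1) V := by
  rw [lead_apply, lead_apply, (r.toGr_injective p V).eq_iff, SuperAlg.symb_eq_symb]

lemma lead_congr (r : AlgRetractIso A B g) {p : ℕ} {V : Opens M} {f f' : A.Jpow p V}
    (h : f.1 = f'.1) : r.lead p V f = r.lead p V f' :=
  congrArg _ (Subtype.ext h)

lemma lead_eq_zero (r : AlgRetractIso A B g) {p : ℕ} {V : Opens M} {f : A.Jpow p V}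
    (h : f.1 = 0) : r.lead p V f = 0 := by
  rw [r.lead_congr (f' := 0) h, map_zero]

lemma res_lead (r : AlgRetractIso A B g) {p : ℕ} {U V : Opens M} (h : U ≤ V) (f : A.Jpow p V) :
    B.res h (r.lead p V f) = r.lead p U ⟨A.res h f, SuperAlg.Jpow_res h f.2⟩ :=
  r.toGr_res p h f.1 f.2

lemma lead_mul (r : AlgRetractIso A B g) {p q : ℕ} {V : Opens M} (f : A.Jpow p V)
    (f' : A.Jpow q V) :
    r.lead (p + q) V ⟨f.1 * f'.1, SuperAlg.Jpow_mul f.2 f'.2⟩ = r.lead p V f * r.lead q V f' :=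
  r.toGr_mul p q V f f' f.2 f'.2

/-- An isomorphism `δ` induces the given isomorphism of retracts. -/
def Compat (r : AlgRetractIso A B g) (D : AlgGradingData B g N) {U : Opens M}
    (δ : AlgIso U A B) : Prop :=
  ∀ (p : ℕ) (V : Opens M) (k : V ≤ U) (f : A.Jpow p V),
    D.proj p V (δ.toEquiv V k f) = r.lead p V f

lemma Compat.restrict {r : AlgRetractIso A B g} {D : AlgGradingData B g N} {U W : Opens M}
    {δ : AlgIso U A B} (h : r.Compat D δ) (k : W ≤ U) : r.Compat D (δ.restrict k) :=
  fun p V k' f => h p V (k'.trans k) f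

/-- Isomorphisms which induce the same isomorphism of retracts differ by a section of `𝒜ut_(2)`. -/
lemma Compat.transition {r : AlgRetractIso A B g} {D : AlgGradingData B g N} {U : Opens M}
    {δ δ' : AlgIso U A B} (h : r.Compat D δ) (h' : r.Compat D δ') :
    δ.symm.trans δ' ∈ autFilt B 2 U := by
  have hp : ∀ (p : ℕ) (V : Opens M) (k : V ≤ U) (f : A.sec V), f ∈ A.Jpow p V →
      D.proj p V (δ'.toEquiv V k f) = D.proj p V (δ.toEquiv V k f) := fun p V k f hf =>
    (h' p V k ⟨f, hf⟩).trans (h p V k ⟨f, hf⟩).symm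
  intro V k b
  obtain ⟨f, rfl⟩ := (δ.toEquiv V k).surjective b
  change δ'.toEquiv V k ((δ.toEquiv V k).symm (δ.toEquiv V k f)) - _ ∈ _
  rw [AlgEquiv.symm_apply_apply]
  refine D.mem_Jpow.2 fun i hi => ?_
  rw [map_sub, sub_eq_zero]
  -- Congruence modulo `𝒥 ^ 2` means agreement of the components of degrees `0` and `1`. Degree `0`
  -- is covered by compatibility, as every section lies in `𝒥 ^ 0`.
  obtain rfl | rfl : i = 0 ∨ i = 1 := by omega
  · exact hp 0 V k f (SuperAlg.mem_Jpow_zero f)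
  -- Compatibility in degree `1` speaks only of sections of `𝒥`. But twice `f` is an even section
  -- plus the odd section `f - σ f`; the even one contributes nothing in degree `1`, and the odd one
  -- lies in `𝒥`.
  have hodd : f - A.σ V f ∈ A.odd V := by
    change A.σ V (f - A.σ V f) = -(f - A.σ V f)
    rw [map_sub, A.σ_σ, neg_sub]
  have heven : ∀ ε : AlgIso U A B,
      D.proj 1 V (ε.toEquiv V k (f + A.σ V f)) = 0 := fun ε =>
    D.proj_one_even (by rw [ε.map_σ, map_add, A.σ_σ, add_comm])
  have h2 : (2 : ℂ) • f = (f + A.σ V f) + (f - A.σ V f) := by rw [two_smul]; abel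
  have h3 : ∀ ε : AlgIso U A B, (2 : ℂ) • D.proj 1 V (ε.toEquiv V k f) =
      D.proj 1 V (ε.toEquiv V k (f - A.σ V f)) := fun ε => by
    rw [← map_smul, ← map_smul, h2, map_add (ε.toEquiv V k), map_add, heven, zero_add]
  exact smul_right_injective _ two_ne_zero
    ((h3 δ').trans ((hp 1 V k _ (SuperAlg.odd_le_Jpow_one V hodd)).trans (h3 δ).symm))

section GradedIso

variable (r : AlgRetractIso A B g) (D : AlgGradingData B g N) {U : Opens M} (φ : AlgIso U B A)

/-- The linear map `s ↦ ∑ᵢ r (φ sᵢ)`, where `sᵢ` is the component of degree `i` of `s`. -/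
def gradedLin (V : Opens M) (k : V ≤ U) : B.sec V →ₗ[ℂ] B.sec V :=
  ∑ i ∈ Finset.range N, (r.lead i V) ∘ₗ
    LinearMap.codRestrict (A.Jpow i V) ((φ.toEquiv V k).toLinearMap ∘ₗ D.proj i V) fun f =>
      φ.map_Jpow i V k (D.le_Jpow i V (D.proj_mem i V f))

/-- Only the summand of index `i` survives on a section of degree `i`. Degrees from `N` on do not
occur in the sum, but there the section itself is zero. -/
lemma gradedLin_of_mem {i : ℕ} {V : Opens M} (k : V ≤ U) {s : B.sec V} (hs : s ∈ g i V) :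
    r.gradedLin D φ V k s =
      r.lead i V ⟨φ.toEquiv V k s, φ.map_Jpow i V k (D.le_Jpow i V hs)⟩ := by
  by_cases hi : i < N
  · unfold gradedLin
    rw [LinearMap.sum_apply, Finset.sum_eq_single i]
    · refine r.lead_eq_lead.2 ?_
      change φ.toEquiv V k (D.proj i V s) - φ.toEquiv V k s ∈ _
      rw [D.proj_self i V s hs, sub_self]
      exact zero_mem _
    · intro j _ hj
      refine r.lead_eq_zero ?_
      change φ.toEquiv V k (D.proj j V s) = 0
      rw [D.proj_ne j i V hj s hs, map_zero]
    · intro h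
      exact absurd (Finset.mem_range.2 hi) h
  · have h0 : s = 0 := D.eq_zero_of_le (by omega) hs
    subst h0
    rw [map_zero]
    exact (r.lead_eq_zero (map_zero (φ.toEquiv V k))).symm

lemma gradedLin_mem {i : ℕ} {V : Opens M} (k : V ≤ U) {s : B.sec V} (hs : s ∈ g i V) :
    r.gradedLin D φ V k s ∈ g i V := by
  rw [gradedLin_of_mem r D φ k hs]
  exact r.toGr_mem i V _

lemma proj_gradedLin (i : ℕ) (V : Opens M) (k : V ≤ U) (s : B.sec V) :
    D.proj i V (r.gradedLin D φ V k s) = r.gradedLin D φ V k (D.proj i V s) := by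
  induction s using D.induction with
  | h j s hs =>
    have := r.gradedLin_mem D φ k hs
    by_cases h : i = j
    · subst h; rw [D.proj_self i V s hs, D.proj_self i V _ this]
    · rw [D.proj_ne i j V h s hs, D.proj_ne i j V h _ this, map_zero]
  | hadd s t hs ht => rw [map_add, map_add, hs, ht, map_add, map_add]

lemma res_gradedLin {V W : Opens M} (h : W ≤ V) (k : V ≤ U) (s : B.sec V) :
    B.res h (r.gradedLin D φ V k s) = r.gradedLin D φ W (h.trans k) (B.res h s) := by
  induction s using D.induction with
  | h i s hs =>
    rw [gradedLin_of_mem r D φ k hs, gradedLin_of_mem r D φ _ (D.res_mem h hs), res_lead]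
    exact r.lead_congr (φ.map_res h k s)
  | hadd s t hs ht => rw [map_add, map_add, hs, ht, map_add, map_add]

lemma σ_gradedLin (V : Opens M) (k : V ≤ U) (s : B.sec V) :
    B.σ V (r.gradedLin D φ V k s) = r.gradedLin D φ V k (B.σ V s) := by
  induction s using D.induction with
  | h i s hs =>
    rw [D.σ_eq i V s hs, map_smul, D.σ_eq i V _ (r.gradedLin_mem D φ k hs)]
  | hadd s t hs ht => rw [map_add, map_add, hs, ht, map_add, map_add]

lemma gradedLin_mul (V : Opens M) (k : V ≤ U) (s t : B.sec V) :
    r.gradedLin D φ V k (s * t) = r.gradedLin D φ V k s * r.gradedLin D φ V k t := by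
  induction s using D.induction with
  | h i s hs =>
    induction t using D.induction with
    | h j t ht =>
      rw [gradedLin_of_mem r D φ k hs, gradedLin_of_mem r D φ k ht,
        gradedLin_of_mem r D φ k (D.mul_mem i j V s hs t ht), ← lead_mul]
      exact r.lead_congr (map_mul (φ.toEquiv V k) s t)
    | hadd t t' ht ht' => rw [mul_add, map_add, ht, ht', map_add, mul_add]
  | hadd s s' hs hs' => rw [add_mul, map_add, hs, hs', map_add, add_mul]

lemma gradedLin_one (V : Opens M) (k : V ≤ U) : r.gradedLin D φ V k 1 = 1 := by
  rw [gradedLin_of_mem r D φ k (D.one_mem V)]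
  exact (r.lead_congr (map_one (φ.toEquiv V k))).trans (r.toGr_one V)

/-- If the leading term of `φ sᵢ` vanishes, then `φ sᵢ` lies in `𝒥 ^ (i + 1)`, hence so does `sᵢ`,
because the inverse of `φ` respects the filtrations. Being homogeneous of degree `i`, `sᵢ` is zero.
-/
lemma gradedLin_injective (V : Opens M) (k : V ≤ U) :
    Function.Injective (r.gradedLin D φ V k) := by
  refine (injective_iff_map_eq_zero _).2 fun s hs => D.ext fun i => ?_
  have h1 := r.proj_gradedLin D φ i V k s
  rw [hs, map_zero, gradedLin_of_mem r D φ k (D.proj_mem i V s), eq_comm,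
    ← map_zero (r.lead i V), r.lead_eq_lead] at h1
  have h2 := φ.symm.map_Jpow (i + 1) V k h1
  rw [map_zero]
  refine D.eq_zero_of_mem (D.proj_mem i V s) ?_
  change (φ.toEquiv V k).symm (φ.toEquiv V k (D.proj i V s) - 0) ∈ _ at h2
  rwa [sub_zero, AlgEquiv.symm_apply_apply] at h2

/-- The isomorphism of retracts is only locally onto, since it is given on presheaf quotients. The
local preimages are unique by injectivity and therefore glue. -/
lemma gradedLin_surjective (V : Opens M) (k : V ≤ U) :
    Function.Surjective (r.gradedLin D φ V k) := by
  intro b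
  induction b using D.induction with
  | h i b hb =>
    have : ∀ x : V, ∃ (W : Opens M) (h : W ≤ V), x.1 ∈ W ∧
        ∃ s : B.sec W, r.gradedLin D φ W (h.trans k) s = B.res h b := by
      rintro ⟨x, hx⟩
      obtain ⟨W, h, hxW, s, hs⟩ := r.toGr_surjective i V b hb x hx
      obtain ⟨⟨f, hf⟩, rfl⟩ := Submodule.mkQ_surjective _ s
      have hf' := φ.symm.map_Jpow i W (h.trans k) hf
      -- The preimage is the leading component of `φ⁻¹ f`: dropping the higher components changes
      -- its image under `φ` only by an element of `𝒥 ^ (i + 1)`.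
      refine ⟨W, h, hxW, D.proj i W (φ.symm.toEquiv W (h.trans k) f), ?_⟩
      rw [gradedLin_of_mem r D φ _ (D.proj_mem i W _), ← hs]
      refine r.lead_eq_lead (f' := ⟨f, hf⟩) |>.2 ?_
      have h1 := φ.map_Jpow (i + 1) W (h.trans k) (neg_mem (D.sub_proj_mem hf'))
      rw [neg_sub, map_sub] at h1
      change _ - φ.toEquiv W _ ((φ.toEquiv W _).symm f) ∈ _ at h1
      rwa [AlgEquiv.apply_symm_apply] at h1
    choose W hW hxW s hs using this
    obtain ⟨f, hf⟩ := D.isSheaf.glue (V := V) (U := W) (fun x hx => ⟨⟨x, hx⟩, hxW _⟩)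
      (fun x T h k' => B.res k' (s x)) (fun x T T' h k' l => B.res_res _ _ _)
      (fun x y T h k' k'' => r.gradedLin_injective D φ T (h.trans k) (by
        rw [← r.res_gradedLin D φ k' ((hW x).trans k), ← r.res_gradedLin D φ k'' ((hW y).trans k),
          hs, hs, B.res_res, B.res_res]))
    refine ⟨f, D.isSheaf.sep (U := W) (fun x hx => ⟨⟨x, hx⟩, hxW _⟩) fun x T h k' => ?_⟩
    rw [r.res_gradedLin, hf x T h k', ← r.res_gradedLin D φ k' ((hW x).trans k), hs, B.res_res]
  | hadd b b' hb hb' =>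
    obtain ⟨s, rfl⟩ := hb
    obtain ⟨s', rfl⟩ := hb'
    exact ⟨s + s', map_add _ _ _⟩

/-- The automorphism of `B|_U` that preserves the grading and is induced by an isomorphism of
retracts `gr A → B` and an isomorphism `B|_U → A|_U`. -/
noncomputable def gradedIso : AlgIso U B B where
  toEquiv V k := AlgEquiv.ofBijective
    (AlgHom.ofLinearMap (r.gradedLin D φ V k) (r.gradedLin_one D φ V k) (r.gradedLin_mul D φ V k))
    ⟨r.gradedLin_injective D φ V k, r.gradedLin_surjective D φ V k⟩
  map_res h k f := r.res_gradedLin D φ h k f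
  map_σ V k f := r.σ_gradedLin D φ V k f

lemma gradedIso_apply (V : Opens M) (k : V ≤ U) (s : B.sec V) :
    (r.gradedIso D φ).toEquiv V k s = r.gradedLin D φ V k s := rfl

/-- The map commutes with the projections and is injective, so homogeneity of the image implies that
of the argument. -/
lemma gradedIso_mem_iff (i : ℕ) (V : Opens M) (k : V ≤ U) (s : B.sec V) :
    (r.gradedIso D φ).toEquiv V k s ∈ g i V ↔ s ∈ g i V := by
  rw [gradedIso_apply]
  refine ⟨fun h => ?_, r.gradedLin_mem D φ k⟩
  rw [D.mem_iff, r.proj_gradedLin] at h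
  exact D.mem_iff.2 (r.gradedLin_injective D φ V k h)

/-- This is the correction of an arbitrary local isomorphism to one inducing `r`. The leading
component of the image of `f` is `r` applied to `φ` of the leading component of `φ⁻¹ f`, and the
latter differs from `f` by an element of `𝒥 ^ (p + 1)`. -/
lemma compat_gradedIso : r.Compat D (φ.symm.trans (r.gradedIso D φ)) := by
  rintro p V k ⟨f, hf⟩
  change D.proj p V (r.gradedLin D φ V k ((φ.toEquiv V k).symm f)) = _
  rw [proj_gradedLin, gradedLin_of_mem r D φ k (D.proj_mem p V _), r.lead_eq_lead]
  have h1 := φ.map_Jpow (p + 1) V k (neg_mem (D.sub_proj_mem (φ.symm.map_Jpow p V k hf)))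
  rw [neg_sub, map_sub] at h1
  change _ - φ.toEquiv V k ((φ.toEquiv V k).symm f) ∈ _ at h1
  rwa [AlgEquiv.apply_symm_apply] at h1

/-- The graded automorphisms defined by `φ` and `φ'` agree if these differ by a section of
`𝒜ut_(2)`. -/
lemma gradedIso_eq {φ φ' : AlgIso U B A} (h : φ'.trans φ.symm ∈ autFilt B 2 U) :
    r.gradedIso D φ = r.gradedIso D φ' := by
  refine AlgIso.ext' fun V k s => ?_
  rw [gradedIso_apply, gradedIso_apply]
  induction s using D.induction with
  | h i s hs =>
    rw [gradedLin_of_mem r D φ k hs, gradedLin_of_mem r D φ' k hs, r.lead_eq_lead]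
    have h1 := φ.map_Jpow _ V k (neg_mem (sub_mem_Jpow_of_mem_autFilt h k (D.le_Jpow i V hs)))
    rw [neg_sub, map_sub] at h1
    change _ - φ.toEquiv V k ((φ.toEquiv V k).symm _) ∈ _ at h1
    rwa [AlgEquiv.apply_symm_apply] at h1
  | hadd s t hs ht => rw [map_add, map_add, hs, ht]

end GradedIso

end AlgRetractIso

namespace AlgAtlas

variable {A B : SuperAlg M} {g : AlgGrading B} {N : ℕ}

/-- Two charts differ by a transition in `𝒜ut_(2)`, which is the identity on `𝒥 ^ p / 𝒥 ^ (p + 1)`;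
thus leading terms do not depend on the chart. -/
lemma chart_sub_chart_mem (t : AlgAtlas A B) {i j : t.ι} {T : Opens M} (hi : T ≤ t.U i)
    (hj : T ≤ t.U j) {p : ℕ} {f : A.sec T} (hf : f ∈ A.Jpow p T) :
    (t.chart i).toEquiv T hi f - (t.chart j).toEquiv T hj f ∈ B.Jpow (p + 1) T := by
  have h := sub_mem_Jpow_of_mem_autFilt (t.transition i j T hi hj) le_rfl
    ((t.chart j).map_Jpow p T hj hf)
  change (t.chart i).toEquiv T hi (((t.chart j).toEquiv T hj).symm _) - _ ∈ _ at h
  rwa [AlgEquiv.symm_apply_apply] at h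

lemma exists_lead (t : AlgAtlas A B) (D : AlgGradingData B g N) (p : ℕ) (V : Opens M)
    (f : A.Jpow p V) : ∃ b : B.sec V, ∀ i T (h : T ≤ V) (k : T ≤ t.U i),
      B.res h b = D.proj p T ((t.chart i).toEquiv T k (A.res h f)) :=
  D.isSheaf.glue (fun x _ => t.cover x) _
    (fun i T T' h k l => by rw [D.proj_res, (t.chart i).map_res, A.res_res])
    (fun i j T h k k' =>
      D.proj_eq_of_sub_mem (t.chart_sub_chart_mem k k' (SuperAlg.Jpow_res h f.2)))

/-- The leading term in `B` of a section of `𝒥 ^ p`, as seen by the charts of an atlas. -/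
noncomputable def lead (t : AlgAtlas A B) (D : AlgGradingData B g N) (p : ℕ) (V : Opens M) :
    A.Jpow p V →ₗ[ℂ] B.sec V where
  toFun f := (t.exists_lead D p V f).choose
  map_add' f f' := D.isSheaf.sep (fun x _ => t.cover x) fun i T h k => by
    rw [map_add, (t.exists_lead D p V _).choose_spec i T h k,
      (t.exists_lead D p V _).choose_spec i T h k, (t.exists_lead D p V _).choose_spec i T h k,
      ← map_add, ← map_add, ← map_add]
    rfl
  map_smul' c f := D.isSheaf.sep (fun x _ => t.cover x) fun i T h k => by
    rw [map_smul, (t.exists_lead D p V _).choose_spec i T h k,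
      (t.exists_lead D p V _).choose_spec i T h k, RingHom.id_apply, ← map_smul, ← map_smul,
      ← map_smul]
    rfl

lemma res_lead (t : AlgAtlas A B) (D : AlgGradingData B g N) {p : ℕ} {V : Opens M}
    (f : A.Jpow p V) {i : t.ι} {T : Opens M} (h : T ≤ V) (k : T ≤ t.U i) :
    B.res h (t.lead D p V f) = D.proj p T ((t.chart i).toEquiv T k (A.res h f)) :=
  (t.exists_lead D p V f).choose_spec i T h k

/-- In one chart, a section of `𝒥 ^ p` without component of degree `p` lies in `𝒥 ^ (p + 1)`, and
charts respect the filtrations. Hence the leading term descends to an injective map on the quotient.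
-/
lemma lead_eq_zero_iff (t : AlgAtlas A B) (D : AlgGradingData B g N) {p : ℕ} {V : Opens M}
    (f : A.Jpow p V) : t.lead D p V f = 0 ↔ f.1 ∈ A.Jpow (p + 1) V := by
  constructor
  · intro h
    refine SuperAlg.Jpow_of_local fun x hx => ?_
    obtain ⟨i, hi⟩ := t.cover x
    have h1 := t.res_lead D f (i := i) (T := V ⊓ t.U i) inf_le_left inf_le_right
    rw [h, map_zero] at h1
    have h2 := D.sub_proj_mem ((t.chart i).map_Jpow p (V ⊓ t.U i) inf_le_right
      (SuperAlg.Jpow_res inf_le_left f.2))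
    rw [← h1, sub_zero] at h2
    have h3 := (t.chart i).symm.map_Jpow _ _ inf_le_right h2
    change ((t.chart i).toEquiv _ _).symm _ ∈ _ at h3
    rw [AlgEquiv.symm_apply_apply] at h3
    exact ⟨V ⊓ t.U i, inf_le_left, ⟨hx, hi⟩, h3⟩
  · intro h
    refine D.isSheaf.sep (fun x _ => t.cover x) fun i T l k => ?_
    rw [t.res_lead D f l k, map_zero]
    exact D.mem_Jpow.1 ((t.chart i).map_Jpow _ T k (SuperAlg.Jpow_res l h)) p (by omega)

/-- The isomorphism of retracts induced by the charts of an atlas. -/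
noncomputable def retractIso (t : AlgAtlas A B) (D : AlgGradingData B g N) :
    AlgRetractIso A B g where
  toGr p V := Submodule.liftQ _ (t.lead D p V) fun f hf => (t.lead_eq_zero_iff D f).2 hf
  toGr_mem p V s := by
    obtain ⟨f, rfl⟩ := Submodule.mkQ_surjective _ s
    change t.lead D p V f ∈ g p V
    refine D.mem_of_local fun x hx => ?_
    obtain ⟨i, hi⟩ := t.cover x
    exact ⟨V ⊓ t.U i, inf_le_left, ⟨hx, hi⟩, by
      rw [t.res_lead D f inf_le_left inf_le_right]; exact D.proj_mem _ _ _⟩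
  toGr_res p U V h f hf := by
    change B.res h (t.lead D p V ⟨f, hf⟩) = t.lead D p U ⟨A.res h f, _⟩
    refine D.isSheaf.sep (fun x _ => t.cover x) fun i T l k => ?_
    rw [B.res_res, t.res_lead D _ _ k, t.res_lead D _ _ k, A.res_res]
  toGr_injective p U := by
    refine (injective_iff_map_eq_zero _).2 fun s hs => ?_
    obtain ⟨f, rfl⟩ := Submodule.mkQ_surjective _ s
    exact (Submodule.Quotient.mk_eq_zero _).2 ((t.lead_eq_zero_iff D f).1 hs)
  -- On `U ⊓ t.U i` the preimage of `b` is the class of its pull-back by the chart `i`.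
  toGr_surjective p U b hb x hx := by
    obtain ⟨i, hi⟩ := t.cover x
    have hb' := D.res_mem (inf_le_left : U ⊓ t.U i ≤ U) hb
    have hJ := (t.chart i).symm.map_Jpow p (U ⊓ t.U i) inf_le_right (D.le_Jpow p _ hb')
    refine ⟨U ⊓ t.U i, inf_le_left, ⟨hx, hi⟩, SuperAlg.symb _ hJ, ?_⟩
    change t.lead D p _ ⟨_, hJ⟩ = _
    have h := t.res_lead D ⟨_, hJ⟩ (i := i) le_rfl inf_le_right
    rw [B.res_self, A.res_self] at h
    refine h.trans ?_
    change D.proj p _ ((t.chart i).toEquiv _ _ (((t.chart i).toEquiv _ _).symm _)) = _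
    rw [AlgEquiv.apply_symm_apply, D.proj_self _ _ _ hb']
  toGr_one U := by
    change t.lead D 0 U ⟨1, _⟩ = 1
    refine D.isSheaf.sep (fun x _ => t.cover x) fun i T l k => ?_
    rw [t.res_lead D _ l k]
    simp only [map_one]
    exact D.proj_self 0 T _ (D.one_mem T)
  toGr_mul p q U f f' hf hf' := by
    change t.lead D (p + q) U ⟨f * f', _⟩ = t.lead D p U ⟨f, hf⟩ * t.lead D q U ⟨f', hf'⟩
    refine D.isSheaf.sep (fun x _ => t.cover x) fun i T l k => ?_
    rw [map_mul, t.res_lead D _ l k, t.res_lead D _ l k, t.res_lead D _ l k, ← D.proj_mul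
      ((t.chart i).map_Jpow p T k (SuperAlg.Jpow_res l hf))
      ((t.chart i).map_Jpow q T k (SuperAlg.Jpow_res l hf')), ← map_mul, ← map_mul]
  toGr_σ p U f hf := by
    change B.σ U (t.lead D p U ⟨f, hf⟩) = t.lead D p U ⟨A.σ U f, _⟩
    refine D.isSheaf.sep (fun x _ => t.cover x) fun i T l k => ?_
    rw [B.res_σ, t.res_lead D _ l k, t.res_lead D _ l k, A.res_σ, ← (t.chart i).map_σ, D.proj_σ]

/-- Over a set inside `t.U i` the glued leading term is the one computed in the chart `i`. Every
atlas thus consists of charts compatible with a single isomorphism of retracts. -/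
lemma compat_retractIso (t : AlgAtlas A B) (D : AlgGradingData B g N) (i : t.ι) :
    (t.retractIso D).Compat D (t.chart i) := fun p V k f => by
  change _ = t.lead D p V f
  have h := t.res_lead D f (i := i) le_rfl k
  rw [B.res_self, A.res_self] at h
  exact h.symm

end AlgAtlas

end GradedAlgebras

/-! ### The same constructions for graded modules and quasi-isomorphisms. -/

section GradedModules

variable {M : Type u} [TopologicalSpace M]

/-- The analogue of `AlgGradingData` for a sheaf of modules over `B`. -/
structure ModGradingData {B : SuperAlg M} (E : SuperMod B) (g : AlgGrading B) (e : ModGrading E)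
    (N : ℕ) where
  isSheaf : E.IsSheaf
  proj : ∀ (k : ℕ) (U : Opens M), E.sec U →+ E.sec U
  proj_res : ∀ (k : ℕ) {U V : Opens M} (h : U ≤ V) (v : E.sec V),
    E.res h (proj k V v) = proj k U (E.res h v)
  proj_mem : ∀ (k : ℕ) (U : Opens M) (v : E.sec U), proj k U v ∈ e k U
  proj_self : ∀ (k : ℕ) (U : Opens M), ∀ v ∈ e k U, proj k U v = v
  proj_ne : ∀ (j k : ℕ) (U : Opens M), j ≠ k → ∀ v ∈ e k U, proj j U v = 0
  sum_proj : ∀ (U : Opens M) (v : E.sec U), ∑ k ∈ Finset.range N, proj k U v = v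
  smul_mem : ∀ (p q : ℕ) (U : Opens M), ∀ f ∈ g p U, ∀ v ∈ e q U, f • v ∈ e (p + q) U
  σ_mem : ∀ (k : ℕ) (U : Opens M), ∀ v ∈ e k U, E.σ U v ∈ e k U
  le_filt : ∀ (k : ℕ) (U : Opens M), e k U ≤ E.filt k U

namespace ModGradingData

variable {B : SuperAlg M} {E : SuperMod B} {g : AlgGrading B} {e : ModGrading E} {N : ℕ}
  (D : ModGradingData E g e N)
include D

lemma induction {U : Opens M} {P : E.sec U → Prop} (h : ∀ k, ∀ v ∈ e k U, P v)
    (hadd : ∀ v v', P v → P v' → P (v + v')) (v : E.sec U) : P v := by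
  rw [← D.sum_proj U v]
  exact Finset.sum_induction _ P hadd (h 0 0 (zero_mem _)) fun k _ => h k _ (D.proj_mem k U v)

lemma ext {U : Opens M} {v v' : E.sec U} (h : ∀ k, D.proj k U v = D.proj k U v') : v = v' := by
  rw [← D.sum_proj U v, ← D.sum_proj U v']
  exact Finset.sum_congr rfl fun k _ => h k

lemma mem_iff {k : ℕ} {U : Opens M} {v : E.sec U} : v ∈ e k U ↔ D.proj k U v = v :=
  ⟨D.proj_self k U v, fun h => h ▸ D.proj_mem k U v⟩

lemma res_mem {k : ℕ} {U V : Opens M} (h : U ≤ V) {v : E.sec V} (hv : v ∈ e k V) :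
    E.res h v ∈ e k U := by
  rw [D.mem_iff, ← D.proj_res, D.proj_self k V v hv]

lemma eq_zero_of_le {k : ℕ} (hk : N ≤ k) {U : Opens M} {v : E.sec U} (hv : v ∈ e k U) : v = 0 := by
  rw [← D.sum_proj U v]
  exact Finset.sum_eq_zero fun j hj =>
    D.proj_ne j k U (by have := Finset.mem_range.1 hj; omega) v hv

lemma mem_of_local {k : ℕ} {V : Opens M} {v : E.sec V}
    (h : ∀ x ∈ V, ∃ (W : Opens M) (h : W ≤ V), x ∈ W ∧ E.res h v ∈ e k W) : v ∈ e k V := by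
  refine D.mem_iff.2 (D.isSheaf.sep' fun x hx => ?_)
  obtain ⟨W, hW, hxW, hv⟩ := h x hx
  exact ⟨W, hW, hxW, by rw [D.proj_res, D.proj_self _ _ _ hv]⟩

lemma proj_σ (k : ℕ) (U : Opens M) (v : E.sec U) : D.proj k U (E.σ U v) = E.σ U (D.proj k U v) := by
  induction v using D.induction with
  | h j v hv =>
    by_cases h : k = j
    · subst h; rw [D.proj_self k U v hv, D.proj_self k U _ (D.σ_mem k U v hv)]
    · rw [D.proj_ne k j U h v hv, map_zero, D.proj_ne k j U h _ (D.σ_mem j U v hv)]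
  | hadd v v' hv hv' => rw [map_add, map_add, hv, hv', map_add, map_add]

lemma proj_smul_eq_zero (DB : AlgGradingData B g N) {p q k : ℕ} (hk : k < p + q) {U : Opens M}
    {f : B.sec U} {v : E.sec U} (hf : ∀ i < p, DB.proj i U f = 0)
    (hv : ∀ i < q, D.proj i U v = 0) : D.proj k U (f • v) = 0 := by
  rw [← DB.sum_proj U f, ← D.sum_proj U v, Finset.sum_smul, map_sum]
  refine Finset.sum_eq_zero fun i _ => ?_
  rw [Finset.smul_sum, map_sum]
  refine Finset.sum_eq_zero fun j _ => ?_
  by_cases hi : i < p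
  · rw [hf i hi, zero_smul, map_zero]
  by_cases hj : j < q
  · rw [hv j hj, smul_zero, map_zero]
  exact D.proj_ne k (i + j) U (by omega) _ (D.smul_mem i j U _ (DB.proj_mem i U f) _
    (D.proj_mem j U v))

/-- The subsheaf `𝒥 ^ p E` consists of the sections without components in degrees less than `p`. -/
lemma mem_filt (DB : AlgGradingData B g N) {p : ℕ} {U : Opens M} {v : E.sec U} :
    v ∈ E.filt p U ↔ ∀ k < p, D.proj k U v = 0 := by
  constructor
  · intro hv k hk
    refine D.isSheaf.sep' fun x hx => ?_
    obtain ⟨W, hW, hxW, hvW⟩ := hv x hx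
    refine ⟨W, hW, hxW, ?_⟩
    have : E.preFilt p W ≤ (D.proj k W).ker := by
      refine (AddSubgroup.closure_le _).2 ?_
      rintro _ ⟨f, hf, v, rfl⟩
      -- The module factor `v` is arbitrary, so its filtration degree is taken to be `0`.
      exact D.proj_smul_eq_zero DB (p := p) (q := 0) (by omega) (DB.mem_Jpow.1 hf)
        fun i hi => absurd hi (by omega)
    rw [D.proj_res, map_zero]
    exact this hvW
  · intro h
    rw [← D.sum_proj U v]
    refine AddSubgroup.sum_mem _ fun k _ => ?_
    by_cases hk : k < p
    · rw [h k hk]; exact zero_mem _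
    · exact SuperMod.filt_antitone (by omega) U (D.le_filt k U (D.proj_mem k U v))

lemma sub_proj_mem (DB : AlgGradingData B g N) {p : ℕ} {U : Opens M} {v : E.sec U}
    (hv : v ∈ E.filt p U) : v - D.proj p U v ∈ E.filt (p + 1) U := by
  refine (D.mem_filt DB).2 fun k hk => ?_
  rw [map_sub]
  by_cases h : k = p
  · rw [h, D.proj_self p U _ (D.proj_mem p U v), sub_self]
  · rw [(D.mem_filt DB).1 hv k (by omega), D.proj_ne k p U h _ (D.proj_mem p U v), sub_zero]

lemma proj_eq_of_sub_mem (DB : AlgGradingData B g N) {p : ℕ} {U : Opens M} {v v' : E.sec U}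
    (h : v - v' ∈ E.filt (p + 1) U) : D.proj p U v = D.proj p U v' := by
  rw [← sub_eq_zero, ← map_sub]
  exact (D.mem_filt DB).1 h p (by omega)

/-- As for products in the algebra, replacing `f` or `v` by its leading component alters `f • v`
only one filtration step deeper. -/
lemma proj_smul (DB : AlgGradingData B g N) {p q : ℕ} {U : Opens M} {f : B.sec U} {v : E.sec U}
    (hf : f ∈ B.Jpow p U) (hv : v ∈ E.filt q U) :
    D.proj (p + q) U (f • v) = DB.proj p U f • D.proj q U v := by
  rw [← D.proj_self (p + q) U (DB.proj p U f • D.proj q U v)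
    (D.smul_mem p q U _ (DB.proj_mem p U f) _ (D.proj_mem q U v))]
  refine D.proj_eq_of_sub_mem DB ?_
  have h1 := SuperMod.filt_smul (DB.sub_proj_mem hf) hv
  have h2 := SuperMod.filt_smul (DB.le_Jpow p U (DB.proj_mem p U f)) (D.sub_proj_mem DB hv)
  rw [show p + 1 + q = p + q + 1 by omega] at h1
  rw [show f • v - DB.proj p U f • D.proj q U v =
    (f - DB.proj p U f) • v + DB.proj p U f • (v - D.proj q U v) by
      rw [sub_smul, smul_sub]; abel]
  exact add_mem h1 h2

lemma eq_zero_of_mem (DB : AlgGradingData B g N) {p : ℕ} {U : Opens M} {v : E.sec U}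
    (hv : v ∈ e p U) (h : v ∈ E.filt (p + 1) U) : v = 0 := by
  rw [← D.proj_self p U v hv]
  exact (D.mem_filt DB).1 h p (by omega)

end ModGradingData

/-- A quasi-automorphism in `𝒬𝒜ut_(1)(2)` is the identity on `E_(p) / E_(p + 1)`. -/
lemma sub_mem_filt_of_mem_qautFilt {X : SuperPair M} {U : Opens M} {a : QuasiIso U X X}
    (ha : a ∈ qautFilt X 1 2 U) {p : ℕ} {V : Opens M} (k : V ≤ U) {v : X.mod.sec V}
    (hv : v ∈ X.mod.filt p V) : a.toModEquiv V k v - v ∈ X.mod.filt (p + 1) V := by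
  refine SuperMod.filt_of_local fun x hx => ?_
  obtain ⟨W, hW, hxW, hvW⟩ := hv x hx
  refine ⟨W, hW, hxW, ?_⟩
  have : X.mod.preFilt p W ≤ (X.mod.filt (p + 1) W).comap
      ((a.toModEquiv W (hW.trans k)).toAddMonoidHom - AddMonoidHom.id _) := by
    refine (AddSubgroup.closure_le _).2 ?_
    rintro _ ⟨f, hf, v, rfl⟩
    change a.toModEquiv W _ (f • v) - f • v ∈ X.mod.filt (p + 1) W
    -- The first term is controlled by `Ψ`, which is the identity on `𝒥 ^ p / 𝒥 ^ (p + 1)`; the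
    -- second by `Φ v ≡ v` modulo `𝒥 E`, with the factor `f` in `𝒥 ^ p`.
    rw [a.mod_smul, show ∀ (f' : X.alg.sec W) (v' : X.mod.sec W), f' • v' - f • v =
      (f' - f) • v' + f • (v' - v) from fun f' v' => by rw [sub_smul, smul_sub]; abel]
    exact add_mem (SuperMod.smul_mem_filt (sub_mem_Jpow_of_mem_autFilt ha.2 _ hf) _)
      (SuperMod.filt_smul hf (ha.1 W _ v))
  rw [map_sub, a.mod_res]
  exact this hvW

namespace RetractIso

variable {X Y : SuperPair M} {g : AlgGrading Y.alg} {e : ModGrading Y.mod} {N : ℕ}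

/-- The leading term of a section of `E_(p)`. -/
def modLead (r : RetractIso X Y g e) (p : ℕ) (V : Opens M) : X.mod.filt p V →+ Y.mod.sec V :=
  (r.toGrMod p V).comp (QuotientAddGroup.mk' _)

lemma modLead_eq_modLead (r : RetractIso X Y g e) {p : ℕ} {V : Opens M} {v v' : X.mod.filt p V} :
    r.modLead p V v = r.modLead p V v' ↔ v.1 - v'.1 ∈ X.mod.filt (p + 1) V := by
  change r.toGrMod p V (SuperMod.symb v.1 v.2) = r.toGrMod p V (SuperMod.symb v'.1 v'.2) ↔ _
  rw [(r.toGrMod_injective p V).eq_iff, SuperMod.symb_eq_symb]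

lemma modLead_congr (r : RetractIso X Y g e) {p : ℕ} {V : Opens M} {v v' : X.mod.filt p V}
    (h : v.1 = v'.1) : r.modLead p V v = r.modLead p V v' :=
  congrArg _ (Subtype.ext h)

lemma modLead_eq_zero (r : RetractIso X Y g e) {p : ℕ} {V : Opens M} {v : X.mod.filt p V}
    (h : v.1 = 0) : r.modLead p V v = 0 := by
  rw [r.modLead_congr (v' := 0) h, map_zero]

lemma res_modLead (r : RetractIso X Y g e) {p : ℕ} {U V : Opens M} (h : U ≤ V)
    (v : X.mod.filt p V) :
    Y.mod.res h (r.modLead p V v) = r.modLead p U ⟨X.mod.res h v, SuperMod.filt_res h v.2⟩ :=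
  r.toGrMod_res p h v.1 v.2

lemma modLead_smul (r : RetractIso X Y g e) {p q : ℕ} {V : Opens M} (f : X.alg.Jpow p V)
    (v : X.mod.filt q V) :
    r.modLead (p + q) V ⟨f.1 • v.1, SuperMod.filt_smul f.2 v.2⟩ =
      r.lead p V f • r.modLead q V v :=
  r.toGrMod_smul p q V f v f.2 v.2

/-- A quasi-isomorphism `δ` induces the given isomorphism of retracts. -/
def ModCompat (r : RetractIso X Y g e) (DB : AlgGradingData Y.alg g N)
    (D : ModGradingData Y.mod g e N) {U : Opens M} (δ : QuasiIso U X Y) : Prop :=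
  r.Compat DB δ.toAlgIso ∧ ∀ (p : ℕ) (V : Opens M) (k : V ≤ U) (v : X.mod.filt p V),
    D.proj p V (δ.toModEquiv V k v) = r.modLead p V v

lemma ModCompat.restrict {r : RetractIso X Y g e} {DB : AlgGradingData Y.alg g N}
    {D : ModGradingData Y.mod g e N} {U W : Opens M} {δ : QuasiIso U X Y}
    (h : r.ModCompat DB D δ) (k : W ≤ U) : r.ModCompat DB D (δ.restrict k) :=
  ⟨h.1.restrict k, fun p V k' f => h.2 p V (k'.trans k) f⟩

/-- Quasi-isomorphisms which induce the same isomorphism of retracts differ by a section of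
`𝒬𝒜ut_(1)(2)`. -/
lemma ModCompat.transition {r : RetractIso X Y g e} {DB : AlgGradingData Y.alg g N}
    {D : ModGradingData Y.mod g e N} {U : Opens M} {δ δ' : QuasiIso U X Y}
    (h : r.ModCompat DB D δ) (h' : r.ModCompat DB D δ') : δ.symm.trans δ' ∈ qautFilt Y 1 2 U := by
  refine ⟨fun V k w => ?_, h.1.transition h'.1⟩
  obtain ⟨v, rfl⟩ := (δ.toModEquiv V k).surjective w
  change δ'.toModEquiv V k ((δ.toModEquiv V k).symm (δ.toModEquiv V k v)) - _ ∈ _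
  rw [AddEquiv.symm_apply_apply]
  refine (D.mem_filt DB).2 fun i hi => ?_
  -- Only congruence modulo `𝒥 E` is demanded on the module, so degree `0` suffices and no parity
  -- argument is needed.
  obtain rfl : i = 0 := by omega
  rw [map_sub, sub_eq_zero]
  exact (h'.2 0 V k ⟨v, SuperMod.mem_filt_zero v⟩).trans
    (h.2 0 V k ⟨v, SuperMod.mem_filt_zero v⟩).symm

section GradedIso

variable (r : RetractIso X Y g e) (DB : AlgGradingData Y.alg g N) (D : ModGradingData Y.mod g e N)
  {U : Opens M} (φ : QuasiIso U Y X)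

/-- The additive map `s ↦ ∑ᵢ r (φ sᵢ)`, where `sᵢ` is the component of degree `i` of `s`. -/
def gradedHom (V : Opens M) (k : V ≤ U) : Y.mod.sec V →+ Y.mod.sec V :=
  ∑ i ∈ Finset.range N, (r.modLead i V).comp
    (AddMonoidHom.codRestrict ((φ.toModEquiv V k).toAddMonoidHom.comp (D.proj i V)) (X.mod.filt i V)
      fun v => φ.map_filt i V k (D.le_filt i V (D.proj_mem i V v)))

/-- Sections of degree at least `N` vanish and form the separate case, as in `gradedLin_of_mem`. -/
lemma gradedHom_of_mem {i : ℕ} {V : Opens M} (k : V ≤ U) {s : Y.mod.sec V} (hs : s ∈ e i V) :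
    r.gradedHom D φ V k s =
      r.modLead i V ⟨φ.toModEquiv V k s, φ.map_filt i V k (D.le_filt i V hs)⟩ := by
  by_cases hi : i < N
  · unfold gradedHom
    rw [AddMonoidHom.finsetSum_apply, Finset.sum_eq_single i]
    · refine r.modLead_congr ?_
      change φ.toModEquiv V k (D.proj i V s) = φ.toModEquiv V k s
      rw [D.proj_self i V s hs]
    · intro j _ hj
      refine r.modLead_eq_zero ?_
      change φ.toModEquiv V k (D.proj j V s) = 0
      rw [D.proj_ne j i V hj s hs, map_zero]
    · intro h
      exact absurd (Finset.mem_range.2 hi) h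
  · have h0 : s = 0 := D.eq_zero_of_le (by omega) hs
    subst h0
    rw [map_zero]
    exact (r.modLead_eq_zero (map_zero (φ.toModEquiv V k))).symm

lemma gradedHom_mem {i : ℕ} {V : Opens M} (k : V ≤ U) {s : Y.mod.sec V} (hs : s ∈ e i V) :
    r.gradedHom D φ V k s ∈ e i V := by
  rw [gradedHom_of_mem r D φ k hs]
  exact r.toGrMod_mem i V _

lemma proj_gradedHom (i : ℕ) (V : Opens M) (k : V ≤ U) (s : Y.mod.sec V) :
    D.proj i V (r.gradedHom D φ V k s) = r.gradedHom D φ V k (D.proj i V s) := by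
  induction s using D.induction with
  | h j s hs =>
    have := r.gradedHom_mem D φ k hs
    by_cases h : i = j
    · subst h; rw [D.proj_self i V s hs, D.proj_self i V _ this]
    · rw [D.proj_ne i j V h s hs, D.proj_ne i j V h _ this, map_zero]
  | hadd s t hs ht => rw [map_add, map_add, hs, ht, map_add, map_add]

lemma res_gradedHom {V W : Opens M} (h : W ≤ V) (k : V ≤ U) (s : Y.mod.sec V) :
    Y.mod.res h (r.gradedHom D φ V k s) = r.gradedHom D φ W (h.trans k) (Y.mod.res h s) := by
  induction s using D.induction with
  | h i s hs =>
    rw [gradedHom_of_mem r D φ k hs, gradedHom_of_mem r D φ _ (D.res_mem h hs), res_modLead]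
    exact r.modLead_congr (φ.mod_res h k s)
  | hadd s t hs ht => rw [map_add, map_add, hs, ht, map_add, map_add]

lemma σ_gradedHom (V : Opens M) (k : V ≤ U) (s : Y.mod.sec V) :
    Y.mod.σ V (r.gradedHom D φ V k s) = r.gradedHom D φ V k (Y.mod.σ V s) := by
  induction s using D.induction with
  | h i s hs =>
    rw [gradedHom_of_mem r D φ k hs, gradedHom_of_mem r D φ k (D.σ_mem i V s hs)]
    refine (r.toGrMod_σ i V _ _).trans ?_
    exact r.modLead_congr (φ.mod_σ V k s)
  | hadd s t hs ht => rw [map_add, map_add, hs, ht, map_add, map_add]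

/-- On homogeneous sections this is the compatibility of the isomorphism of retracts with products;
additivity in both arguments does the rest. It makes `gradedHom` semilinear over the graded
automorphism of the algebra. -/
lemma gradedHom_smul (V : Opens M) (k : V ≤ U) (f : Y.alg.sec V) (s : Y.mod.sec V) :
    r.gradedHom D φ V k (f • s) =
      r.gradedLin DB φ.toAlgIso V k f • r.gradedHom D φ V k s := by
  induction f using DB.induction with
  | h i f hf =>
    induction s using D.induction with
    | h j s hs =>
      rw [r.gradedLin_of_mem DB φ.toAlgIso k hf, gradedHom_of_mem r D φ k hs,
        gradedHom_of_mem r D φ k (D.smul_mem i j V f hf s hs), ← modLead_smul]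
      exact r.modLead_congr (φ.mod_smul V k f s)
    | hadd t t' ht ht' => rw [smul_add, map_add, ht, ht', map_add, smul_add]
  | hadd s s' hs hs' => rw [add_smul, map_add, hs, hs', map_add, add_smul]

include DB in
lemma gradedHom_injective (V : Opens M) (k : V ≤ U) :
    Function.Injective (r.gradedHom D φ V k) := by
  refine (injective_iff_map_eq_zero _).2 fun s hs => D.ext fun i => ?_
  have h1 := r.proj_gradedHom D φ i V k s
  rw [hs, map_zero, gradedHom_of_mem r D φ k (D.proj_mem i V s), eq_comm,
    ← map_zero (r.modLead i V), r.modLead_eq_modLead] at h1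
  have h2 := φ.symm.map_filt (i + 1) V k h1
  rw [map_zero]
  refine D.eq_zero_of_mem DB (D.proj_mem i V s) ?_
  change (φ.toModEquiv V k).symm (φ.toModEquiv V k (D.proj i V s) - 0) ∈ _ at h2
  rwa [sub_zero, AddEquiv.symm_apply_apply] at h2

include DB in
lemma gradedHom_surjective (V : Opens M) (k : V ≤ U) :
    Function.Surjective (r.gradedHom D φ V k) := by
  intro b
  induction b using D.induction with
  | h i b hb =>
    have : ∀ x : V, ∃ (W : Opens M) (h : W ≤ V), x.1 ∈ W ∧
        ∃ s : Y.mod.sec W, r.gradedHom D φ W (h.trans k) s = Y.mod.res h b := by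
      rintro ⟨x, hx⟩
      obtain ⟨W, h, hxW, s, hs⟩ := r.toGrMod_surjective i V b hb x hx
      obtain ⟨⟨f, hf⟩, rfl⟩ := QuotientAddGroup.mk'_surjective _ s
      have hf' := φ.symm.map_filt i W (h.trans k) hf
      refine ⟨W, h, hxW, D.proj i W (φ.symm.toModEquiv W (h.trans k) f), ?_⟩
      rw [gradedHom_of_mem r D φ _ (D.proj_mem i W _), ← hs]
      refine r.modLead_eq_modLead (v' := ⟨f, hf⟩) |>.2 ?_
      have h1 := φ.map_filt (i + 1) W (h.trans k) (neg_mem (D.sub_proj_mem DB hf'))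
      rw [neg_sub, map_sub] at h1
      change _ - φ.toModEquiv W _ ((φ.toModEquiv W _).symm f) ∈ _ at h1
      rwa [AddEquiv.apply_symm_apply] at h1
    choose W hW hxW s hs using this
    obtain ⟨f, hf⟩ := D.isSheaf.glue (V := V) (U := W) (fun x hx => ⟨⟨x, hx⟩, hxW _⟩)
      (fun x T h k' => Y.mod.res k' (s x)) (fun x T T' h k' l => Y.mod.res_res _ _ _)
      (fun x y T h k' k'' => r.gradedHom_injective DB D φ T (h.trans k) (by
        rw [← r.res_gradedHom D φ k' ((hW x).trans k), ← r.res_gradedHom D φ k'' ((hW y).trans k),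
          hs, hs, Y.mod.res_res, Y.mod.res_res]))
    refine ⟨f, D.isSheaf.sep (U := W) (fun x hx => ⟨⟨x, hx⟩, hxW _⟩) fun x T h k' => ?_⟩
    rw [r.res_gradedHom, hf x T h k', ← r.res_gradedHom D φ k' ((hW x).trans k), hs, Y.mod.res_res]
  | hadd b b' hb hb' =>
    obtain ⟨s, rfl⟩ := hb
    obtain ⟨s', rfl⟩ := hb'
    exact ⟨s + s', map_add _ _ _⟩

/-- The quasi-automorphism of `Y|_U` that preserves the gradings and is induced by an isomorphism of
retracts `gr X → Y` and a quasi-isomorphism `Y|_U → X|_U`. -/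
noncomputable def gradedQuasiIso : QuasiIso U Y Y where
  toAlgIso := r.gradedIso DB φ.toAlgIso
  toModEquiv V k := AddEquiv.ofBijective (r.gradedHom D φ V k)
    ⟨r.gradedHom_injective DB D φ V k, r.gradedHom_surjective DB D φ V k⟩
  mod_res h k f := r.res_gradedHom D φ h k f
  mod_σ V k f := r.σ_gradedHom D φ V k f
  mod_smul V k f s := r.gradedHom_smul DB D φ V k f s

lemma gradedQuasiIso_apply (V : Opens M) (k : V ≤ U) (s : Y.mod.sec V) :
    (r.gradedQuasiIso DB D φ).toModEquiv V k s = r.gradedHom D φ V k s := rfl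

lemma gradedQuasiIso_mem_iff (i : ℕ) (V : Opens M) (k : V ≤ U) (s : Y.mod.sec V) :
    (r.gradedQuasiIso DB D φ).toModEquiv V k s ∈ e i V ↔ s ∈ e i V := by
  rw [gradedQuasiIso_apply]
  refine ⟨fun h => ?_, r.gradedHom_mem D φ k⟩
  rw [D.mem_iff, r.proj_gradedHom] at h
  exact D.mem_iff.2 (r.gradedHom_injective DB D φ V k h)

/-- Any local quasi-isomorphism can thus be corrected by a graded quasi-automorphism so as to induce
`r`; passing to the leading component of `φ⁻¹ f` costs only a section one filtration step deeper. -/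
lemma modCompat_gradedQuasiIso :
    r.ModCompat DB D (φ.symm.trans (r.gradedQuasiIso DB D φ)) := by
  refine ⟨r.compat_gradedIso DB φ.toAlgIso, ?_⟩
  rintro p V k ⟨f, hf⟩
  change D.proj p V (r.gradedHom D φ V k ((φ.toModEquiv V k).symm f)) = _
  rw [proj_gradedHom, gradedHom_of_mem r D φ k (D.proj_mem p V _), r.modLead_eq_modLead]
  have h1 := φ.map_filt (p + 1) V k (neg_mem (D.sub_proj_mem DB (φ.symm.map_filt p V k hf)))
  rw [neg_sub, map_sub] at h1
  change _ - φ.toModEquiv V k ((φ.toModEquiv V k).symm f) ∈ _ at h1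
  rwa [AddEquiv.apply_symm_apply] at h1

/-- The graded quasi-automorphisms defined by `φ` and `φ'` agree if these differ by a section of
`𝒬𝒜ut_(1)(2)`. -/
lemma gradedQuasiIso_eq {φ φ' : QuasiIso U Y X} (h : φ'.trans φ.symm ∈ qautFilt Y 1 2 U) :
    r.gradedQuasiIso DB D φ = r.gradedQuasiIso DB D φ' := by
  refine QuasiIso.ext' (fun V k s => ?_) fun V k s => ?_
  · have := r.gradedIso_eq DB (φ := φ.toAlgIso) (φ' := φ'.toAlgIso) h.2
    change (r.gradedIso DB φ.toAlgIso).toEquiv V k s = (r.gradedIso DB φ'.toAlgIso).toEquiv V k s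
    rw [this]
  rw [gradedQuasiIso_apply, gradedQuasiIso_apply]
  induction s using D.induction with
  | h i s hs =>
    rw [gradedHom_of_mem r D φ k hs, gradedHom_of_mem r D φ' k hs, r.modLead_eq_modLead]
    have h1 := φ.map_filt _ V k (neg_mem (sub_mem_filt_of_mem_qautFilt h k (D.le_filt i V hs)))
    rw [neg_sub, map_sub] at h1
    change _ - φ.toModEquiv V k ((φ.toModEquiv V k).symm _) ∈ _ at h1
    rwa [AddEquiv.apply_symm_apply] at h1
  | hadd s t hs ht => rw [map_add, map_add, hs, ht]

end GradedIso

end RetractIso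

namespace Atlas

variable {X Y : SuperPair M} {g : AlgGrading Y.alg} {e : ModGrading Y.mod} {N : ℕ}

/-- The underlying atlas of the sheaf of superalgebras. -/
def toAlgAtlas (t : Atlas X Y) : AlgAtlas X.alg Y.alg where
  ι := t.ι
  U := t.U
  cover := t.cover
  chart i := (t.chart i).toAlgIso
  transition i j T hi hj := (t.transition i j T hi hj).2

lemma chart_sub_chart_mem (t : Atlas X Y) {i j : t.ι} {T : Opens M} (hi : T ≤ t.U i)
    (hj : T ≤ t.U j) {p : ℕ} {v : X.mod.sec T} (hv : v ∈ X.mod.filt p T) :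
    (t.chart i).toModEquiv T hi v - (t.chart j).toModEquiv T hj v ∈ Y.mod.filt (p + 1) T := by
  have h := sub_mem_filt_of_mem_qautFilt (t.transition i j T hi hj) le_rfl
    ((t.chart j).map_filt p T hj hv)
  change (t.chart i).toModEquiv T hi (((t.chart j).toModEquiv T hj).symm _) - _ ∈ _ at h
  rwa [AddEquiv.symm_apply_apply] at h

lemma exists_modLead (t : Atlas X Y) (DB : AlgGradingData Y.alg g N)
    (D : ModGradingData Y.mod g e N) (p : ℕ) (V : Opens M) (v : X.mod.filt p V) :
    ∃ b : Y.mod.sec V, ∀ i T (h : T ≤ V) (k : T ≤ t.U i),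
      Y.mod.res h b = D.proj p T ((t.chart i).toModEquiv T k (X.mod.res h v)) :=
  D.isSheaf.glue (fun x _ => t.cover x) _
    (fun i T T' h k l => by rw [D.proj_res, (t.chart i).mod_res, X.mod.res_res])
    (fun i j T h k k' =>
      D.proj_eq_of_sub_mem DB (t.chart_sub_chart_mem k k' (SuperMod.filt_res h v.2)))

variable (t : Atlas X Y) (DB : AlgGradingData Y.alg g N) (D : ModGradingData Y.mod g e N)

/-- The leading term in `Y` of a section of `E_(p)`, as seen by the charts of an atlas. -/
noncomputable def modLead (p : ℕ) (V : Opens M) : X.mod.filt p V →+ Y.mod.sec V where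
  toFun v := (t.exists_modLead DB D p V v).choose
  map_zero' := D.isSheaf.sep (fun x _ => t.cover x) fun i T h k => by
    rw [(t.exists_modLead DB D p V _).choose_spec i T h k, ZeroMemClass.coe_zero, map_zero,
      map_zero, map_zero, map_zero]
  map_add' v v' := D.isSheaf.sep (fun x _ => t.cover x) fun i T h k => by
    rw [map_add, (t.exists_modLead DB D p V _).choose_spec i T h k,
      (t.exists_modLead DB D p V _).choose_spec i T h k,
      (t.exists_modLead DB D p V _).choose_spec i T h k, ← map_add, ← map_add, ← map_add]
    rfl

lemma res_modLead {p : ℕ} {V : Opens M} (v : X.mod.filt p V) {i : t.ι} {T : Opens M} (h : T ≤ V)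
    (k : T ≤ t.U i) : Y.mod.res h (t.modLead DB D p V v) =
      D.proj p T ((t.chart i).toModEquiv T k (X.mod.res h v)) :=
  (t.exists_modLead DB D p V v).choose_spec i T h k

lemma modLead_eq_zero_iff {p : ℕ} {V : Opens M} (v : X.mod.filt p V) :
    t.modLead DB D p V v = 0 ↔ v.1 ∈ X.mod.filt (p + 1) V := by
  constructor
  · intro h
    refine SuperMod.filt_of_local fun x hx => ?_
    obtain ⟨i, hi⟩ := t.cover x
    have h1 := t.res_modLead DB D v (i := i) (T := V ⊓ t.U i) inf_le_left inf_le_right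
    rw [h, map_zero] at h1
    have h2 := D.sub_proj_mem DB ((t.chart i).map_filt p (V ⊓ t.U i) inf_le_right
      (SuperMod.filt_res inf_le_left v.2))
    rw [← h1, sub_zero] at h2
    have h3 := (t.chart i).symm.map_filt _ _ inf_le_right h2
    change ((t.chart i).toModEquiv _ _).symm _ ∈ _ at h3
    rw [AddEquiv.symm_apply_apply] at h3
    exact ⟨V ⊓ t.U i, inf_le_left, ⟨hx, hi⟩, h3⟩
  · intro h
    refine D.isSheaf.sep (fun x _ => t.cover x) fun i T l k => ?_
    rw [t.res_modLead DB D v l k, map_zero]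
    exact (D.mem_filt DB).1 ((t.chart i).map_filt _ T k (SuperMod.filt_res l h)) p (by omega)

/-- The isomorphism of retracts induced by the charts of an atlas. -/
noncomputable def retractIso : RetractIso X Y g e where
  toAlgRetractIso := t.toAlgAtlas.retractIso DB
  toGrMod p V := QuotientAddGroup.lift _ (t.modLead DB D p V) fun f hf =>
    (t.modLead_eq_zero_iff DB D f).2 hf
  toGrMod_mem p V s := by
    obtain ⟨f, rfl⟩ := QuotientAddGroup.mk'_surjective _ s
    change t.modLead DB D p V f ∈ e p V
    refine D.mem_of_local fun x hx => ?_
    obtain ⟨i, hi⟩ := t.cover x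
    exact ⟨V ⊓ t.U i, inf_le_left, ⟨hx, hi⟩, by
      rw [t.res_modLead DB D f inf_le_left inf_le_right]; exact D.proj_mem _ _ _⟩
  toGrMod_res p U V h f hf := by
    change Y.mod.res h (t.modLead DB D p V ⟨f, hf⟩) = t.modLead DB D p U ⟨X.mod.res h f, _⟩
    refine D.isSheaf.sep (fun x _ => t.cover x) fun i T l k => ?_
    rw [Y.mod.res_res, t.res_modLead DB D _ _ k, t.res_modLead DB D _ _ k, X.mod.res_res]
  toGrMod_injective p U := by
    refine (injective_iff_map_eq_zero _).2 fun s hs => ?_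
    obtain ⟨f, rfl⟩ := QuotientAddGroup.mk'_surjective _ s
    exact (QuotientAddGroup.eq_zero_iff _).2 ((t.modLead_eq_zero_iff DB D f).1 hs)
  toGrMod_surjective p U b hb x hx := by
    obtain ⟨i, hi⟩ := t.cover x
    have hb' := D.res_mem (inf_le_left : U ⊓ t.U i ≤ U) hb
    -- A homogeneous section lies in the filtration step of its degree, so its pull-back by the
    -- chart has a class in the right quotient.
    have hJ := (t.chart i).symm.map_filt p (U ⊓ t.U i) inf_le_right (D.le_filt p _ hb')
    refine ⟨U ⊓ t.U i, inf_le_left, ⟨hx, hi⟩, SuperMod.symb _ hJ, ?_⟩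
    change t.modLead DB D p _ ⟨_, hJ⟩ = _
    have h := t.res_modLead DB D ⟨_, hJ⟩ (i := i) le_rfl inf_le_right
    rw [Y.mod.res_self, X.mod.res_self] at h
    refine h.trans ?_
    change D.proj p _ ((t.chart i).toModEquiv _ _ (((t.chart i).toModEquiv _ _).symm _)) = _
    rw [AddEquiv.apply_symm_apply, D.proj_self _ _ _ hb']
  toGrMod_smul p q U f v hf hv := by
    change t.modLead DB D (p + q) U ⟨f • v, _⟩ =
      t.toAlgAtlas.lead DB p U ⟨f, hf⟩ • t.modLead DB D q U ⟨v, hv⟩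
    refine D.isSheaf.sep (fun x _ => t.cover x) fun i T l k => ?_
    rw [Y.mod.res_smul, t.res_modLead DB D _ l k, t.res_modLead DB D _ l k,
      t.toAlgAtlas.res_lead DB _ l k]
    refine Eq.trans ?_ (D.proj_smul DB
      ((t.chart i).toAlgIso.map_Jpow p T k (SuperAlg.Jpow_res l hf))
      ((t.chart i).map_filt q T k (SuperMod.filt_res l hv)))
    exact congrArg _ ((congrArg _ (X.mod.res_smul l f v)).trans ((t.chart i).mod_smul T k _ _))
  toGrMod_σ p U f hf := by
    change Y.mod.σ U (t.modLead DB D p U ⟨f, hf⟩) = t.modLead DB D p U ⟨X.mod.σ U f, _⟩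
    refine D.isSheaf.sep (fun x _ => t.cover x) fun i T l k => ?_
    rw [Y.mod.res_σ, t.res_modLead DB D _ l k, t.res_modLead DB D _ l k, X.mod.res_σ,
      ← (t.chart i).mod_σ, D.proj_σ]

lemma modCompat_retractIso (i : t.ι) : (t.retractIso DB D).ModCompat DB D (t.chart i) :=
  ⟨t.toAlgAtlas.compat_retractIso DB i, fun p V k f => by
    change _ = t.modLead DB D p V f
    have h := t.res_modLead DB D f (i := i) le_rfl k
    rw [Y.mod.res_self, X.mod.res_self] at h
    exact h.symm⟩

end Atlas

end GradedModules

/-! ### Comparison of cocycles, gluing of isomorphisms, and uniqueness of atlases up to the group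
action. -/

section Torsors

variable {M : Type u} [TopologicalSpace M]

open PresheafOfGroups

namespace Cocycle

variable {P : (Opens M)ᵒᵖ ⥤ GrpCat.{u}}

lemma mk_congr {ι : Type u} {U : ι → Opens M} {h h' : ∀ x : M, ∃ i, x ∈ U i} {z z' : OneCocycle P U}
    (hz : ∀ i j (T : Opens M) (a : T ⟶ U i) (b : T ⟶ U j), z.ev i j a b = z'.ev i j a b) :
    Cocycle.mk ι U h z = Cocycle.mk ι U h' z' := by
  have : z = z' := by
    cases z; cases z'
    congr 1
    exact OneCochain.ext (funext fun i => funext fun j => funext fun T => funext fun a => funext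
      fun b => hz i j T a b)
  rw [this]

lemma Rel.refl (c : Cocycle P) : Rel c c :=
  ⟨c.ι, c.U, c.cover, id, fun _ => le_rfl, id, fun _ => le_rfl, _, OneCohomologyRelation.refl _⟩

lemma Rel.symm {c d : Cocycle P} (h : Rel c d) : Rel d c := by
  obtain ⟨κ, W, hW, a, ha, b, hb, γ, hγ⟩ := h
  exact ⟨κ, W, hW, b, hb, a, ha, _, hγ.symm⟩

/-- The two relations index the middle cocycle `d` differently, through `b` and through `a'`. On the
common refinement the values of `d` itself pass from one indexing to the other. -/
lemma Rel.trans {c d e : Cocycle P} (h : Rel c d) (h' : Rel d e) : Rel c e := by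
  obtain ⟨κ, W, hW, a, ha, b, hb, γ, hγ⟩ := h
  obtain ⟨κ', W', hW', a', ha', b', hb', γ', hγ'⟩ := h'
  refine ⟨κ × κ', fun k => W k.1 ⊓ W' k.2, fun x => ?_, fun k => a k.1,
    fun k => inf_le_left.trans (ha k.1), fun k => b' k.2, fun k => inf_le_right.trans (hb' k.2),
    fun k => P.map (homOfLE (inf_le_right : W k.1 ⊓ W' k.2 ≤ W' k.2)).op (γ' k.2) *
      d.z.ev (a' k.2) (b k.1) (homOfLE (inf_le_right.trans (ha' k.2)))
        (homOfLE (inf_le_left.trans (hb k.1))) *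
      P.map (homOfLE (inf_le_left : W k.1 ⊓ W' k.2 ≤ W k.1)).op (γ k.1), ?_⟩
  · obtain ⟨k, hk⟩ := hW x
    obtain ⟨k', hk'⟩ := hW' x
    exact ⟨(k, k'), hk, hk'⟩
  · rintro ⟨k, k'⟩ ⟨l, l'⟩ T s t
    have h1 := hγ k l (homOfLE ((leOfHom s).trans inf_le_left))
      (homOfLE ((leOfHom t).trans inf_le_left))
    have h2 := hγ' k' l' (homOfLE ((leOfHom s).trans inf_le_right))
      (homOfLE ((leOfHom t).trans inf_le_right))
    have key : ∀ {A B C : Opens M} (i : A ⟶ B) (j : B ⟶ C) (k : A ⟶ C) (x : P.obj (op C)),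
        P.map i.op (P.map j.op x) = P.map k.op x := fun i j k x => by
      rw [show k = i ≫ j from rfl, op_comp, P.map_comp]; rfl
    simp only [map_mul, OneCochain.ev_precomp]
    rw [key s _ (homOfLE ((leOfHom s).trans inf_le_left)) (γ k),
      key s _ (homOfLE ((leOfHom s).trans inf_le_right)) (γ' k'),
      key t _ (homOfLE ((leOfHom t).trans inf_le_left)) (γ l),
      key t _ (homOfLE ((leOfHom t).trans inf_le_right)) (γ' l')]
    -- The group identity behind transitivity: both `d₁ d₂` and `d₃ d₄` equal the diagonal value
    -- `d₀` of `d`, by the cocycle condition.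
    have grp : ∀ {H : GrpCat.{u}} {x x' y y' f d₀ d₁ d₂ d₃ d₄ f' : H}, x * f = d₂ * y →
        x' * d₃ = f' * y' → d₁ * d₂ = d₀ → d₃ * d₄ = d₀ →
        x' * d₁ * x * f = f' * (y' * d₄ * y) := by
      intro H x x' y y' f d₀ d₁ d₂ d₃ d₄ f' h h' k k'
      rw [mul_assoc, h, ← mul_assoc, mul_assoc x', k, ← k', ← mul_assoc, ← mul_assoc, h']
      simp only [mul_assoc]
    exact grp h1 h2 (d.z.ev_trans _ _ _ _ _ _) (d.z.ev_trans _ _ _ _ _ _)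

end Cocycle

namespace H1

variable {P : (Opens M)ᵒᵖ ⥤ GrpCat.{u}}

/-- The relation is already an equivalence, so equality of classes yields an actual coboundary on a
refinement. -/
lemma mk_eq_mk {c d : Cocycle P} : mk c = mk d ↔ Cocycle.Rel c d :=
  Equivalence.quot_mk_eq_iff ⟨Cocycle.Rel.refl, Cocycle.Rel.symm, Cocycle.Rel.trans⟩ c d

end H1

section Glue

variable {ι : Type u} {U : ι → Opens M} (hU : ∀ x : M, ∃ i, x ∈ U i)
include hU

lemma AlgIso.exists_glue_apply {A B : SuperAlg M} (hB : B.IsSheaf) (φ : ∀ i, AlgIso (U i) A B)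
    (hφ : ∀ i j (T : Opens M) (hi : T ≤ U i) (hj : T ≤ U j) (f : A.sec T),
      (φ i).toEquiv T hi f = (φ j).toEquiv T hj f) (V : Opens M) (f : A.sec V) :
    ∃ b : B.sec V, ∀ i T (h : T ≤ V) (k : T ≤ U i),
      B.res h b = (φ i).toEquiv T k (A.res h f) :=
  hB.glue (fun x _ => hU x) _ (fun i T T' h k l => by rw [(φ i).map_res, A.res_res])
    (fun i j T h k k' => hφ i j T k k' _)

/-- Isomorphisms of sheaves of superalgebras can be glued. -/
lemma AlgIso.exists_glue {A B : SuperAlg M} (hA : A.IsSheaf) (hB : B.IsSheaf)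
    (φ : ∀ i, AlgIso (U i) A B)
    (hφ : ∀ i j (T : Opens M) (hi : T ≤ U i) (hj : T ≤ U j) (f : A.sec T),
      (φ i).toEquiv T hi f = (φ j).toEquiv T hj f) :
    ∃ ψ : AlgIso ⊤ A B, ∀ i (T : Opens M) (hi : T ≤ U i) (f : A.sec T),
      ψ.toEquiv T le_top f = (φ i).toEquiv T hi f := by
  -- The inverses agree on overlaps too, so they glue to a two-sided inverse and bijectivity needs
  -- no separate argument.
  have hφ' : ∀ i j (T : Opens M) (hi : T ≤ U i) (hj : T ≤ U j) (f : B.sec T),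
      (φ i).symm.toEquiv T hi f = (φ j).symm.toEquiv T hj f := fun i j T hi hj f =>
    ((φ i).toEquiv T hi).injective (by
      rw [hφ i j T hi hj ((φ j).symm.toEquiv T hj f)]
      exact (((φ i).toEquiv T hi).apply_symm_apply f).trans
        (((φ j).toEquiv T hj).apply_symm_apply f).symm)
  choose F hF using AlgIso.exists_glue_apply hU hB φ hφ
  choose G hG using AlgIso.exists_glue_apply hU hA (fun i => (φ i).symm) hφ'
  refine ⟨⟨fun V _ => AlgEquiv.mk ⟨F V, G V, ?_, ?_⟩ ?_ ?_ ?_, ?_, ?_⟩, ?_⟩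
  · refine fun f => hA.sep (fun x _ => hU x) fun i T h k => ?_
    rw [hG V _ i T h k, hF V _ i T h k]
    exact ((φ i).toEquiv T k).symm_apply_apply _
  · refine fun f => hB.sep (fun x _ => hU x) fun i T h k => ?_
    rw [hF V _ i T h k, hG V _ i T h k]
    exact ((φ i).toEquiv T k).apply_symm_apply _
  · refine fun f g => hB.sep (fun x _ => hU x) fun i T h k => ?_
    change B.res h (F V (f * g)) = B.res h (F V f * F V g)
    rw [map_mul, hF V _ i T h k, hF V _ i T h k, hF V _ i T h k, map_mul, map_mul]
  · refine fun f g => hB.sep (fun x _ => hU x) fun i T h k => ?_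
    change B.res h (F V (f + g)) = B.res h (F V f + F V g)
    rw [map_add, hF V _ i T h k, hF V _ i T h k, hF V _ i T h k, map_add, map_add]
  · refine fun c => hB.sep (fun x _ => hU x) fun i T h k => ?_
    change B.res h (F V (algebraMap ℂ _ c)) = _
    rw [hF V _ i T h k, AlgHom.commutes, AlgEquiv.commutes, AlgHom.commutes]
  · refine fun {V W} h k f => hB.sep (fun x _ => hU x) fun i T l m => ?_
    change B.res l (B.res h (F V f)) = B.res l (F W (A.res h f))
    rw [B.res_res, hF V _ i T _ m, hF W _ i T _ m, A.res_res]
  · refine fun V k f => hB.sep (fun x _ => hU x) fun i T l m => ?_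
    change B.res l (B.σ V (F V f)) = B.res l (F V (A.σ V f))
    rw [B.res_σ, hF V _ i T _ m, hF V _ i T _ m, A.res_σ, (φ i).map_σ]
  · intro i T hi f
    change F T f = _
    rw [← B.res_self T (F T f), hF T _ i T le_rfl hi, A.res_self]

lemma QuasiIso.exists_glue_apply {X Y : SuperPair M} (hY : Y.mod.IsSheaf)
    (φ : ∀ i, QuasiIso (U i) X Y)
    (hφ : ∀ i j (T : Opens M) (hi : T ≤ U i) (hj : T ≤ U j) (f : X.mod.sec T),
      (φ i).toModEquiv T hi f = (φ j).toModEquiv T hj f) (V : Opens M) (f : X.mod.sec V) :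
    ∃ b : Y.mod.sec V, ∀ i T (h : T ≤ V) (k : T ≤ U i),
      Y.mod.res h b = (φ i).toModEquiv T k (X.mod.res h f) :=
  hY.glue (fun x _ => hU x) _ (fun i T T' h k l => by rw [(φ i).mod_res, X.mod.res_res])
    (fun i j T h k k' => hφ i j T k k' _)

/-- Quasi-isomorphisms can be glued. -/
lemma QuasiIso.exists_glue {X Y : SuperPair M} (hXA : X.alg.IsSheaf) (hYA : Y.alg.IsSheaf)
    (hX : X.mod.IsSheaf) (hY : Y.mod.IsSheaf) (φ : ∀ i, QuasiIso (U i) X Y)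
    (hφA : ∀ i j (T : Opens M) (hi : T ≤ U i) (hj : T ≤ U j) (f : X.alg.sec T),
      (φ i).toEquiv T hi f = (φ j).toEquiv T hj f)
    (hφ : ∀ i j (T : Opens M) (hi : T ≤ U i) (hj : T ≤ U j) (f : X.mod.sec T),
      (φ i).toModEquiv T hi f = (φ j).toModEquiv T hj f) :
    ∃ ψ : QuasiIso ⊤ X Y, (∀ i (T : Opens M) (hi : T ≤ U i) (f : X.alg.sec T),
      ψ.toEquiv T le_top f = (φ i).toEquiv T hi f) ∧
      ∀ i (T : Opens M) (hi : T ≤ U i) (f : X.mod.sec T),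
      ψ.toModEquiv T le_top f = (φ i).toModEquiv T hi f := by
  obtain ⟨ψ, hψ⟩ := AlgIso.exists_glue hU hXA hYA (fun i => (φ i).toAlgIso) hφA
  have hφ' : ∀ i j (T : Opens M) (hi : T ≤ U i) (hj : T ≤ U j) (f : Y.mod.sec T),
      (φ i).symm.toModEquiv T hi f = (φ j).symm.toModEquiv T hj f := fun i j T hi hj f =>
    ((φ i).toModEquiv T hi).injective (by
      rw [hφ i j T hi hj ((φ j).symm.toModEquiv T hj f)]
      exact (((φ i).toModEquiv T hi).apply_symm_apply f).trans
        (((φ j).toModEquiv T hj).apply_symm_apply f).symm)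
  choose F hF using QuasiIso.exists_glue_apply hU hY φ hφ
  choose G hG using QuasiIso.exists_glue_apply hU hX (fun i => (φ i).symm) hφ'
  refine ⟨⟨ψ, fun V _ => AddEquiv.mk ⟨F V, G V, ?_, ?_⟩ ?_, ?_, ?_, ?_⟩, hψ, ?_⟩
  · refine fun f => hX.sep (fun x _ => hU x) fun i T h k => ?_
    rw [hG V _ i T h k, hF V _ i T h k]
    exact ((φ i).toModEquiv T k).symm_apply_apply _
  · refine fun f => hY.sep (fun x _ => hU x) fun i T h k => ?_
    rw [hF V _ i T h k, hG V _ i T h k]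
    exact ((φ i).toModEquiv T k).apply_symm_apply _
  · refine fun f g => hY.sep (fun x _ => hU x) fun i T h k => ?_
    change Y.mod.res h (F V (f + g)) = Y.mod.res h (F V f + F V g)
    rw [map_add, hF V _ i T h k, hF V _ i T h k, hF V _ i T h k, map_add, map_add]
  · refine fun {V W} h k f => hY.sep (fun x _ => hU x) fun i T l m => ?_
    change Y.mod.res l (Y.mod.res h (F V f)) = Y.mod.res l (F W (X.mod.res h f))
    rw [Y.mod.res_res, hF V _ i T _ m, hF W _ i T _ m, X.mod.res_res]
  · refine fun V k f => hY.sep (fun x _ => hU x) fun i T l m => ?_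
    change Y.mod.res l (Y.mod.σ V (F V f)) = Y.mod.res l (F V (X.mod.σ V f))
    rw [Y.mod.res_σ, hF V _ i T _ m, hF V _ i T _ m, X.mod.res_σ, (φ i).mod_σ]
  · refine fun V k f v => hY.sep (fun x _ => hU x) fun i T l m => ?_
    change Y.mod.res l (F V (f • v)) = Y.mod.res l (ψ.toEquiv V k f • F V v)
    rw [Y.mod.res_smul, hF V _ i T _ m, hF V _ i T _ m, X.mod.res_smul, (φ i).mod_smul, ψ.map_res,
      hψ i T m]
  · intro i T hi f
    change F T f = _
    rw [← Y.mod.res_self T (F T f), hF T _ i T le_rfl hi, X.mod.res_self]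

end Glue

namespace AlgAtlas

variable {A A' B : SuperAlg M} {g : AlgGrading B} {N : ℕ}

/-- The atlas obtained by composing the charts with an automorphism of the target. -/
def conj (t : AlgAtlas A B) (a : AlgIso ⊤ B B) : AlgAtlas A B where
  ι := t.ι
  U := t.U
  cover := t.cover
  chart i := (t.chart i).trans (a.restrict le_top)
  transition i j T hi hj :=
    ((autConj B 2 a).app (op T) ⟨_, t.transition i j T hi hj⟩).2

/-- The atlas obtained by composing an isomorphism with the charts. -/
def comap (t : AlgAtlas A B) (ψ : AlgIso ⊤ A' A) : AlgAtlas A' B where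
  ι := t.ι
  U := t.U
  cover := t.cover
  chart i := (ψ.restrict le_top).trans (t.chart i)
  transition i j T hi hj := by
    have h := t.transition i j T hi hj
    convert h using 1
    refine AlgIso.ext' fun V k f => ?_
    change (t.chart i).toEquiv V _ (ψ.toEquiv V _ ((ψ.toEquiv V _).symm
      (((t.chart j).toEquiv V _).symm f))) = _
    rw [AlgEquiv.apply_symm_apply]
    rfl

/-- The isomorphism `ψ` cancels between one chart and the inverse of another, so isomorphic sheaves
have atlases with literally the same cocycle. -/
lemma cocycle_comap (t : AlgAtlas A B) (ψ : AlgIso ⊤ A' A) :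
    (t.comap ψ).cocycle = t.cocycle := by
  refine Cocycle.mk_congr fun i j T a b => Subtype.ext ?_
  refine AlgIso.ext' fun V k f => ?_
  change (t.chart i).toEquiv V _ (ψ.toEquiv V _ ((ψ.toEquiv V _).symm
    (((t.chart j).toEquiv V _).symm f))) = _
  rw [AlgEquiv.apply_symm_apply]
  rfl

/-- Atlases that induce the same isomorphism of retracts have cohomologous cocycles. -/
lemma rel_of_compat {r : AlgRetractIso A B g} {D : AlgGradingData B g N} {t t' : AlgAtlas A B}
    (h : ∀ i, r.Compat D (t.chart i)) (h' : ∀ i, r.Compat D (t'.chart i)) :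
    Cocycle.Rel t.cocycle t'.cocycle := by
  refine ⟨t.ι × t'.ι, fun k => t.U k.1 ⊓ t'.U k.2, fun x => ?_, Prod.fst, fun k => inf_le_left,
    Prod.snd, fun k => inf_le_right, fun k =>
      -- The coboundary is the change of charts from `t` to `t'`; it lies in `𝒜ut_(2)` because both
      -- charts induce `r`.
      ⟨((t.chart k.1).restrict inf_le_left).symm.trans ((t'.chart k.2).restrict inf_le_right),
        ((h k.1).restrict _).transition ((h' k.2).restrict _)⟩, ?_⟩
  · obtain ⟨i, hi⟩ := t.cover x
    obtain ⟨j, hj⟩ := t'.cover x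
    exact ⟨(i, j), hi, hj⟩
  · rintro ⟨i, i'⟩ ⟨j, j'⟩ T a b
    refine Subtype.ext (AlgIso.ext' fun V k f => ?_)
    change (t'.chart i').toEquiv V _ (((t.chart i).toEquiv V _).symm ((t.chart i).toEquiv V _
      (((t.chart j).toEquiv V _).symm f))) = (t'.chart i').toEquiv V _
      (((t'.chart j').toEquiv V _).symm ((t'.chart j').toEquiv V _
      (((t.chart j).toEquiv V _).symm f)))
    rw [AlgEquiv.symm_apply_apply, AlgEquiv.symm_apply_apply]

/-- The orbit of the class of the cocycle of an atlas does not depend on the atlas. -/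
lemma exists_smul_eq (D : AlgGradingData B g N) (t t' : AlgAtlas A B) :
    ∃ a : autZero B g, a • H1.mk t'.cocycle = H1.mk t.cocycle := by
  -- The retract isomorphism of `t` and the charts of `t'` define graded automorphisms over the
  -- covering of `t'`. On overlaps they agree, because the transitions of `t'` lie in `𝒜ut_(2)`.
  obtain ⟨a, ha⟩ := AlgIso.exists_glue t'.cover D.isSheaf D.isSheaf
    (fun j => (t.retractIso D).gradedIso D (t'.chart j).symm) fun i j T hi hj f => by
      have h := (t.retractIso D).gradedIso_eq D (φ := ((t'.chart i).restrict hi).symm)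
        (φ' := ((t'.chart j).restrict hj).symm) (t'.transition i j T hi hj)
      exact congrArg (fun φ : AlgIso T B B => φ.toEquiv T le_rfl f) h
  refine ⟨⟨a, fun p V f => ⟨fun h => ?_, fun h => ?_⟩⟩, ?_⟩
  · refine D.mem_of_local fun x hx => ?_
    obtain ⟨i, hi⟩ := t'.cover x
    refine ⟨V ⊓ t'.U i, inf_le_left, ⟨hx, hi⟩, ?_⟩
    have h := D.res_mem (inf_le_left : V ⊓ t'.U i ≤ V) h
    rwa [a.map_res, ha i _ inf_le_right, AlgRetractIso.gradedIso_mem_iff] at h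
  · refine D.mem_of_local fun x hx => ?_
    obtain ⟨i, hi⟩ := t'.cover x
    refine ⟨V ⊓ t'.U i, inf_le_left, ⟨hx, hi⟩, ?_⟩
    rw [a.map_res, ha i _ inf_le_right, AlgRetractIso.gradedIso_mem_iff]
    exact D.res_mem (inf_le_left : V ⊓ t'.U i ≤ V) h
  -- Acting by `a` on the class amounts to composing the charts of `t'` with `a`. The new charts
  -- induce the retract isomorphism of `t`.
  · change H1.mk (t'.conj a).cocycle = _
    refine H1.mk_eq_mk.2 (rel_of_compat (r := t.retractIso D) (D := D) (fun j => ?_)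
      (t.compat_retractIso D))
    have h : (t'.conj a).chart j =
        (t'.chart j).symm.symm.trans ((t.retractIso D).gradedIso D (t'.chart j).symm) :=
      AlgIso.ext' fun V k f => ha j V k _
    rw [h]
    exact AlgRetractIso.compat_gradedIso _ D _

/-- Sheaves with atlases that have cohomologous cocycles are isomorphic. -/
lemma nonempty_iso_of_rel (hA : A.IsSheaf) (hA' : A'.IsSheaf) (t : AlgAtlas A B)
    (t' : AlgAtlas A' B) (h : Cocycle.Rel t.cocycle t'.cocycle) : Nonempty (AlgIso ⊤ A A') := by
  obtain ⟨κ, W, hW, a, ha, b, hb, γ, hγ⟩ := h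
  -- Locally the isomorphism is the chart of `t`, then `γ`, then the inverse chart of `t'`. The
  -- coboundary relation says precisely that these agree on overlaps.
  obtain ⟨ψ, _⟩ := AlgIso.exists_glue hW hA hA' (fun k =>
    (((t.chart (a k)).restrict (ha k)).trans (γ k).1).trans
      ((t'.chart (b k)).restrict (hb k)).symm) fun k l T hk hl f => by
    have h1 := hγ k l (homOfLE hk) (homOfLE hl)
    have h2 := congrArg (fun φ : autFilt B 2 T => φ.1.toEquiv T le_rfl
      ((t.chart (a l)).toEquiv T (hl.trans (ha l)) f)) h1
    change (γ k).1.toEquiv T hk ((t.chart (a k)).toEquiv T _ (((t.chart (a l)).toEquiv T _).symm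
      ((t.chart (a l)).toEquiv T _ f))) = (t'.chart (b k)).toEquiv T _
      (((t'.chart (b l)).toEquiv T _).symm ((γ l).1.toEquiv T hl
      ((t.chart (a l)).toEquiv T _ f))) at h2
    rw [AlgEquiv.symm_apply_apply] at h2
    change ((t'.chart (b k)).toEquiv T _).symm ((γ k).1.toEquiv T hk
      ((t.chart (a k)).toEquiv T _ f)) = ((t'.chart (b l)).toEquiv T _).symm
      ((γ l).1.toEquiv T hl ((t.chart (a l)).toEquiv T _ f))
    rw [h2, AlgEquiv.symm_apply_apply]
  exact ⟨ψ⟩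

/-- The automorphism `a` is absorbed into the charts: `t.conj a` is another atlas of the same sheaf,
and its class is `a • H1.mk t.cocycle`. -/
lemma nonempty_iso_of_smul_eq (hA : A.IsSheaf) (hA' : A'.IsSheaf) (t : AlgAtlas A B)
    (t' : AlgAtlas A' B) (a : AlgIso ⊤ B B)
    (h : a • H1.mk t.cocycle = H1.mk t'.cocycle) : Nonempty (AlgIso ⊤ A A') :=
  nonempty_iso_of_rel hA hA' (t.conj a) t' (H1.mk_eq_mk.1 h)

/-- A sheaf that is locally isomorphic to `B` and has an isomorphism of its retract with `B` has an
atlas. -/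
lemma nonempty_of_retractIso (r : AlgRetractIso A B g) (D : AlgGradingData B g N)
    (h : ∀ x : M, ∃ U : Opens M, x ∈ U ∧ Nonempty (AlgIso U B A)) : Nonempty (AlgAtlas A B) := by
  choose U hU φ using h
  exact ⟨{
    ι := M
    U := U
    cover := fun x => ⟨x, hU x⟩
    -- Each local isomorphism is corrected by its graded automorphism, so that all charts induce `r`
    -- and the transitions lie in `𝒜ut_(2)`.
    chart := fun x => (φ x).some.symm.trans (r.gradedIso D (φ x).some)
    transition := fun x y T hx hy =>
      ((r.compat_gradedIso D (φ y).some).restrict hy).transition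
        ((r.compat_gradedIso D (φ x).some).restrict hx) }⟩

end AlgAtlas

namespace Atlas

variable {X X' Y : SuperPair M} {g : AlgGrading Y.alg} {e : ModGrading Y.mod} {N : ℕ}

/-- The atlas obtained by composing the charts with a quasi-automorphism of the target. -/
def conj (t : Atlas X Y) (a : QuasiIso ⊤ Y Y) : Atlas X Y where
  ι := t.ι
  U := t.U
  cover := t.cover
  chart i := (t.chart i).trans (a.restrict le_top)
  transition i j T hi hj :=
    ((qautConj Y 1 2 a).app (op T) ⟨_, t.transition i j T hi hj⟩).2

lemma comap_transition (t : Atlas X Y) (ψ : QuasiIso ⊤ X' X) {i j : t.ι} {T : Opens M}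
    (hi : T ≤ t.U i) (hj : T ≤ t.U j) :
    (((ψ.restrict le_top).trans (t.chart j)).restrict hj).symm.trans
      (((ψ.restrict le_top).trans (t.chart i)).restrict hi) =
    ((t.chart j).restrict hj).symm.trans ((t.chart i).restrict hi) := by
  refine QuasiIso.ext' (fun V k f => ?_) fun V k f => ?_
  · change (t.chart i).toEquiv V _ (ψ.toEquiv V _ ((ψ.toEquiv V _).symm
      (((t.chart j).toEquiv V _).symm f))) = _
    rw [AlgEquiv.apply_symm_apply]
    rfl
  · change (t.chart i).toModEquiv V _ (ψ.toModEquiv V _ ((ψ.toModEquiv V _).symm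
      (((t.chart j).toModEquiv V _).symm f))) = _
    rw [AddEquiv.apply_symm_apply]
    rfl

/-- The atlas obtained by composing a quasi-isomorphism with the charts. -/
def comap (t : Atlas X Y) (ψ : QuasiIso ⊤ X' X) : Atlas X' Y where
  ι := t.ι
  U := t.U
  cover := t.cover
  chart i := (ψ.restrict le_top).trans (t.chart i)
  transition i j T hi hj := by
    rw [t.comap_transition]
    exact t.transition i j T hi hj

lemma cocycle_comap (t : Atlas X Y) (ψ : QuasiIso ⊤ X' X) :
    (t.comap ψ).cocycle = t.cocycle :=
  Cocycle.mk_congr fun i j T a b => Subtype.ext (t.comap_transition ψ _ _)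

/-- Atlases that induce the same isomorphism of retracts have cohomologous cocycles. -/
lemma rel_of_compat {r : RetractIso X Y g e} {DB : AlgGradingData Y.alg g N}
    {D : ModGradingData Y.mod g e N} {t t' : Atlas X Y}
    (h : ∀ i, r.ModCompat DB D (t.chart i)) (h' : ∀ i, r.ModCompat DB D (t'.chart i)) :
    Cocycle.Rel t.cocycle t'.cocycle := by
  refine ⟨t.ι × t'.ι, fun k => t.U k.1 ⊓ t'.U k.2, fun x => ?_, Prod.fst, fun k => inf_le_left,
    Prod.snd, fun k => inf_le_right, fun k =>
      ⟨((t.chart k.1).restrict inf_le_left).symm.trans ((t'.chart k.2).restrict inf_le_right),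
        ((h k.1).restrict _).transition ((h' k.2).restrict _)⟩, ?_⟩
  · obtain ⟨i, hi⟩ := t.cover x
    obtain ⟨j, hj⟩ := t'.cover x
    exact ⟨(i, j), hi, hj⟩
  · rintro ⟨i, i'⟩ ⟨j, j'⟩ T a b
    refine Subtype.ext (QuasiIso.ext' (fun V k f => ?_) fun V k f => ?_)
    · change (t'.chart i').toEquiv V _ (((t.chart i).toEquiv V _).symm ((t.chart i).toEquiv V _
        (((t.chart j).toEquiv V _).symm f))) = (t'.chart i').toEquiv V _
        (((t'.chart j').toEquiv V _).symm ((t'.chart j').toEquiv V _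
        (((t.chart j).toEquiv V _).symm f)))
      rw [AlgEquiv.symm_apply_apply, AlgEquiv.symm_apply_apply]
    · change (t'.chart i').toModEquiv V _ (((t.chart i).toModEquiv V _).symm
        ((t.chart i).toModEquiv V _ (((t.chart j).toModEquiv V _).symm f))) =
        (t'.chart i').toModEquiv V _ (((t'.chart j').toModEquiv V _).symm
        ((t'.chart j').toModEquiv V _ (((t.chart j).toModEquiv V _).symm f)))
      rw [AddEquiv.symm_apply_apply, AddEquiv.symm_apply_apply]

/-- The orbit of the class of the cocycle of an atlas does not depend on the atlas. -/
lemma exists_smul_eq (DB : AlgGradingData Y.alg g N) (D : ModGradingData Y.mod g e N)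
    (t t' : Atlas X Y) : ∃ a : qautZero Y g e, a • H1.mk t'.cocycle = H1.mk t.cocycle := by
  -- Transitions of `t'` act trivially on the graded pieces; hence the graded quasi-automorphisms
  -- built from different charts coincide on overlaps and glue.
  have heq : ∀ i j (T : Opens M) (hi : T ≤ t'.U i) (hj : T ≤ t'.U j),
      (t.retractIso DB D).gradedQuasiIso DB D ((t'.chart i).restrict hi).symm =
        (t.retractIso DB D).gradedQuasiIso DB D ((t'.chart j).restrict hj).symm :=
    fun i j T hi hj => (t.retractIso DB D).gradedQuasiIso_eq DB D
      (φ := ((t'.chart i).restrict hi).symm) (φ' := ((t'.chart j).restrict hj).symm)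
      (t'.transition i j T hi hj)
  obtain ⟨a, haA, ha⟩ := QuasiIso.exists_glue t'.cover DB.isSheaf DB.isSheaf D.isSheaf D.isSheaf
    (fun j => (t.retractIso DB D).gradedQuasiIso DB D (t'.chart j).symm)
    (fun i j T hi hj f =>
      congrArg (fun φ : QuasiIso T Y Y => φ.toEquiv T le_rfl f) (heq i j T hi hj))
    (fun i j T hi hj f =>
      congrArg (fun φ : QuasiIso T Y Y => φ.toModEquiv T le_rfl f) (heq i j T hi hj))
  refine ⟨⟨a, fun p V f => ⟨fun h => ?_, fun h => ?_⟩, fun p V f => ⟨fun h => ?_, fun h => ?_⟩⟩, ?_⟩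
  · refine D.mem_of_local fun x hx => ?_
    obtain ⟨i, hi⟩ := t'.cover x
    refine ⟨V ⊓ t'.U i, inf_le_left, ⟨hx, hi⟩, ?_⟩
    have h := D.res_mem (inf_le_left : V ⊓ t'.U i ≤ V) h
    rwa [a.mod_res, ha i _ inf_le_right, RetractIso.gradedQuasiIso_mem_iff] at h
  · refine D.mem_of_local fun x hx => ?_
    obtain ⟨i, hi⟩ := t'.cover x
    refine ⟨V ⊓ t'.U i, inf_le_left, ⟨hx, hi⟩, ?_⟩
    rw [a.mod_res, ha i _ inf_le_right, RetractIso.gradedQuasiIso_mem_iff]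
    exact D.res_mem (inf_le_left : V ⊓ t'.U i ≤ V) h
  · refine DB.mem_of_local fun x hx => ?_
    obtain ⟨i, hi⟩ := t'.cover x
    refine ⟨V ⊓ t'.U i, inf_le_left, ⟨hx, hi⟩, ?_⟩
    have h := DB.res_mem (inf_le_left : V ⊓ t'.U i ≤ V) h
    rw [a.map_res, haA i _ inf_le_right] at h
    exact ((t.retractIso DB D).gradedIso_mem_iff DB (t'.chart i).symm.toAlgIso p _ _ _).1 h
  · refine DB.mem_of_local fun x hx => ?_
    obtain ⟨i, hi⟩ := t'.cover x
    refine ⟨V ⊓ t'.U i, inf_le_left, ⟨hx, hi⟩, ?_⟩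
    rw [a.map_res, haA i _ inf_le_right]
    exact ((t.retractIso DB D).gradedIso_mem_iff DB (t'.chart i).symm.toAlgIso p _ _ _).2
      (DB.res_mem (inf_le_left : V ⊓ t'.U i ≤ V) h)
  · change H1.mk (t'.conj a).cocycle = _
    refine H1.mk_eq_mk.2 (rel_of_compat (r := t.retractIso DB D) (DB := DB) (D := D) (fun j => ?_)
      (t.modCompat_retractIso DB D))
    have h : (t'.conj a).chart j =
        (t'.chart j).symm.symm.trans ((t.retractIso DB D).gradedQuasiIso DB D (t'.chart j).symm) :=
      QuasiIso.ext' (fun V k f => haA j V k _) fun V k f => ha j V k _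
    rw [h]
    exact RetractIso.modCompat_gradedQuasiIso _ DB D _

/-- Sheaves with atlases that have cohomologous cocycles are quasi-isomorphic. -/
lemma nonempty_iso_of_rel (hXA : X.alg.IsSheaf) (hXA' : X'.alg.IsSheaf) (hX : X.mod.IsSheaf)
    (hX' : X'.mod.IsSheaf) (t : Atlas X Y) (t' : Atlas X' Y)
    (h : Cocycle.Rel t.cocycle t'.cocycle) : Nonempty (QuasiIso ⊤ X X') := by
  obtain ⟨κ, W, hW, a, ha, b, hb, γ, hγ⟩ := h
  -- The algebra part and the module part are glued from the same composites; each overlap condition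
  -- is one half of the coboundary relation.
  obtain ⟨ψ, _⟩ := QuasiIso.exists_glue hW hXA hXA' hX hX' (fun k =>
    (((t.chart (a k)).restrict (ha k)).trans (γ k).1).trans
      ((t'.chart (b k)).restrict (hb k)).symm) (fun k l T hk hl f => by
    have h1 := hγ k l (homOfLE hk) (homOfLE hl)
    have h2 := congrArg (fun φ : qautFilt Y 1 2 T => φ.1.toEquiv T le_rfl
      ((t.chart (a l)).toEquiv T (hl.trans (ha l)) f)) h1
    change (γ k).1.toEquiv T hk ((t.chart (a k)).toEquiv T _ (((t.chart (a l)).toEquiv T _).symm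
      ((t.chart (a l)).toEquiv T _ f))) = (t'.chart (b k)).toEquiv T _
      (((t'.chart (b l)).toEquiv T _).symm ((γ l).1.toEquiv T hl
      ((t.chart (a l)).toEquiv T _ f))) at h2
    rw [AlgEquiv.symm_apply_apply] at h2
    change ((t'.chart (b k)).toEquiv T _).symm ((γ k).1.toEquiv T hk
      ((t.chart (a k)).toEquiv T _ f)) = ((t'.chart (b l)).toEquiv T _).symm
      ((γ l).1.toEquiv T hl ((t.chart (a l)).toEquiv T _ f))
    rw [h2, AlgEquiv.symm_apply_apply]) (fun k l T hk hl f => by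
    have h1 := hγ k l (homOfLE hk) (homOfLE hl)
    have h2 := congrArg (fun φ : qautFilt Y 1 2 T => φ.1.toModEquiv T le_rfl
      ((t.chart (a l)).toModEquiv T (hl.trans (ha l)) f)) h1
    change (γ k).1.toModEquiv T hk ((t.chart (a k)).toModEquiv T _
      (((t.chart (a l)).toModEquiv T _).symm ((t.chart (a l)).toModEquiv T _ f))) =
      (t'.chart (b k)).toModEquiv T _ (((t'.chart (b l)).toModEquiv T _).symm
      ((γ l).1.toModEquiv T hl ((t.chart (a l)).toModEquiv T _ f))) at h2
    rw [AddEquiv.symm_apply_apply] at h2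
    change ((t'.chart (b k)).toModEquiv T _).symm ((γ k).1.toModEquiv T hk
      ((t.chart (a k)).toModEquiv T _ f)) = ((t'.chart (b l)).toModEquiv T _).symm
      ((γ l).1.toModEquiv T hl ((t.chart (a l)).toModEquiv T _ f))
    rw [h2, AddEquiv.symm_apply_apply])
  exact ⟨ψ⟩

lemma nonempty_iso_of_smul_eq (hXA : X.alg.IsSheaf) (hXA' : X'.alg.IsSheaf) (hX : X.mod.IsSheaf)
    (hX' : X'.mod.IsSheaf) (t : Atlas X Y) (t' : Atlas X' Y) (a : QuasiIso ⊤ Y Y)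
    (h : a • H1.mk t.cocycle = H1.mk t'.cocycle) : Nonempty (QuasiIso ⊤ X X') :=
  nonempty_iso_of_rel hXA hXA' hX hX' (t.conj a) t' (H1.mk_eq_mk.1 h)

/-- A sheaf that is locally quasi-isomorphic to `Y` and has an isomorphism of its retract with `Y`
has an atlas. -/
lemma nonempty_of_retractIso (r : RetractIso X Y g e) (DB : AlgGradingData Y.alg g N)
    (D : ModGradingData Y.mod g e N)
    (h : ∀ x : M, ∃ U : Opens M, x ∈ U ∧ Nonempty (QuasiIso U Y X)) : Nonempty (Atlas X Y) := by
  choose U hU φ using h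
  exact ⟨{
    ι := M
    U := U
    cover := fun x => ⟨x, hU x⟩
    chart := fun x => (φ x).some.symm.trans (r.gradedQuasiIso DB D (φ x).some)
    transition := fun x y T hx hy =>
      ((r.modCompat_gradedQuasiIso DB D (φ y).some).restrict hy).transition
        ((r.modCompat_gradedQuasiIso DB D (φ x).some).restrict hx) }⟩

end Atlas

end Torsors

/-! ### Descent: the sheaf and the pair glued from copies of the split model by a cocycle. -/

section Descent

variable {M : Type u} [TopologicalSpace M]

/-- The pairs of an index and of an open subset of `V` contained in the corresponding member of a
family of open sets. -/
abbrev LocalIndex {ι : Type u} (U : ι → Opens M) (V : Opens M) : Type u :=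
  {p : ι × Opens M // p.2 ≤ V ∧ p.2 ≤ U p.1}

namespace Cocycle

section Alg

variable {B : SuperAlg M} {q : ℕ} (c : Cocycle (autSheaf B q))

/-- The transition automorphism of a cocycle on sections over `V`. -/
def tr (i j : c.ι) (V : Opens M) (hi : V ≤ c.U i) (hj : V ≤ c.U j) : B.sec V ≃ₐ[ℂ] B.sec V :=
  (c.z.ev i j (homOfLE hi) (homOfLE hj)).1.toEquiv V le_rfl

lemma res_tr {i j : c.ι} {V W : Opens M} (h : W ≤ V) (hi : V ≤ c.U i) (hj : V ≤ c.U j)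
    (f : B.sec V) :
    B.res h (c.tr i j V hi hj f) = c.tr i j W (h.trans hi) (h.trans hj) (B.res h f) := by
  refine ((c.z.ev i j (homOfLE hi) (homOfLE hj)).1.map_res h le_rfl f).trans ?_
  exact congrArg (fun a : autFilt B q W => a.1.toEquiv W le_rfl (B.res h f))
    (c.z.ev_precomp i j (homOfLE h) (homOfLE hi) (homOfLE hj))

lemma σ_tr {i j : c.ι} {V : Opens M} (hi : V ≤ c.U i) (hj : V ≤ c.U j) (f : B.sec V) :
    B.σ V (c.tr i j V hi hj f) = c.tr i j V hi hj (B.σ V f) :=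
  (c.z.ev i j (homOfLE hi) (homOfLE hj)).1.map_σ V le_rfl f

lemma tr_tr {i j k : c.ι} {V : Opens M} (hi : V ≤ c.U i) (hj : V ≤ c.U j) (hk : V ≤ c.U k)
    (f : B.sec V) : c.tr i j V hi hj (c.tr j k V hj hk f) = c.tr i k V hi hk f :=
  congrArg (fun a : autFilt B q V => a.1.toEquiv V le_rfl f)
    (c.z.ev_trans i j k (homOfLE hi) (homOfLE hj) (homOfLE hk))

lemma tr_self {i : c.ι} {V : Opens M} (hi : V ≤ c.U i) (f : B.sec V) : c.tr i i V hi hi f = f :=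
  congrArg (fun a : autFilt B q V => a.1.toEquiv V le_rfl f)
    (PresheafOfGroups.OneCocycle.ev_refl _ _ c.z i (homOfLE hi))

/-- The sections over `V` of the sheaf of superalgebras glued from copies of `B` by a cocycle. -/
def glueSec (V : Opens M) : Subalgebra ℂ (∀ k : LocalIndex c.U V, B.sec k.1.2) where
  -- The entry at `(i, W)` is the section over `W` as seen in the chart `i`; this one condition
  -- encodes both restriction and change of chart.
  carrier := {s | ∀ (k l : LocalIndex c.U V) (h : l.1.2 ≤ k.1.2),
    c.tr l.1.1 k.1.1 l.1.2 l.2.2 (h.trans k.2.2) (B.res h (s k)) = s l}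
  mul_mem' {s t} hs ht k l h := by
    rw [Pi.mul_apply, Pi.mul_apply, map_mul, map_mul, hs k l h, ht k l h]
  add_mem' {s t} hs ht k l h := by
    rw [Pi.add_apply, Pi.add_apply, map_add, map_add, hs k l h, ht k l h]
  algebraMap_mem' a k l h := by
    rw [Pi.algebraMap_apply, Pi.algebraMap_apply, AlgHom.commutes, AlgEquiv.commutes]

/-- The sheaf of superalgebras glued from copies of `B` by a cocycle. -/
def glueAlg : SuperAlg M where
  sec V := c.glueSec V
  res {V W} h :=
    { toFun := fun s => ⟨fun k => s.1 ⟨k.1, k.2.1.trans h, k.2.2⟩, fun k l h' =>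
        s.2 ⟨k.1, k.2.1.trans h, k.2.2⟩ ⟨l.1, l.2.1.trans h, l.2.2⟩ h'⟩
      map_one' := rfl
      map_mul' := fun _ _ => rfl
      map_zero' := rfl
      map_add' := fun _ _ => rfl
      commutes' := fun _ => rfl }
  res_self _ _ := rfl
  res_res _ _ _ := rfl
  σ V :=
    { toFun := fun s => ⟨fun k => B.σ _ (s.1 k), fun k l h => by
        rw [B.res_σ, ← c.σ_tr, s.2 k l h]⟩
      map_one' := Subtype.ext (funext fun k => map_one (B.σ _))
      map_mul' := fun s t => Subtype.ext (funext fun k => map_mul (B.σ _) (s.1 k) (t.1 k))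
      map_zero' := Subtype.ext (funext fun k => map_zero (B.σ _))
      map_add' := fun s t => Subtype.ext (funext fun k => map_add (B.σ _) (s.1 k) (t.1 k))
      commutes' := fun a => Subtype.ext (funext fun k => (B.σ _).commutes a) }
  σ_σ V s := Subtype.ext (funext fun k => B.σ_σ _ (s.1 k))
  res_σ _ _ := rfl

/-- The isomorphism of the glued sheaf with `B` over a member of the covering. -/
def glueChart (i : c.ι) : AlgIso (c.U i) c.glueAlg B where
  toEquiv V hV :=
    { toFun := fun s => s.1 ⟨(i, V), le_rfl, hV⟩
      -- A section seen in the chart `i` determines all other entries by restriction and transition;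
      -- the cocycle identity makes the resulting family compatible.
      invFun := fun f => ⟨fun k => c.tr k.1.1 i k.1.2 k.2.2 (k.2.1.trans hV) (B.res k.2.1 f),
        fun k l h => by rw [c.res_tr, c.tr_tr, B.res_res]⟩
      left_inv := fun s => Subtype.ext (funext fun k => s.2 ⟨(i, V), le_rfl, hV⟩ k k.2.1)
      right_inv := fun f => (c.tr_self hV _).trans (B.res_self V f)
      map_mul' := fun _ _ => rfl
      map_add' := fun _ _ => rfl
      commutes' := fun _ => rfl }
  map_res {V W} h hV s := by
    have := s.2 ⟨(i, V), le_rfl, hV⟩ ⟨(i, W), h, h.trans hV⟩ h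
    rw [c.tr_self] at this
    exact this
  map_σ _ _ _ := rfl

/-- On open sets inside a member of the covering the glued presheaf is isomorphic to the sheaf `B`.
Elsewhere its sections are compatible families over such sets, so the basis criterion applies. -/
lemma glueAlg_isSheaf (hB : B.IsSheaf) : c.glueAlg.IsSheaf := by
  refine SuperAlg.isSheaf_iff.2 (TypePresheaf.isSheaf_of_basis (fun W => ∃ i, W ≤ c.U i)
    (fun V W h ⟨i, hi⟩ => ⟨i, h.trans hi⟩) ?_ ?_ ?_)
  · rintro V ⟨i, hi⟩
    exact TypePresheaf.GluesOn.of_equiv (Q := B.toTypePresheaf)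
      (fun W h => ((c.glueChart i).toEquiv W (h.trans hi)).toEquiv)
      (fun W W' h k f => (c.glueChart i).map_res h (k.trans hi) f)
      ((SuperAlg.isSheaf_iff.1 hB).gluesOn V)
  · intro V f g h
    refine Subtype.ext (funext fun k => ?_)
    have := h k.1.2 k.2.1 ⟨k.1.1, k.2.2⟩
    exact congrFun (congrArg Subtype.val this) ⟨k.1, le_rfl, k.2.2⟩
  · intro V s hs
    refine ⟨⟨fun k => (s k.1.2 k.2.1 ⟨k.1.1, k.2.2⟩).1 ⟨k.1, le_rfl, k.2.2⟩, fun k l h => ?_⟩, ?_⟩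
    · exact ((s k.1.2 k.2.1 ⟨k.1.1, k.2.2⟩).2 ⟨k.1, le_rfl, k.2.2⟩ ⟨l.1, h, l.2.2⟩ h).trans
        (congrArg (fun t : c.glueSec l.1.2 => t.1 ⟨l.1, le_rfl, l.2.2⟩)
          (hs k.1.2 l.1.2 k.2.1 ⟨k.1.1, k.2.2⟩ h))
    · intro W h b
      refine Subtype.ext (funext fun k => ?_)
      change (s k.1.2 _ _).1 _ = _
      rw [← hs W k.1.2 h b k.2.1]
      rfl

end Alg

/-- The atlas of the sheaf glued by a cocycle. -/
def glueAtlas {B : SuperAlg M} (c : Cocycle (autSheaf B 2)) : AlgAtlas c.glueAlg B where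
  ι := c.ι
  U := c.U
  cover := c.cover
  chart := c.glueChart
  transition i j T hi hj := by
    convert (c.z.ev i j (homOfLE hi) (homOfLE hj)).2
    refine AlgIso.ext' fun V k f => ?_
    change c.tr i j V _ _ (B.res le_rfl f) = _
    rw [B.res_self]
    exact congrArg (fun a : autFilt B 2 V => a.1.toEquiv V le_rfl f)
      (c.z.ev_precomp i j (homOfLE k) (homOfLE hi) (homOfLE hj)).symm

/-- Reading the family built from a section in chart `j` at the index `i` applies the transition
from `j` to `i`. The given cocycle is therefore recovered on the nose, not only up to coboundary,
which yields surjectivity. -/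
lemma cocycle_glueAtlas {B : SuperAlg M} (c : Cocycle (autSheaf B 2)) :
    c.glueAtlas.cocycle = c := by
  refine Cocycle.mk_congr fun i j T a b => Subtype.ext ?_
  refine AlgIso.ext' fun V k f => ?_
  change c.tr i j V _ _ (B.res le_rfl f) = _
  rw [B.res_self]
  exact congrArg (fun a : autFilt B 2 V => a.1.toEquiv V le_rfl f)
    (c.z.ev_precomp i j (homOfLE k) a b).symm

section Mod

variable {Y : SuperPair M} {p q : ℕ} (c : Cocycle (qautSheaf Y p q))

/-- The transition automorphism of a cocycle on sections of the module over `V`. -/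
def trMod (i j : c.ι) (V : Opens M) (hi : V ≤ c.U i) (hj : V ≤ c.U j) :
    Y.mod.sec V ≃+ Y.mod.sec V :=
  (c.z.ev i j (homOfLE hi) (homOfLE hj)).1.toModEquiv V le_rfl

lemma res_trMod {i j : c.ι} {V W : Opens M} (h : W ≤ V) (hi : V ≤ c.U i) (hj : V ≤ c.U j)
    (f : Y.mod.sec V) :
    Y.mod.res h (c.trMod i j V hi hj f) =
      c.trMod i j W (h.trans hi) (h.trans hj) (Y.mod.res h f) := by
  refine ((c.z.ev i j (homOfLE hi) (homOfLE hj)).1.mod_res h le_rfl f).trans ?_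
  exact congrArg (fun a : qautFilt Y p q W => a.1.toModEquiv W le_rfl (Y.mod.res h f))
    (c.z.ev_precomp i j (homOfLE h) (homOfLE hi) (homOfLE hj))

lemma σ_trMod {i j : c.ι} {V : Opens M} (hi : V ≤ c.U i) (hj : V ≤ c.U j) (f : Y.mod.sec V) :
    Y.mod.σ V (c.trMod i j V hi hj f) = c.trMod i j V hi hj (Y.mod.σ V f) :=
  (c.z.ev i j (homOfLE hi) (homOfLE hj)).1.mod_σ V le_rfl f

/-- The module transitions are semilinear over the image cocycle under `Φ_Ψ ↦ Ψ`. This is why the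
glued module lives over the algebra glued by that image. -/
lemma trMod_smul {i j : c.ι} {V : Opens M} (hi : V ≤ c.U i) (hj : V ≤ c.U j) (f : Y.alg.sec V)
    (v : Y.mod.sec V) : c.trMod i j V hi hj (f • v) =
      (c.map (baseMap Y p q)).tr i j V hi hj f • c.trMod i j V hi hj v :=
  (c.z.ev i j (homOfLE hi) (homOfLE hj)).1.mod_smul V le_rfl f v

lemma trMod_trMod {i j k : c.ι} {V : Opens M} (hi : V ≤ c.U i) (hj : V ≤ c.U j) (hk : V ≤ c.U k)
    (f : Y.mod.sec V) :
    c.trMod i j V hi hj (c.trMod j k V hj hk f) = c.trMod i k V hi hk f :=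
  congrArg (fun a : qautFilt Y p q V => a.1.toModEquiv V le_rfl f)
    (c.z.ev_trans i j k (homOfLE hi) (homOfLE hj) (homOfLE hk))

lemma trMod_self {i : c.ι} {V : Opens M} (hi : V ≤ c.U i) (f : Y.mod.sec V) :
    c.trMod i i V hi hi f = f :=
  congrArg (fun a : qautFilt Y p q V => a.1.toModEquiv V le_rfl f)
    (PresheafOfGroups.OneCocycle.ev_refl _ _ c.z i (homOfLE hi))

/-- The sections over `V` of the sheaf of modules glued by a cocycle. -/
def glueModSec (V : Opens M) : AddSubgroup (∀ k : LocalIndex c.U V, Y.mod.sec k.1.2) where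
  carrier := {s | ∀ (k l : LocalIndex c.U V) (h : l.1.2 ≤ k.1.2),
    c.trMod l.1.1 k.1.1 l.1.2 l.2.2 (h.trans k.2.2) (Y.mod.res h (s k)) = s l}
  add_mem' {s t} hs ht k l h := by
    rw [Pi.add_apply, Pi.add_apply, map_add, map_add, hs k l h, ht k l h]
  zero_mem' k l h := by
    rw [Pi.zero_apply, Pi.zero_apply, map_zero, map_zero]
  neg_mem' {s} hs k l h := by
    rw [Pi.neg_apply, Pi.neg_apply, map_neg, map_neg, hs k l h]

instance (V : Opens M) : Module ((c.map (baseMap Y p q)).glueSec V) (c.glueModSec V) where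
  smul a s := ⟨fun k => a.1 k • s.1 k, fun k l h => by
    rw [Y.mod.res_smul, c.trMod_smul, s.2 k l h]
    exact congrArg (· • s.1 l) (a.2 k l h)⟩
  one_smul s := Subtype.ext (funext fun k => one_smul _ (s.1 k))
  mul_smul a b s := Subtype.ext (funext fun k => mul_smul (a.1 k) (b.1 k) (s.1 k))
  smul_zero a := Subtype.ext (funext fun k => smul_zero (a.1 k))
  smul_add a s t := Subtype.ext (funext fun k => smul_add (a.1 k) (s.1 k) (t.1 k))
  add_smul a b s := Subtype.ext (funext fun k => add_smul (a.1 k) (b.1 k) (s.1 k))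
  zero_smul s := Subtype.ext (funext fun k => zero_smul _ (s.1 k))

/-- The sheaf of modules glued by a cocycle. -/
def glueMod : SuperMod (c.map (baseMap Y p q)).glueAlg where
  sec V := c.glueModSec V
  module V := inferInstanceAs (Module ((c.map (baseMap Y p q)).glueSec V) (c.glueModSec V))
  res {V W} h :=
    { toFun := fun s => ⟨fun k => s.1 ⟨k.1, k.2.1.trans h, k.2.2⟩, fun k l h' =>
        s.2 ⟨k.1, k.2.1.trans h, k.2.2⟩ ⟨l.1, l.2.1.trans h, l.2.2⟩ h'⟩
      map_zero' := rfl
      map_add' := fun _ _ => rfl }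
  res_self _ _ := rfl
  res_res _ _ _ := rfl
  res_smul _ _ _ := rfl
  σ V :=
    { toFun := fun s => ⟨fun k => Y.mod.σ _ (s.1 k), fun k l h => by
        rw [Y.mod.res_σ, ← c.σ_trMod, s.2 k l h]⟩
      map_zero' := Subtype.ext (funext fun k => map_zero (Y.mod.σ _))
      map_add' := fun s t => Subtype.ext (funext fun k => map_add (Y.mod.σ _) (s.1 k) (t.1 k)) }
  σ_σ V s := Subtype.ext (funext fun k => Y.mod.σ_σ _ (s.1 k))
  σ_smul V a s := Subtype.ext (funext fun k => Y.mod.σ_smul _ (a.1 k) (s.1 k))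
  res_σ _ _ := rfl

/-- The pair glued from copies of `Y` by a cocycle. -/
def gluePair : SuperPair M := ⟨(c.map (baseMap Y p q)).glueAlg, c.glueMod⟩

/-- The quasi-isomorphism of the glued pair with `Y` over a member of the covering. -/
def glueModChart (i : c.ι) : QuasiIso (c.U i) c.gluePair Y where
  toAlgIso := (c.map (baseMap Y p q)).glueChart i
  toModEquiv V hV :=
    { toFun := fun s => s.1 ⟨(i, V), le_rfl, hV⟩
      invFun := fun f => ⟨fun k => c.trMod k.1.1 i k.1.2 k.2.2 (k.2.1.trans hV) (Y.mod.res k.2.1 f),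
        fun k l h => by rw [c.res_trMod, c.trMod_trMod, Y.mod.res_res]⟩
      left_inv := fun s => Subtype.ext (funext fun k => s.2 ⟨(i, V), le_rfl, hV⟩ k k.2.1)
      right_inv := fun f => (c.trMod_self hV _).trans (Y.mod.res_self V f)
      map_add' := fun _ _ => rfl }
  mod_res {V W} h hV s := by
    have := s.2 ⟨(i, V), le_rfl, hV⟩ ⟨(i, W), h, h.trans hV⟩ h
    rw [c.trMod_self] at this
    exact this
  mod_σ _ _ _ := rfl
  mod_smul _ _ _ _ := rfl

/-- The charts identify the glued module with the sheaf of `Y` over subsets of the covering sets,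
and these form a basis in the sense of the criterion. -/
lemma glueMod_isSheaf (hY : Y.mod.IsSheaf) : c.glueMod.IsSheaf := by
  refine SuperMod.isSheaf_iff.2 (TypePresheaf.isSheaf_of_basis (fun W => ∃ i, W ≤ c.U i)
    (fun V W h ⟨i, hi⟩ => ⟨i, h.trans hi⟩) ?_ ?_ ?_)
  · rintro V ⟨i, hi⟩
    exact TypePresheaf.GluesOn.of_equiv (Q := Y.mod.toTypePresheaf)
      (fun W h => ((c.glueModChart i).toModEquiv W (h.trans hi)).toEquiv)
      (fun W W' h k f => (c.glueModChart i).mod_res h (k.trans hi) f)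
      ((SuperMod.isSheaf_iff.1 hY).gluesOn V)
  · intro V f g h
    refine Subtype.ext (funext fun k => ?_)
    have := h k.1.2 k.2.1 ⟨k.1.1, k.2.2⟩
    exact congrFun (congrArg Subtype.val this) ⟨k.1, le_rfl, k.2.2⟩
  · intro V s hs
    refine ⟨⟨fun k => (s k.1.2 k.2.1 ⟨k.1.1, k.2.2⟩).1 ⟨k.1, le_rfl, k.2.2⟩, fun k l h => ?_⟩, ?_⟩
    · exact ((s k.1.2 k.2.1 ⟨k.1.1, k.2.2⟩).2 ⟨k.1, le_rfl, k.2.2⟩ ⟨l.1, h, l.2.2⟩ h).trans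
        (congrArg (fun t : c.glueModSec l.1.2 => t.1 ⟨l.1, le_rfl, l.2.2⟩)
          (hs k.1.2 l.1.2 k.2.1 ⟨k.1.1, k.2.2⟩ h))
    · intro W h b
      refine Subtype.ext (funext fun k => ?_)
      change (s k.1.2 _ _).1 _ = _
      rw [← hs W k.1.2 h b k.2.1]
      rfl

end Mod

lemma glueModChart_transition {Y : SuperPair M} {p q : ℕ} (c : Cocycle (qautSheaf Y p q))
    (i j : c.ι) (T : Opens M) (a : T ⟶ c.U i) (b : T ⟶ c.U j) :
    ((c.glueModChart j).restrict (leOfHom b)).symm.trans ((c.glueModChart i).restrict (leOfHom a)) =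
      (c.z.ev i j a b).1 := by
  refine QuasiIso.ext' (fun V k f => ?_) fun V k f => ?_
  · change (c.map (baseMap Y p q)).tr i j V _ _ (Y.alg.res le_rfl f) = _
    rw [Y.alg.res_self]
    exact congrArg (fun a : qautFilt Y p q V => a.1.toEquiv V le_rfl f)
      (c.z.ev_precomp i j (homOfLE k) a b).symm
  · change c.trMod i j V _ _ (Y.mod.res le_rfl f) = _
    rw [Y.mod.res_self]
    exact congrArg (fun a : qautFilt Y p q V => a.1.toModEquiv V le_rfl f)
      (c.z.ev_precomp i j (homOfLE k) a b).symm

/-- The atlas of the pair glued by a cocycle. -/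
def glueModAtlas {Y : SuperPair M} (c : Cocycle (qautSheaf Y 1 2)) : Atlas c.gluePair Y where
  ι := c.ι
  U := c.U
  cover := c.cover
  chart := c.glueModChart
  transition i j T hi hj := by
    rw [c.glueModChart_transition i j T (homOfLE hi) (homOfLE hj)]
    exact (c.z.ev i j (homOfLE hi) (homOfLE hj)).2

lemma cocycle_glueModAtlas {Y : SuperPair M} (c : Cocycle (qautSheaf Y 1 2)) :
    c.glueModAtlas.cocycle = c :=
  Cocycle.mk_congr fun i j T a b => Subtype.ext (c.glueModChart_transition i j T a b)

end Cocycle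

end Descent

/-! ### Sheaf condition for holomorphic functions and for the free local models. -/

section Model

variable {n : ℕ} {M : Type u} [TopologicalSpace M] [ChartedSpace (EuclideanSpace ℂ (Fin n)) M]

variable (n M) in
/-- The sheaf of holomorphic functions, as a presheaf of types. -/
noncomputable def holPresheaf : TypePresheaf M where
  sec U := Hol n U
  res h f := Hol.res h f
  res_self _ _ := rfl
  res_res _ _ _ := rfl

/-- Functions are glued pointwise, and analyticity is a local property. -/
lemma holPresheaf_gluesOn (V : Opens M) : (holPresheaf n M).GluesOn V := by
  intro ι U hU
  refine ⟨fun f g hfg => ?_, fun s hs hs' => ?_⟩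
  · refine ContMDiffMap.ext fun x => ?_
    obtain ⟨i, hi⟩ := hU x x.2
    exact DFunLike.congr_fun
      (F := C^ω⟮𝓘(ℂ, EuclideanSpace ℂ (Fin n)), (V ⊓ U i : Opens M); 𝓘(ℂ), ℂ⟯)
      (hfg i (V ⊓ U i) inf_le_left inf_le_right) ⟨x, x.2, hi⟩
  · choose i hi using hU
    let S : ∀ i (T : Opens M), T ≤ V → T ≤ U i →
      C^ω⟮𝓘(ℂ, EuclideanSpace ℂ (Fin n)), T; 𝓘(ℂ), ℂ⟯ := s
    -- The value at `x` does not depend on the index or on the neighbourhood: both are compared on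
    -- `T ⊓ T'`.
    have hval : ∀ i j (T T' : Opens M) (h : T ≤ V) (h' : T' ≤ V) (k : T ≤ U i) (k' : T' ≤ U j)
        (x : M) (hx : x ∈ T) (hx' : x ∈ T'), S i T h k ⟨x, hx⟩ = S j T' h' k' ⟨x, hx'⟩ := by
      intro i j T T' h h' k k' x hx hx'
      have h1 := DFunLike.congr_fun
        (F := C^ω⟮𝓘(ℂ, EuclideanSpace ℂ (Fin n)), (T ⊓ T' : Opens M); 𝓘(ℂ), ℂ⟯)
        (hs i T (T ⊓ T') h k inf_le_left) ⟨x, hx, hx'⟩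
      have h2 := DFunLike.congr_fun
        (F := C^ω⟮𝓘(ℂ, EuclideanSpace ℂ (Fin n)), (T ⊓ T' : Opens M); 𝓘(ℂ), ℂ⟯)
        (hs j T' (T ⊓ T') h' k' inf_le_right) ⟨x, hx, hx'⟩
      have h3 := DFunLike.congr_fun
        (F := C^ω⟮𝓘(ℂ, EuclideanSpace ℂ (Fin n)), (T ⊓ T' : Opens M); 𝓘(ℂ), ℂ⟯)
        (hs' i j (T ⊓ T') (inf_le_left.trans h) (inf_le_left.trans k) (inf_le_right.trans k'))
        ⟨x, hx, hx'⟩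
      exact h1.trans (h3.trans h2.symm)
    classical
    let F : M → ℂ := fun x => if hx : x ∈ V then
      S (i x hx) (V ⊓ U (i x hx)) inf_le_left inf_le_right ⟨x, hx, hi x hx⟩ else 0
    have hF : ∀ j T (h : T ≤ V) (k : T ≤ U j) (x : T), F x = S j T h k x := by
      intro j T h k x
      simp only [F, dif_pos (h x.2)]
      exact hval _ _ _ _ _ _ _ _ _ _ _
    have hsm : ContMDiff 𝓘(ℂ, EuclideanSpace ℂ (Fin n)) 𝓘(ℂ) ω (fun x : V => F x) := by
      intro x
      refine contMDiffAt_subtype_iff.2 ?_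
      have := (S (i x x.2) (V ⊓ U (i x x.2)) inf_le_left inf_le_right).contMDiff
        ⟨x.1, x.2, hi x x.2⟩
      refine (contMDiffAt_subtype_iff (U := V ⊓ U (i x x.2)) (x := ⟨x.1, x.2, hi x x.2⟩)).1 ?_
      convert this using 1
      exact funext fun y => hF _ _ _ _ y
    refine ⟨(⟨fun x : V => F x, hsm⟩ : C^ω⟮𝓘(ℂ, EuclideanSpace ℂ (Fin n)), V; 𝓘(ℂ), ℂ⟯),
      fun j T h k => ?_⟩
    exact ContMDiffMap.ext fun x => hF j T h k x

/-- Products of the `ξ` form a finite basis with constant coefficients, so restriction acts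
coefficientwise and the presheaf is a product of copies of `ℱ`, indexed by the subsets of `Fin m`.
-/
lemma modelAlg_isSheaf (m : ℕ) : (modelAlg n M m).IsSheaf := by
  refine SuperAlg.isSheaf_iff.2 (TypePresheaf.isSheaf_of_gluesOn fun V => ?_)
  let b := (Pi.basisFun ℂ (Fin m)).ExteriorAlgebra
  have hb : ∀ (W : Opens M) (a : Hol n W) (w : ExteriorAlgebra ℂ (Fin m → ℂ)) (j : Finset (Fin m)),
      (Algebra.TensorProduct.basis (Hol n W) b).equivFun (a ⊗ₜ w) j =
        a * algebraMap ℂ (Hol n W) (b.repr w j) := fun W a w j => by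
    rw [Module.Basis.equivFun_apply, Algebra.TensorProduct.basis_repr_tmul]
    rfl
  refine TypePresheaf.GluesOn.pi (P := (modelAlg n M m).toTypePresheaf) (V := V)
    (J := Finset (Fin m)) (fun _ => holPresheaf n M)
    (fun W => (Algebra.TensorProduct.basis (Hol n W) b).equivFun.toEquiv) ?_
    (fun _ => holPresheaf_gluesOn V)
  intro W W' h f j
  change (Algebra.TensorProduct.basis (Hol n W') b).equivFun
    (Algebra.TensorProduct.map (Hol.res h) (AlgHom.id ℂ _) f) j =
    Hol.res h ((Algebra.TensorProduct.basis (Hol n W) b).equivFun f j)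
  change Hol n W ⊗[ℂ] ExteriorAlgebra ℂ (Fin m → ℂ) at f
  induction f using TensorProduct.induction_on with
  | zero => simp only [map_zero, Pi.zero_apply]
  | tmul a w =>
    rw [Algebra.TensorProduct.map_tmul, hb, hb, map_mul, AlgHom.commutes]
    rfl
  | add f g hf hg =>
    rw [map_add, map_add, Pi.add_apply, hf, hg, map_add, Pi.add_apply, map_add]

omit [ChartedSpace (EuclideanSpace ℂ (Fin n)) M] in
lemma freeMod_isSheaf {A : SuperAlg M} (hA : A.IsSheaf) (p q : ℕ) : (freeMod A p q).IsSheaf := by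
  refine SuperMod.isSheaf_iff.2 (TypePresheaf.isSheaf_of_gluesOn fun V => ?_)
  refine TypePresheaf.GluesOn.pi (P := (freeMod A p q).toTypePresheaf) (J := Fin p ⊕ Fin q)
    (fun _ => A.toTypePresheaf)
    (fun W => (Equiv.sumArrowEquivProdArrow (Fin p) (Fin q) (A.sec W)).symm) ?_
    (fun _ => (SuperAlg.isSheaf_iff.1 hA).gluesOn V)
  rintro W W' h f (j | j) <;> rfl

end Model

/-! ### The split structure sheaf `⋀ G` in local coordinates. -/

namespace HolMod

variable {n : ℕ} {M : Type u} [TopologicalSpace M] [ChartedSpace (EuclideanSpace ℂ (Fin n)) M]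
  {G S₀ S₁ : HolMod n M}

lemma IsFreeOn.mono {r : ℕ} {U V : Opens M} (h : G.IsFreeOn r U) (k : V ≤ U) : G.IsFreeOn r V := by
  obtain ⟨e, he⟩ := h
  exact ⟨fun W l => e W (l.trans k), fun W W' h l => he W W' h (l.trans k)⟩

lemma IsTriv.mono {U V : Opens M} (h : G.IsTriv U) (k : V ≤ U) : G.IsTriv V :=
  h.imp fun _ h => h.mono k

lemma extRes_self (U : Opens M) (a : G.Ext U) : extRes (le_refl U) a = a := by
  induction a using ExteriorAlgebra.induction with
  | algebraMap r => rw [extRes_algebraMap]; rfl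
  | ι v => rw [extRes_ι, G.res_self]
  | mul a b ha hb => rw [map_mul, ha, hb]
  | add a b ha hb => rw [map_add, ha, hb]

lemma extRes_extRes {U V W : Opens M} (h : U ≤ V) (k : V ≤ W) (a : G.Ext W) :
    extRes h (extRes k a) = extRes (h.trans k) a := by
  induction a using ExteriorAlgebra.induction with
  | algebraMap r => rw [extRes_algebraMap, extRes_algebraMap, extRes_algebraMap]; rfl
  | ι v => rw [extRes_ι, extRes_ι, extRes_ι, G.res_res]
  | mul a b ha hb => rw [map_mul, map_mul, ha, hb, map_mul]
  | add a b ha hb => rw [map_add, map_add, ha, hb, map_add]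

lemma tensRes_self (U : Opens M) (t : G.Tens S₀ S₁ U) : tensRes (le_refl U) t = t := by
  induction t using TensorProduct.induction_on with
  | zero => rw [map_zero]
  | tmul a s => rw [tensRes_tmul, extRes_self, S₀.res_self, S₁.res_self]
  | add x y hx hy => rw [map_add, hx, hy]

lemma tensRes_tensRes {U V W : Opens M} (h : U ≤ V) (k : V ≤ W) (t : G.Tens S₀ S₁ W) :
    tensRes h (tensRes k t) = tensRes (h.trans k) t := by
  induction t using TensorProduct.induction_on with
  | zero => rw [map_zero, map_zero, map_zero]
  | tmul a s => rw [tensRes_tmul, tensRes_tmul, tensRes_tmul, extRes_extRes, S₀.res_res, S₁.res_res]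
  | add x y hx hy => rw [map_add, map_add, hx, hy, map_add]

/-- Over an open set on which `G` is free, a section of `⋀ G` is an element of the exterior
algebra. -/
noncomputable def extSec (V : Opens M) (hV : G.IsTriv V) : G.Ext V ≃ₐ[ℂ] G.splitSec V where
  toFun a := ⟨fun W => extRes W.2.1 a, fun W W' h => extRes_extRes _ _ a⟩
  invFun s := s.1 ⟨V, le_rfl, hV⟩
  left_inv a := extRes_self V a
  right_inv s := Subtype.ext (funext fun W => s.2 ⟨V, le_rfl, hV⟩ W W.2.1)
  map_mul' a b := Subtype.ext (funext fun W => map_mul (extRes W.2.1) a b)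
  map_add' a b := Subtype.ext (funext fun W => map_add (extRes W.2.1) a b)
  commutes' c := Subtype.ext (funext fun W => (extRes W.2.1).commutes c)

section Coordinates

variable {r : ℕ} {V : Opens M} (e : G.sec V ≃ₗ[Hol n V] (Fin r → Hol n V))

/-- The map `v ↦ ∑ᵢ vᵢ ⊗ ξᵢ`. -/
noncomputable def coordLin :
    G.sec V →ₗ[Hol n V] Hol n V ⊗[ℂ] ExteriorAlgebra ℂ (Fin r → ℂ) where
  toFun v := ∑ i, e v i ⊗ₜ ExteriorAlgebra.ι ℂ (Pi.single i 1)
  map_add' v w := by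
    simp only [map_add, Pi.add_apply, TensorProduct.add_tmul, Finset.sum_add_distrib]
  map_smul' f v := by
    simp only [map_smul, Pi.smul_apply, Finset.smul_sum, TensorProduct.smul_tmul', RingHom.id_apply]

lemma coordLin_apply (v : G.sec V) :
    coordLin e v = ∑ i, e v i ⊗ₜ ExteriorAlgebra.ι ℂ (Pi.single i 1) := rfl

/-- Exchanging the two summation indices turns the double sum into its negative, because the
functions commute and the `ξ` anticommute. This is the condition for extending the map to `⋀ G`. -/
lemma coordLin_sq (v : G.sec V) : coordLin e v * coordLin e v = 0 := by
  refine eq_zero_of_eq_neg ?_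
  rw [coordLin_apply, Finset.sum_mul_sum]
  nth_rewrite 2 [Finset.sum_comm]
  rw [← Finset.sum_neg_distrib]
  refine Finset.sum_congr rfl fun i _ => ?_
  rw [← Finset.sum_neg_distrib]
  refine Finset.sum_congr rfl fun j _ => ?_
  rw [Algebra.TensorProduct.tmul_mul_tmul, Algebra.TensorProduct.tmul_mul_tmul, mul_comm (e v j),
    ← TensorProduct.tmul_neg]
  congr 1
  exact eq_neg_of_add_eq_zero_left (ExteriorAlgebra.ι_add_mul_swap _ _)

/-- The section `∑ᵢ wᵢ eᵢ` of `G`, in `⋀ G`, where the `eᵢ` form the basis defined by `e`. -/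
noncomputable def coordSec : (Fin r → ℂ) →ₗ[ℂ] G.Ext V where
  toFun w := ExteriorAlgebra.ι (Hol n V) (e.symm fun i => algebraMap ℂ (Hol n V) (w i))
  map_add' w w' := by
    rw [← map_add, ← map_add]
    exact congrArg (fun f => ExteriorAlgebra.ι (Hol n V) (e.symm f)) (funext fun i => map_add _ _ _)
  map_smul' c w := by
    rw [RingHom.id_apply, ← algebraMap_smul (Hol n V) c (ExteriorAlgebra.ι (Hol n V) _), ← map_smul,
      ← map_smul]
    exact congrArg (fun f => ExteriorAlgebra.ι (Hol n V) (e.symm f)) (funext fun i => map_mul _ _ _)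

lemma coordSec_apply (w : Fin r → ℂ) : coordSec e w =
    ExteriorAlgebra.ι (Hol n V) (e.symm fun i => algebraMap ℂ (Hol n V) (w i)) := rfl

lemma coordSec_sq (w : Fin r → ℂ) : coordSec e w * coordSec e w = 0 :=
  ExteriorAlgebra.ι_sq_zero _

lemma commute_lift_coordSec (f : Hol n V) (w : ExteriorAlgebra ℂ (Fin r → ℂ)) :
    Commute (Algebra.ofId (Hol n V) (G.Ext V) f)
      (ExteriorAlgebra.lift ℂ ⟨coordSec e, coordSec_sq e⟩ w) :=
  Algebra.commutes f _

/-- The inverse of `coordEquiv`. -/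
noncomputable def coordInv : Hol n V ⊗[ℂ] ExteriorAlgebra ℂ (Fin r → ℂ) →ₐ[Hol n V] G.Ext V :=
  Algebra.TensorProduct.lift (Algebra.ofId (Hol n V) (G.Ext V))
    (ExteriorAlgebra.lift ℂ ⟨coordSec e, coordSec_sq e⟩)
    (commute_lift_coordSec e)

lemma coordInv_tmul (f : Hol n V) (w : Fin r → ℂ) :
    coordInv e (f ⊗ₜ ExteriorAlgebra.ι ℂ w) = f • coordSec e w := by
  refine (Algebra.TensorProduct.lift_tmul _ _ (commute_lift_coordSec e) f _).trans ?_
  rw [ExteriorAlgebra.lift_ι_apply, Algebra.smul_def]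
  rfl

/-- The isomorphism `⋀ G(V) → ℱ(V) ⊗ ⋀(ξ₁, …, ξᵣ)` defined by a trivialization of `G`. -/
noncomputable def coordEquiv :
    G.Ext V ≃ₐ[Hol n V] Hol n V ⊗[ℂ] ExteriorAlgebra ℂ (Fin r → ℂ) :=
  AlgEquiv.ofAlgHom (ExteriorAlgebra.lift (Hol n V) ⟨coordLin e, coordLin_sq e⟩)
    (coordInv e)
    (by
      refine Algebra.TensorProduct.ext (Subsingleton.elim _ _) (ExteriorAlgebra.hom_ext ?_)
      refine LinearMap.ext fun w => ?_
      change ExteriorAlgebra.lift (Hol n V) ⟨coordLin e, coordLin_sq e⟩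
        (coordInv e (1 ⊗ₜ ExteriorAlgebra.ι ℂ w)) = 1 ⊗ₜ[ℂ] ExteriorAlgebra.ι ℂ w
      rw [coordInv_tmul, one_smul, coordSec_apply, ExteriorAlgebra.lift_ι_apply,
        coordLin_apply, LinearEquiv.apply_symm_apply]
      conv_rhs => rw [pi_eq_sum_univ' w, map_sum, TensorProduct.tmul_sum]
      refine Finset.sum_congr rfl fun i _ => ?_
      rw [map_smul, TensorProduct.tmul_smul, TensorProduct.smul_tmul',
        Algebra.algebraMap_eq_smul_one])
    (by
      refine ExteriorAlgebra.hom_ext (LinearMap.ext fun v => ?_)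
      change coordInv e (ExteriorAlgebra.lift (Hol n V)
        ⟨coordLin e, coordLin_sq e⟩ (ExteriorAlgebra.ι (Hol n V) v)) = ExteriorAlgebra.ι (Hol n V) v
      rw [ExteriorAlgebra.lift_ι_apply, coordLin_apply, map_sum]
      conv_rhs => rw [← e.symm_apply_apply v, pi_eq_sum_univ' (e v), map_sum, map_sum]
      refine Finset.sum_congr rfl fun i _ => ?_
      rw [coordInv_tmul, map_smul, map_smul, coordSec_apply]
      congr 3
      ext j
      by_cases h : i = j
      · subst h; simp
      · simp [Ne.symm h])

lemma coordEquiv_ι (v : G.sec V) : coordEquiv e (ExteriorAlgebra.ι (Hol n V) v) = coordLin e v :=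
  ExteriorAlgebra.lift_ι_apply (Hol n V) _ _ v

lemma coordEquiv_algebraMap (f : Hol n V) :
    coordEquiv e (algebraMap (Hol n V) (G.Ext V) f) = f ⊗ₜ 1 :=
  (coordEquiv e).commutes f

/-- Both sides are multiplicative and additive in `a`, so functions and elements of `G` suffice.
This turns the isomorphisms over single open sets into one of sheaves. -/
lemma coordEquiv_extRes {W : Opens M} (h : W ≤ V) (e' : G.sec W ≃ₗ[Hol n W] (Fin r → Hol n W))
    (he : ∀ v i, e' (G.res h v) i = Hol.res h (e v i)) (a : G.Ext V) :
    Algebra.TensorProduct.map (Hol.res h) (AlgHom.id ℂ _) (coordEquiv e a) =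
      coordEquiv e' (extRes h a) := by
  induction a using ExteriorAlgebra.induction with
  | algebraMap f =>
    rw [extRes_algebraMap, coordEquiv_algebraMap, coordEquiv_algebraMap,
      Algebra.TensorProduct.map_tmul, map_one]
  | ι v =>
    rw [extRes_ι, coordEquiv_ι, coordEquiv_ι, coordLin_apply, coordLin_apply, map_sum]
    refine Finset.sum_congr rfl fun i _ => ?_
    rw [he, Algebra.TensorProduct.map_tmul, AlgHom.id_apply]
  | mul a b ha hb => rw [map_mul, map_mul, ha, hb, map_mul, map_mul]
  | add a b ha hb => rw [map_add, map_add, ha, hb, map_add, map_add]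

lemma coordEquiv_extσ (a : G.Ext V) :
    Algebra.TensorProduct.map (AlgHom.id ℂ (Hol n V)) CliffordAlgebra.involute (coordEquiv e a) =
      coordEquiv e (G.extσ V a) := by
  induction a using ExteriorAlgebra.induction with
  | algebraMap f =>
    rw [AlgHom.commutes, coordEquiv_algebraMap, Algebra.TensorProduct.map_tmul, map_one]
    rfl
  | ι v =>
    rw [show G.extσ V (ExteriorAlgebra.ι _ v) = -ExteriorAlgebra.ι _ v from
      CliffordAlgebra.involute_ι v, map_neg, coordEquiv_ι, coordLin_apply, map_sum,
      ← Finset.sum_neg_distrib]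
    refine Finset.sum_congr rfl fun i _ => ?_
    rw [Algebra.TensorProduct.map_tmul, ← TensorProduct.tmul_neg]
    exact congrArg _ (CliffordAlgebra.involute_ι _)
  | mul a b ha hb => rw [map_mul, map_mul, ha, hb, map_mul, map_mul]
  | add a b ha hb => rw [map_add, map_add, ha, hb, map_add, map_add]

end Coordinates

/-- Over an open set on which `G` is free of rank `r` the sheaf `⋀ G` is isomorphic to
`ℱ ⊗ ⋀(ξ₁, …, ξᵣ)`. -/
lemma IsFreeOn.nonempty_algIso {r : ℕ} {U : Opens M} (h : G.IsFreeOn r U) :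
    Nonempty (AlgIso U G.splitAlg (modelAlg n M r)) := by
  have ht : G.IsTriv U := ⟨r, h⟩
  obtain ⟨e, he⟩ := h
  refine ⟨⟨fun V k => (G.extSec V (ht.mono k)).symm.trans
    ((coordEquiv (e V k)).restrictScalars ℂ), fun {V W} l k f => ?_, fun V k f => ?_⟩⟩
  · change Algebra.TensorProduct.map (Hol.res l) (AlgHom.id ℂ _)
      (coordEquiv (e V k) (f.1 ⟨V, _⟩)) = coordEquiv (e W _) (f.1 ⟨W, _⟩)
    rw [coordEquiv_extRes (e V k) l (e W (l.trans k)) fun v i => he V W l k v i]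
    exact congrArg _ (f.2 ⟨V, _⟩ ⟨W, _⟩ l)
  · exact coordEquiv_extσ (e V k) _

variable (G) in
-- The open sets on which `G` is free are stable under shrinking, and on them `⋀ G` is the model
-- sheaf. Over a general open set the sections are by definition compatible families over such sets.
lemma splitAlg_isSheaf : G.splitAlg.IsSheaf := by
  refine SuperAlg.isSheaf_iff.2 (TypePresheaf.isSheaf_of_basis G.IsTriv
    (fun V W h k => k.mono h) ?_ ?_ ?_)
  · rintro V ⟨r, hr⟩
    obtain ⟨φ⟩ := hr.nonempty_algIso
    exact TypePresheaf.GluesOn.of_equiv (Q := (modelAlg n M r).toTypePresheaf)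
      (fun W h => (φ.toEquiv W h).toEquiv) (fun W W' h k f => φ.map_res h k f)
      ((SuperAlg.isSheaf_iff.1 (modelAlg_isSheaf r)).gluesOn V)
  · intro V f g h
    refine Subtype.ext (funext fun W => ?_)
    have := h W.1 W.2.1 W.2.2
    exact congrFun (congrArg Subtype.val this) ⟨W.1, le_rfl, W.2.2⟩
  · intro V s hs
    refine ⟨⟨fun W => (s W.1 W.2.1 W.2.2).1 ⟨W.1, le_rfl, W.2.2⟩, fun W W' h => ?_⟩, ?_⟩
    · exact ((s W.1 W.2.1 W.2.2).2 ⟨W.1, le_rfl, W.2.2⟩ ⟨W'.1, h, W'.2.2⟩ h).trans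
        (congrArg (fun t : G.splitSec W'.1 => t.1 ⟨W'.1, le_rfl, W'.2.2⟩)
          (hs W.1 W'.1 W.2.1 W.2.2 h))
    · intro W h b
      refine Subtype.ext (funext fun W' => ?_)
      change (s W'.1 _ _).1 _ = _
      rw [← hs W W'.1 h b W'.2.1]
      rfl

end HolMod

/-! ### The grading of `⋀ G` and the powers of its odd ideal. -/

namespace HolMod

variable {n : ℕ} {M : Type u} [TopologicalSpace M] [ChartedSpace (EuclideanSpace ℂ (Fin n)) M]
  {G S₀ S₁ : HolMod n M}

variable (G) in
/-- The projection of the exterior algebra onto its component of degree `k`. -/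
noncomputable def extProj (k : ℕ) (V : Opens M) : G.Ext V →ₗ[Hol n V] G.Ext V :=
  GradedAlgebra.proj (fun i : ℕ => ⋀[Hol n V]^i (G.sec V)) k

lemma extProj_mem (k : ℕ) (V : Opens M) (a : G.Ext V) :
    G.extProj k V a ∈ ⋀[Hol n V]^k (G.sec V) :=
  SetLike.coe_mem (DirectSum.decompose (fun i : ℕ => ⋀[Hol n V]^i (G.sec V)) a k)

lemma extProj_self (k : ℕ) (V : Opens M) {a : G.Ext V} (ha : a ∈ ⋀[Hol n V]^k (G.sec V)) :
    G.extProj k V a = a :=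
  DirectSum.decompose_of_mem_same (fun i : ℕ => ⋀[Hol n V]^i (G.sec V)) ha

lemma extProj_ne {j k : ℕ} (h : j ≠ k) (V : Opens M) {a : G.Ext V}
    (ha : a ∈ ⋀[Hol n V]^k (G.sec V)) : G.extProj j V a = 0 :=
  DirectSum.decompose_of_mem_ne (fun i : ℕ => ⋀[Hol n V]^i (G.sec V)) ha h.symm

lemma extRes_mem {U V : Opens M} (h : U ≤ V) {k : ℕ} {a : G.Ext V}
    (ha : a ∈ ⋀[Hol n V]^k (G.sec V)) : extRes h a ∈ ⋀[Hol n U]^k (G.sec U) := by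
  induction ha using Submodule.pow_induction_on_left' with
  | algebraMap r =>
    rw [extRes_algebraMap]
    exact SetLike.algebraMap_mem_graded (fun i : ℕ => ⋀[Hol n U]^i (G.sec U)) _
  | add x y i hx hy ihx ihy => rw [map_add]; exact add_mem ihx ihy
  | mem_mul m hm i x hx ih =>
    obtain ⟨v, rfl⟩ := hm
    rw [map_mul, extRes_ι]
    exact (pow_succ' (LinearMap.range (ExteriorAlgebra.ι (Hol n U) (M := G.sec U))) i).symm.le
      (Submodule.mul_mem_mul ⟨_, rfl⟩ ih)

lemma extRes_extProj {U V : Opens M} (h : U ≤ V) (k : ℕ) (a : G.Ext V) :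
    extRes h (G.extProj k V a) = G.extProj k U (extRes h a) := by
  induction a using DirectSum.Decomposition.inductionOn (fun i : ℕ => ⋀[Hol n V]^i (G.sec V)) with
  | zero => simp only [map_zero]
  | homogeneous a =>
    rename_i i
    by_cases hik : k = i
    · subst hik
      rw [extProj_self _ _ a.2, extProj_self _ _ (extRes_mem h a.2)]
    · rw [extProj_ne hik _ a.2, extProj_ne hik _ (extRes_mem h a.2), map_zero]
  | add a b ha hb => rw [map_add, map_add, ha, hb, map_add, map_add]

lemma extσ_of_mem {V : Opens M} {k : ℕ} {a : G.Ext V} (ha : a ∈ ⋀[Hol n V]^k (G.sec V)) :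
    G.extσ V a = (-1 : ℂ) ^ k • a := by
  induction ha using Submodule.pow_induction_on_left' with
  | algebraMap r => rw [AlgHom.commutes, pow_zero, one_smul]
  | add x y i hx hy ihx ihy => rw [map_add, ihx, ihy, smul_add]
  | mem_mul m hm i x hx ih =>
    obtain ⟨v, rfl⟩ := hm
    rw [map_mul, ih, show G.extσ V (ExteriorAlgebra.ι _ v) = -ExteriorAlgebra.ι _ v from
      CliffordAlgebra.involute_ι v, pow_succ', neg_one_mul, neg_smul, mul_smul_comm, neg_mul,
      smul_neg]

/-- The exterior power has a basis indexed by the `k`-element subsets of an `r`-element set, of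
which there are none for `k > r`. -/
lemma extProj_eq_zero {r k : ℕ} {V : Opens M} (hV : G.IsFreeOn r V) (hk : r < k) (a : G.Ext V) :
    G.extProj k V a = 0 := by
  obtain ⟨e, he⟩ := hV
  let b := (Module.Basis.ofEquivFun (e V le_rfl)).exteriorPower k
  have : IsEmpty (Set.powersetCard (Fin r) k) := ⟨fun s => by
    have h1 := s.1.card_le_univ
    rw [Fintype.card_fin] at h1
    have h2 : s.1.card = k := s.2
    omega⟩
  have h := b.repr.injective (Subsingleton.elim (b.repr ⟨_, extProj_mem k V a⟩) (b.repr 0))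
  exact congrArg Subtype.val h

lemma sum_extProj {r N : ℕ} {V : Opens M} (hV : G.IsFreeOn r V) (hN : r < N) (a : G.Ext V) :
    ∑ k ∈ Finset.range N, G.extProj k V a = a := by
  classical
  conv_rhs => rw [← DirectSum.sum_support_decompose (fun i : ℕ => ⋀[Hol n V]^i (G.sec V)) a]
  refine (Finset.sum_subset (fun k hk => ?_) fun k _ hk => ?_).symm
  · rw [Finset.mem_range]
    by_contra hkN
    exact DFinsupp.mem_support_iff.1 hk (Subtype.ext (extProj_eq_zero hV (by omega) a))
  · have h : DirectSum.decompose (fun i : ℕ => ⋀[Hol n V]^i (G.sec V)) a k = 0 :=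
      DFinsupp.notMem_support_iff.1 hk
    exact congrArg Subtype.val h

variable (G) in
/-- The isomorphism `extSec`, onto the sections of the sheaf of superalgebras `⋀ G`. -/
noncomputable def extEquiv (V : Opens M) (hV : G.IsTriv V) : G.Ext V ≃ₐ[ℂ] G.splitAlg.sec V :=
  G.extSec V hV

/-- An element of `⋀^k` is a sum of products of `k` elements of `G`, and elements of `G` are odd. -/
lemma extEquiv_mem_oddIdealPow {V : Opens M} (hV : G.IsTriv V) {k : ℕ} {a : G.Ext V}
    (ha : a ∈ ⋀[Hol n V]^k (G.sec V)) : G.extEquiv V hV a ∈ G.splitAlg.oddIdealPow k V := by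
  induction ha using Submodule.pow_induction_on_left' with
  | algebraMap r =>
    unfold SuperAlg.oddIdealPow
    rw [pow_zero, mul_one]
    exact Submodule.mem_top
  | add x y i hx hy ihx ihy => rw [map_add]; exact add_mem ihx ihy
  | mem_mul m hm i x hx ih =>
    obtain ⟨v, rfl⟩ := hm
    rw [map_mul]
    refine (congrArg (G.splitAlg.oddIdealPow · V) (add_comm 1 i)).le
      (G.splitAlg.oddIdealPow_mul_le 1 i V (Submodule.mul_mem_mul ?_ ih))
    have hodd : G.extEquiv V hV (ExteriorAlgebra.ι _ v) ∈ G.splitAlg.odd V :=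
      Subtype.ext (funext fun W => by
        change G.extσ W.1 (extRes W.2.1 (ExteriorAlgebra.ι _ v)) =
          -extRes W.2.1 (ExteriorAlgebra.ι _ v)
        rw [extRes_ι]
        exact CliffordAlgebra.involute_ι _)
    have h1 := Submodule.mul_mem_mul (Submodule.mul_mem_mul (Submodule.mem_top (R := ℂ) (x := 1))
      hodd) (Submodule.mem_top (R := ℂ) (x := 1))
    have h2 := Submodule.mul_mem_mul (Submodule.mem_top (R := ℂ) (x := 1)) h1
    rw [one_mul, one_mul, mul_one] at h2
    unfold SuperAlg.oddIdealPow
    rw [pow_one]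
    exact h2

lemma extEquiv_apply_val {U V : Opens M} (h : V ≤ U) (hV : G.IsTriv V) (s : G.splitAlg.sec U) :
    G.extEquiv V hV (s.1 ⟨V, h, hV⟩) = G.splitAlg.res h s :=
  Subtype.ext (funext fun W => s.2 ⟨V, h, hV⟩ ⟨W.1, W.2.1.trans h, W.2.2⟩ W.2.1)

/-- The projection of `⋀ G` onto `⋀^k G`. -/
noncomputable def splitProj (k : ℕ) (U : Opens M) : G.splitSec U →ₗ[ℂ] G.splitSec U where
  toFun s := ⟨fun W => G.extProj k W.1 (s.1 W), fun V W h => by rw [extRes_extProj, s.2 V W h]⟩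
  map_add' s t := Subtype.ext (funext fun W => map_add (G.extProj k W.1) (s.1 W) (t.1 W))
  map_smul' c s := Subtype.ext (funext fun W => by
    have h := map_smul (G.extProj k W.1) (algebraMap ℂ (Hol n W.1) c) (s.1 W)
    rwa [algebraMap_smul, algebraMap_smul] at h)

lemma splitSec_sum_val {U : Opens M} (s : ℕ → G.splitSec U) (I : Finset ℕ)
    (W : {V : Opens M // V ≤ U ∧ G.IsTriv V}) : (∑ k ∈ I, s k).1 W = ∑ k ∈ I, (s k).1 W := by
  rw [AddSubmonoidClass.coe_finsetSum, Finset.sum_apply]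

/-- Near every point `G` is free of rank `m`, so degrees `0` to `m` exhaust the exterior algebra
there, and the identity is local. -/
lemma sum_splitProj {m : ℕ} (hG : ∀ x : M, ∃ U : Opens M, x ∈ U ∧ G.IsFreeOn m U) {U : Opens M}
    (s : G.splitSec U) : ∑ k ∈ Finset.range (m + 1), splitProj k U s = s := by
  refine G.splitAlg_isSheaf.sep' fun x hx => ?_
  obtain ⟨V, hxV, hV⟩ := hG x
  refine ⟨U ⊓ V, inf_le_left, ⟨hx, hxV⟩, Subtype.ext (funext fun W => ?_)⟩
  change (∑ k ∈ Finset.range (m + 1), splitProj k U s).1 ⟨W.1, W.2.1.trans inf_le_left, W.2.2⟩ =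
    s.1 ⟨W.1, W.2.1.trans inf_le_left, W.2.2⟩
  rw [splitSec_sum_val]
  exact sum_extProj (hV.mono (W.2.1.trans inf_le_right)) m.lt_succ_self _

lemma splitAlgGr_mul_mem {j k : ℕ} {U : Opens M} {s t : G.splitSec U}
    (hs : s ∈ G.splitAlgGr j U) (ht : t ∈ G.splitAlgGr k U) : s * t ∈ G.splitAlgGr (j + k) U :=
  fun W => (pow_add (LinearMap.range (ExteriorAlgebra.ι (Hol n W.1) (M := G.sec W.1))) j k).symm.le
    (Submodule.mul_mem_mul (hs W) (ht W))

lemma res_mem_oddIdealPow {k : ℕ} {U V : Opens M} (h : V ≤ U) (hV : G.IsTriv V)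
    (s : G.splitAlg.sec U) (hs : s.1 ⟨V, h, hV⟩ ∈ ⋀[Hol n V]^k (G.sec V)) :
    G.splitAlg.res h s ∈ G.splitAlg.oddIdealPow k V :=
  (extEquiv_apply_val h hV s) ▸ extEquiv_mem_oddIdealPow hV hs

/-- Membership in `𝒥 ^ k` is a local condition, so it is enough to look at open sets on which `G` is
free. -/
lemma mem_splitAlg_Jpow {m : ℕ} (hG : ∀ x : M, ∃ U : Opens M, x ∈ U ∧ G.IsFreeOn m U)
    (k : ℕ) (U : Opens M) (s : G.splitAlg.sec U) (hs : s ∈ G.splitAlgGrading k U) :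
    s ∈ G.splitAlg.Jpow k U := fun x hx => by
  obtain ⟨V, hxV, hV⟩ := hG x
  have ht : G.IsTriv (U ⊓ V) := ⟨m, hV.mono inf_le_right⟩
  exact ⟨U ⊓ V, inf_le_left, ⟨hx, hxV⟩,
    res_mem_oddIdealPow inf_le_left ht s (hs ⟨U ⊓ V, inf_le_left, ht⟩)⟩

/-- The projections onto the homogeneous components, for the grading `⋀ G = ⨁ ⋀^p G`. -/
noncomputable def splitAlgGradingData {m : ℕ}
    (hG : ∀ x : M, ∃ U : Opens M, x ∈ U ∧ G.IsFreeOn m U) :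
    AlgGradingData G.splitAlg G.splitAlgGrading (m + 1) where
  isSheaf := G.splitAlg_isSheaf
  proj k U := splitProj k U
  proj_res _ _ _ _ _ := rfl
  proj_mem k U s W := extProj_mem k W.1 (s.1 W)
  proj_self k U s hs := Subtype.ext (funext fun W => extProj_self k W.1 (hs W))
  proj_ne j k U h s hs := Subtype.ext (funext fun W => extProj_ne h W.1 (hs W))
  sum_proj U s := sum_splitProj hG s
  one_mem U W := SetLike.GradedOne.one_mem (A := fun i : ℕ => ⋀[Hol n W.1]^i (G.sec W.1))
  mul_mem p q U s hs t ht := splitAlgGr_mul_mem hs ht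
  σ_eq k U s hs := Subtype.ext (funext fun W => extσ_of_mem (hs W))
  le_Jpow k U := mem_splitAlg_Jpow hG k U

end HolMod

/-! ### The split module `⋀ G ⊗ S`: coordinates and the sheaf condition. -/

namespace HolMod

variable {n : ℕ} {M : Type u} [TopologicalSpace M] [ChartedSpace (EuclideanSpace ℂ (Fin n)) M]
  {G S₀ S₁ : HolMod n M}

section Coordinates

variable {p q : ℕ} {V : Opens M} (e₀ : S₀.sec V ≃ₗ[Hol n V] (Fin p → Hol n V))
  (e₁ : S₁.sec V ≃ₗ[Hol n V] (Fin q → Hol n V))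

variable (G) in
/-- The isomorphism `⋀ G(V) ⊗ (S₀(V) ⊕ S₁(V)) → (⋀ G(V))^p ⊕ (⋀ G(V))^q` defined by trivializations
of `S₀` and `S₁`. -/
noncomputable def tensCoord :
    G.Tens S₀ S₁ V ≃ₗ[G.Ext V] (Fin p → G.Ext V) × (Fin q → G.Ext V) :=
  (Algebra.TensorProduct.basis (G.Ext V)
    ((Module.Basis.ofEquivFun e₀).prod (Module.Basis.ofEquivFun e₁))).equivFun ≪≫ₗ
    LinearEquiv.sumArrowLequivProdArrow (Fin p) (Fin q) (G.Ext V) (G.Ext V)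

lemma tensCoord_tmul_fst (a : G.Ext V) (s : S₀.sec V × S₁.sec V) (i : Fin p) :
    (G.tensCoord e₀ e₁ (a ⊗ₜ s)).1 i = a * algebraMap (Hol n V) (G.Ext V) (e₀ s.1 i) := by
  change (Algebra.TensorProduct.basis (G.Ext V) _).repr (a ⊗ₜ s) (Sum.inl i) = _
  rw [Algebra.TensorProduct.basis_repr_tmul]
  simp

lemma tensCoord_tmul_snd (a : G.Ext V) (s : S₀.sec V × S₁.sec V) (j : Fin q) :
    (G.tensCoord e₀ e₁ (a ⊗ₜ s)).2 j = a * algebraMap (Hol n V) (G.Ext V) (e₁ s.2 j) := by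
  change (Algebra.TensorProduct.basis (G.Ext V) _).repr (a ⊗ₜ s) (Sum.inr j) = _
  rw [Algebra.TensorProduct.basis_repr_tmul]
  simp

lemma tensCoord_tensRes_fst {W : Opens M} (h : W ≤ V)
    {e₀' : S₀.sec W ≃ₗ[Hol n W] (Fin p → Hol n W)} {e₁' : S₁.sec W ≃ₗ[Hol n W] (Fin q → Hol n W)}
    (h₀ : ∀ v i, e₀' (S₀.res h v) i = Hol.res h (e₀ v i)) (t : G.Tens S₀ S₁ V) (i : Fin p) :
    (G.tensCoord e₀' e₁' (tensRes h t)).1 i = extRes h ((G.tensCoord e₀ e₁ t).1 i) := by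
  induction t using TensorProduct.induction_on with
  | zero => simp only [map_zero, Prod.fst_zero, Pi.zero_apply]
  | tmul a s =>
    rw [tensRes_tmul, tensCoord_tmul_fst, tensCoord_tmul_fst, map_mul, extRes_algebraMap, h₀]
  | add x y hx hy =>
    rw [map_add, map_add, Prod.fst_add, Pi.add_apply, hx, hy, map_add, Prod.fst_add, Pi.add_apply,
      map_add]

lemma tensCoord_tensRes_snd {W : Opens M} (h : W ≤ V)
    {e₀' : S₀.sec W ≃ₗ[Hol n W] (Fin p → Hol n W)} {e₁' : S₁.sec W ≃ₗ[Hol n W] (Fin q → Hol n W)}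
    (h₁ : ∀ v i, e₁' (S₁.res h v) i = Hol.res h (e₁ v i)) (t : G.Tens S₀ S₁ V) (j : Fin q) :
    (G.tensCoord e₀' e₁' (tensRes h t)).2 j = extRes h ((G.tensCoord e₀ e₁ t).2 j) := by
  induction t using TensorProduct.induction_on with
  | zero => simp only [map_zero, Prod.snd_zero, Pi.zero_apply]
  | tmul a s =>
    rw [tensRes_tmul, tensCoord_tmul_snd, tensCoord_tmul_snd, map_mul, extRes_algebraMap, h₁]
  | add x y hx hy =>
    rw [map_add, map_add, Prod.snd_add, Pi.add_apply, hx, hy, map_add, Prod.snd_add, Pi.add_apply,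
      map_add]

lemma tensCoord_tensσ_fst (t : G.Tens S₀ S₁ V) (i : Fin p) :
    (G.tensCoord e₀ e₁ (G.tensσ S₀ S₁ V t)).1 i = G.extσ V ((G.tensCoord e₀ e₁ t).1 i) := by
  induction t using TensorProduct.induction_on with
  | zero => simp only [map_zero, Prod.fst_zero, Pi.zero_apply]
  | tmul a s => rw [tensσ_tmul, tensCoord_tmul_fst, tensCoord_tmul_fst, map_mul, AlgHom.commutes]
  | add x y hx hy =>
    rw [map_add, map_add, Prod.fst_add, Pi.add_apply, hx, hy, map_add, Prod.fst_add, Pi.add_apply,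
      map_add]

/-- The sign records that the basis elements coming from `S₁` are odd; it matches the sign in the
parity of `freeMod`. -/
lemma tensCoord_tensσ_snd (t : G.Tens S₀ S₁ V) (j : Fin q) :
    (G.tensCoord e₀ e₁ (G.tensσ S₀ S₁ V t)).2 j = -G.extσ V ((G.tensCoord e₀ e₁ t).2 j) := by
  induction t using TensorProduct.induction_on with
  | zero => simp only [map_zero, Prod.snd_zero, Pi.zero_apply, neg_zero]
  | tmul a s =>
    rw [tensσ_tmul, tensCoord_tmul_snd, tensCoord_tmul_snd, map_mul, AlgHom.commutes, map_neg,
      Pi.neg_apply, map_neg, mul_neg]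
  | add x y hx hy =>
    rw [map_add, map_add, Prod.snd_add, Pi.add_apply, hx, hy, map_add, Prod.snd_add, Pi.add_apply,
      map_add, neg_add]

end Coordinates

variable (G S₀ S₁) in
/-- The open sets on which `G`, `S₀` and `S₁` are free. -/
def AllTriv (U : Opens M) : Prop := G.IsTriv U ∧ S₀.IsTriv U ∧ S₁.IsTriv U

lemma AllTriv.mono {U V : Opens M} (h : AllTriv G S₀ S₁ U) (k : V ≤ U) : AllTriv G S₀ S₁ V :=
  ⟨h.1.mono k, h.2.1.mono k, h.2.2.mono k⟩

/-- Over an open set on which `G`, `S₀` and `S₁` are free, a section of `⋀ G ⊗ S` is an element of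
the tensor product of the modules of sections. -/
noncomputable def tensEquiv (V : Opens M) (hV : AllTriv G S₀ S₁ V) :
    G.Tens S₀ S₁ V ≃+ (G.splitMod S₀ S₁).sec V where
  toFun t := ⟨fun W => tensRes W.2.1 t, fun W W' h => tensRes_tensRes _ _ t⟩
  invFun s := s.1 ⟨V, le_rfl, hV⟩
  left_inv t := tensRes_self V t
  right_inv s := Subtype.ext (funext fun W => s.2 ⟨V, le_rfl, hV⟩ W W.2.1)
  map_add' s t := Subtype.ext (funext fun W => map_add (tensRes W.2.1) s t)

lemma tensEquiv_smul {V : Opens M} (hV : AllTriv G S₀ S₁ V) (a : G.Ext V) (t : G.Tens S₀ S₁ V) :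
    tensEquiv V hV (a • t) = G.extEquiv V hV.1 a • tensEquiv V hV t :=
  Subtype.ext (funext fun W => G.tensRes_smul S₀ S₁ W.2.1 a t)

lemma tensEquiv_apply_val {U V : Opens M} (h : V ≤ U) (hV : AllTriv G S₀ S₁ V)
    (s : (G.splitMod S₀ S₁).sec U) :
    tensEquiv V hV (s.1 ⟨V, h, hV⟩) = (G.splitMod S₀ S₁).res h s :=
  Subtype.ext (funext fun W => s.2 ⟨V, h, hV⟩ ⟨W.1, W.2.1.trans h, W.2.2⟩ W.2.1)

lemma res_extEquiv {V W : Opens M} (h : W ≤ V) (hV : G.IsTriv V) (a : G.Ext V) :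
    G.splitAlg.res h (G.extEquiv V hV a) = G.extEquiv W (hV.mono h) (extRes h a) :=
  Subtype.ext (funext fun W' => (extRes_extRes W'.2.1 h a).symm)

lemma σ_extEquiv {V : Opens M} (hV : G.IsTriv V) (a : G.Ext V) :
    G.splitAlg.σ V (G.extEquiv V hV a) = G.extEquiv V hV (G.extσ V a) :=
  Subtype.ext (funext fun W => (G.extRes_extσ W.2.1 a).symm)

lemma extEquiv_val {V : Opens M} (hV : G.IsTriv V) (s : G.splitAlg.sec V) :
    G.extEquiv V hV (s.1 ⟨V, le_rfl, hV⟩) = s :=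
  (G.extEquiv V hV).apply_symm_apply s

section FreeCoordinates

variable {p q : ℕ} {V : Opens M} (hV : AllTriv G S₀ S₁ V)
  (e₀ : S₀.sec V ≃ₗ[Hol n V] (Fin p → Hol n V)) (e₁ : S₁.sec V ≃ₗ[Hol n V] (Fin q → Hol n V))

/-- The coordinates of the sections of `⋀ G ⊗ S` defined by trivializations of `S₀` and `S₁`. -/
noncomputable def freeCoord : (G.splitMod S₀ S₁).sec V ≃+ (freeMod G.splitAlg p q).sec V :=
  (tensEquiv V hV).symm.trans ((G.tensCoord e₀ e₁).toAddEquiv.trans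
    ((AddEquiv.piCongrRight fun _ => (G.extEquiv V hV.1).toAddEquiv).prodCongr
      (AddEquiv.piCongrRight fun _ => (G.extEquiv V hV.1).toAddEquiv)))

lemma res_freeCoord {W : Opens M} (h : W ≤ V)
    {e₀' : S₀.sec W ≃ₗ[Hol n W] (Fin p → Hol n W)} {e₁' : S₁.sec W ≃ₗ[Hol n W] (Fin q → Hol n W)}
    (h₀ : ∀ v i, e₀' (S₀.res h v) i = Hol.res h (e₀ v i))
    (h₁ : ∀ v i, e₁' (S₁.res h v) i = Hol.res h (e₁ v i)) (v : (G.splitMod S₀ S₁).sec V) :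
    (freeMod G.splitAlg p q).res h (freeCoord hV e₀ e₁ v) =
      freeCoord (hV.mono h) e₀' e₁' ((G.splitMod S₀ S₁).res h v) := by
  -- Compatibility of the family `v`: its entry at `W` is the restriction of its entry at `V`, which
  -- reduces the claim to the coordinates of tensors.
  have hv : tensRes h (v.1 ⟨V, le_rfl, hV⟩) = v.1 ⟨W, h, hV.mono h⟩ :=
    v.2 ⟨V, le_rfl, hV⟩ ⟨W, h, hV.mono h⟩ h
  refine Prod.ext (funext fun i => ?_) (funext fun j => ?_)
  · exact (res_extEquiv h hV.1 _).trans (congrArg (G.extEquiv W (hV.mono h).1)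
      ((tensCoord_tensRes_fst e₀ e₁ h h₀ _ i).symm.trans
        (congrArg (fun t => (G.tensCoord e₀' e₁' t).1 i) hv)))
  · exact (res_extEquiv h hV.1 _).trans (congrArg (G.extEquiv W (hV.mono h).1)
      ((tensCoord_tensRes_snd e₀ e₁ h h₁ _ j).symm.trans
        (congrArg (fun t => (G.tensCoord e₀' e₁' t).2 j) hv)))

lemma σ_freeCoord (v : (G.splitMod S₀ S₁).sec V) :
    (freeMod G.splitAlg p q).σ V (freeCoord hV e₀ e₁ v) =
      freeCoord hV e₀ e₁ ((G.splitMod S₀ S₁).σ V v) := by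
  refine Prod.ext (funext fun i => ?_) (funext fun j => ?_)
  · exact (σ_extEquiv hV.1 _).trans (congrArg (G.extEquiv V hV.1)
      (tensCoord_tensσ_fst e₀ e₁ _ i).symm)
  · exact (congrArg Neg.neg (σ_extEquiv hV.1 _)).trans ((map_neg (G.extEquiv V hV.1) _).symm.trans
      (congrArg (G.extEquiv V hV.1) (tensCoord_tensσ_snd e₀ e₁ _ j).symm))

lemma freeCoord_smul (f : G.splitAlg.sec V) (v : (G.splitMod S₀ S₁).sec V) :
    freeCoord hV e₀ e₁ (f • v) = f • freeCoord hV e₀ e₁ v := by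
  have h := map_smul (G.tensCoord e₀ e₁) (f.1 ⟨V, le_rfl, hV.1⟩) (v.1 ⟨V, le_rfl, hV⟩)
  refine Prod.ext (funext fun i => ?_) (funext fun j => ?_)
  · exact (congrArg (fun x => G.extEquiv V hV.1 (x.1 i)) h).trans
      ((map_mul (G.extEquiv V hV.1) _ _).trans (congrArg (· * _) (extEquiv_val hV.1 f)))
  · exact (congrArg (fun x => G.extEquiv V hV.1 (x.2 j)) h).trans
      ((map_mul (G.extEquiv V hV.1) _ _).trans (congrArg (· * _) (extEquiv_val hV.1 f)))

end FreeCoordinates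

/-- Over an open set on which `G`, `S₀` and `S₁` are free, the sheaf `⋀ G ⊗ S` is free. -/
lemma exists_quasiIso_freeMod {p q : ℕ} {U : Opens M} (hG : G.IsTriv U) (h₀ : S₀.IsFreeOn p U)
    (h₁ : S₁.IsFreeOn q U) :
    ∃ φ : QuasiIso U (G.splitPair S₀ S₁) ⟨G.splitAlg, freeMod G.splitAlg p q⟩,
      φ.toAlgIso = AlgIso.refl U G.splitAlg := by
  have hU : AllTriv G S₀ S₁ U := ⟨hG, ⟨p, h₀⟩, ⟨q, h₁⟩⟩
  obtain ⟨e₀, he₀⟩ := h₀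
  obtain ⟨e₁, he₁⟩ := h₁
  exact ⟨⟨AlgIso.refl U G.splitAlg, fun V k => freeCoord (hU.mono k) (e₀ V k) (e₁ V k),
    fun {V W} h k v => res_freeCoord (hU.mono k) (e₀ V k) (e₁ V k) h (he₀ V W h k) (he₁ V W h k) v,
    fun V k v => σ_freeCoord (hU.mono k) (e₀ V k) (e₁ V k) v,
    fun V k f v => freeCoord_smul (hU.mono k) (e₀ V k) (e₁ V k) f v⟩, rfl⟩

variable (G S₀ S₁) in
-- Where `G`, `S₀` and `S₁` are all free the module is a finite product of copies of the sheaf `⋀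
-- G`; such open sets satisfy the basis criterion.
lemma splitMod_isSheaf : (G.splitMod S₀ S₁).IsSheaf := by
  refine SuperMod.isSheaf_iff.2 (TypePresheaf.isSheaf_of_basis (AllTriv G S₀ S₁)
    (fun V W h k => k.mono h) ?_ ?_ ?_)
  · rintro V ⟨hG, ⟨p, h₀⟩, ⟨q, h₁⟩⟩
    obtain ⟨φ, -⟩ := exists_quasiIso_freeMod hG h₀ h₁
    exact TypePresheaf.GluesOn.of_equiv (Q := (freeMod G.splitAlg p q).toTypePresheaf)
      (fun W h => (φ.toModEquiv W h).toEquiv) (fun W W' h k v => φ.mod_res h k v)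
      ((SuperMod.isSheaf_iff.1 (freeMod_isSheaf G.splitAlg_isSheaf p q)).gluesOn V)
  · intro V f g h
    refine Subtype.ext (funext fun W => ?_)
    have := h W.1 W.2.1 W.2.2
    exact congrFun (congrArg Subtype.val this) ⟨W.1, le_rfl, W.2.2⟩
  · intro V s hs
    refine ⟨⟨fun W => (s W.1 W.2.1 W.2.2).1 ⟨W.1, le_rfl, W.2.2⟩, fun W W' h => ?_⟩, ?_⟩
    · exact ((s W.1 W.2.1 W.2.2).2 ⟨W.1, le_rfl, W.2.2⟩ ⟨W'.1, h, W'.2.2⟩ h).trans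
        (congrArg (fun t : G.splitModSec S₀ S₁ W'.1 => t.1 ⟨W'.1, le_rfl, W'.2.2⟩)
          (hs W.1 W'.1 W.2.1 W.2.2 h))
    · intro W h b
      refine Subtype.ext (funext fun W' => ?_)
      change (s W'.1 _ _).1 _ = _
      rw [← hs W W'.1 h b W'.2.1]
      rfl

end HolMod

/-! ### The grading of `⋀ G ⊗ S` and its filtration. -/

namespace HolMod

variable {n : ℕ} {M : Type u} [TopologicalSpace M] [ChartedSpace (EuclideanSpace ℂ (Fin n)) M]
  {G S₀ S₁ : HolMod n M}

lemma tmul_mem_tensGr {k : ℕ} {V : Opens M} {a : G.Ext V} (ha : a ∈ ⋀[Hol n V]^k (G.sec V))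
    (s : S₀.sec V × S₁.sec V) : a ⊗ₜ[Hol n V] s ∈ G.tensGr S₀ S₁ k V :=
  ⟨⟨a, ha⟩ ⊗ₜ s, rfl⟩

/-- The graded piece is the image of `⋀^k G ⊗ S`, hence generated additively by pure tensors whose
first factor has degree `k`. -/
lemma tensGr_induction {k : ℕ} {V : Opens M} {P : G.Tens S₀ S₁ V → Prop} (h0 : P 0)
    (htmul : ∀ a ∈ ⋀[Hol n V]^k (G.sec V), ∀ s : S₀.sec V × S₁.sec V, P (a ⊗ₜ s))
    (hadd : ∀ x y, P x → P y → P (x + y)) {t : G.Tens S₀ S₁ V} (ht : t ∈ G.tensGr S₀ S₁ k V) :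
    P t := by
  obtain ⟨t, rfl⟩ := ht
  induction t using TensorProduct.induction_on with
  | zero => rwa [map_zero]
  | tmul a s => exact htmul a.1 a.2 s
  | add x y hx hy => rw [map_add]; exact hadd _ _ hx hy

variable (G S₀ S₁) in
/-- The projection of `⋀ G(V) ⊗ (S₀(V) ⊕ S₁(V))` onto its component of degree `k`. -/
noncomputable def tensProj (k : ℕ) (V : Opens M) : G.Tens S₀ S₁ V →ₗ[Hol n V] G.Tens S₀ S₁ V :=
  (G.extProj k V).rTensor _

lemma tensProj_tmul (k : ℕ) {V : Opens M} (a : G.Ext V) (s : S₀.sec V × S₁.sec V) :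
    G.tensProj S₀ S₁ k V (a ⊗ₜ s) = G.extProj k V a ⊗ₜ s := rfl

lemma tensProj_mem (k : ℕ) (V : Opens M) (t : G.Tens S₀ S₁ V) :
    G.tensProj S₀ S₁ k V t ∈ G.tensGr S₀ S₁ k V := by
  induction t using TensorProduct.induction_on with
  | zero => rw [map_zero]; exact zero_mem _
  | tmul a s => exact tmul_mem_tensGr (extProj_mem k V a) s
  | add x y hx hy => rw [map_add]; exact add_mem hx hy

lemma tensProj_self (k : ℕ) (V : Opens M) {t : G.Tens S₀ S₁ V} (ht : t ∈ G.tensGr S₀ S₁ k V) :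
    G.tensProj S₀ S₁ k V t = t := by
  refine tensGr_induction (P := fun t => G.tensProj S₀ S₁ k V t = t) (map_zero _)
    (fun a ha s => ?_) (fun x y hx hy => ?_) ht
  · rw [tensProj_tmul, extProj_self k V ha]
  · rw [map_add, hx, hy]

lemma tensProj_ne {j k : ℕ} (h : j ≠ k) (V : Opens M) {t : G.Tens S₀ S₁ V}
    (ht : t ∈ G.tensGr S₀ S₁ k V) : G.tensProj S₀ S₁ j V t = 0 := by
  refine tensGr_induction (P := fun t => G.tensProj S₀ S₁ j V t = 0) (map_zero _)
    (fun a ha s => ?_) (fun x y hx hy => ?_) ht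
  · rw [tensProj_tmul, extProj_ne h V ha, TensorProduct.zero_tmul]
  · rw [map_add, hx, hy, add_zero]

lemma tensRes_tensProj {U V : Opens M} (h : U ≤ V) (k : ℕ) (t : G.Tens S₀ S₁ V) :
    tensRes h (G.tensProj S₀ S₁ k V t) = G.tensProj S₀ S₁ k U (tensRes h t) := by
  induction t using TensorProduct.induction_on with
  | zero => simp only [map_zero]
  | tmul a s => rw [tensProj_tmul, tensRes_tmul, tensRes_tmul, tensProj_tmul, extRes_extProj]
  | add x y hx hy => rw [map_add, map_add, hx, hy, map_add, map_add]

lemma sum_tensProj {r N : ℕ} {V : Opens M} (hV : G.IsFreeOn r V) (hN : r < N)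
    (t : G.Tens S₀ S₁ V) : ∑ k ∈ Finset.range N, G.tensProj S₀ S₁ k V t = t := by
  induction t using TensorProduct.induction_on with
  | zero => simp only [map_zero, Finset.sum_const_zero]
  | tmul a s =>
    simp only [tensProj_tmul]
    rw [← TensorProduct.sum_tmul, sum_extProj hV hN]
  | add x y hx hy => simp only [map_add, Finset.sum_add_distrib, hx, hy]

lemma smul_mem_tensGr {j k : ℕ} {V : Opens M} {a : G.Ext V} (ha : a ∈ ⋀[Hol n V]^j (G.sec V))
    {t : G.Tens S₀ S₁ V} (ht : t ∈ G.tensGr S₀ S₁ k V) : a • t ∈ G.tensGr S₀ S₁ (j + k) V := by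
  refine tensGr_induction (P := fun t => a • t ∈ G.tensGr S₀ S₁ (j + k) V)
    (by rw [smul_zero]; exact zero_mem _) (fun b hb s => ?_) (fun x y hx hy => ?_) ht
  · rw [TensorProduct.smul_tmul', smul_eq_mul]
    exact tmul_mem_tensGr ((pow_add (LinearMap.range (ExteriorAlgebra.ι (Hol n V)
      (M := G.sec V))) j k).symm.le (Submodule.mul_mem_mul ha hb)) _
  · rw [smul_add]
    exact add_mem hx hy

lemma extσ_mem {k : ℕ} {V : Opens M} {a : G.Ext V} (ha : a ∈ ⋀[Hol n V]^k (G.sec V)) :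
    G.extσ V a ∈ ⋀[Hol n V]^k (G.sec V) := by
  rw [extσ_of_mem ha, ← algebraMap_smul (Hol n V) ((-1 : ℂ) ^ k) a]
  exact Submodule.smul_mem _ _ ha

lemma tensσ_mem {k : ℕ} {V : Opens M} {t : G.Tens S₀ S₁ V} (ht : t ∈ G.tensGr S₀ S₁ k V) :
    G.tensσ S₀ S₁ V t ∈ G.tensGr S₀ S₁ k V := by
  refine tensGr_induction (P := fun t => G.tensσ S₀ S₁ V t ∈ G.tensGr S₀ S₁ k V)
    (by rw [map_zero]; exact zero_mem _) (fun b hb s => ?_) (fun x y hx hy => ?_) ht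
  · exact tmul_mem_tensGr (extσ_mem hb) _
  · rw [map_add]
    exact add_mem hx hy

/-- A pure tensor `a ⊗ s` is `a • (1 ⊗ s)`, and `a` lies in `𝒥 ^ k` when its degree is `k`. -/
lemma tensEquiv_mem_preFilt {k : ℕ} {V : Opens M} (hV : AllTriv G S₀ S₁ V) {t : G.Tens S₀ S₁ V}
    (ht : t ∈ G.tensGr S₀ S₁ k V) : tensEquiv V hV t ∈ (G.splitMod S₀ S₁).preFilt k V := by
  refine tensGr_induction (P := fun t => tensEquiv V hV t ∈ (G.splitMod S₀ S₁).preFilt k V)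
    (by rw [map_zero]; exact zero_mem _) (fun a ha s => ?_) (fun x y hx hy => ?_) ht
  · refine AddSubgroup.subset_closure ⟨G.extEquiv V hV.1 a,
      SuperAlg.oddIdealPow_le_Jpow _ _ (extEquiv_mem_oddIdealPow hV.1 ha),
      tensEquiv V hV (1 ⊗ₜ s), ?_⟩
    rw [← tensEquiv_smul, TensorProduct.smul_tmul', smul_eq_mul, mul_one]
  · rw [map_add]
    exact add_mem hx hy

lemma res_mem_preFilt {k : ℕ} {U V : Opens M} (h : V ≤ U) (hV : AllTriv G S₀ S₁ V)
    (s : (G.splitMod S₀ S₁).sec U) (hs : s.1 ⟨V, h, hV⟩ ∈ G.tensGr S₀ S₁ k V) :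
    (G.splitMod S₀ S₁).res h s ∈ (G.splitMod S₀ S₁).preFilt k V :=
  (tensEquiv_apply_val h hV s) ▸ tensEquiv_mem_preFilt hV hs

/-- The projection of `⋀ G ⊗ S` onto `⋀^k G ⊗ S`. -/
noncomputable def splitModProj (k : ℕ) (U : Opens M) :
    G.splitModSec S₀ S₁ U →+ G.splitModSec S₀ S₁ U where
  toFun s := ⟨fun W => G.tensProj S₀ S₁ k W.1 (s.1 W), fun V W h => by
    rw [tensRes_tensProj, s.2 V W h]⟩
  map_zero' := Subtype.ext (funext fun W => map_zero (G.tensProj S₀ S₁ k W.1))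
  map_add' s t := Subtype.ext (funext fun W => map_add (G.tensProj S₀ S₁ k W.1) (s.1 W) (t.1 W))

lemma splitModSec_sum_val {U : Opens M} (s : ℕ → G.splitModSec S₀ S₁ U) (I : Finset ℕ)
    (W : G.TrivIn S₀ S₁ U) : (∑ k ∈ I, s k).1 W = ∑ k ∈ I, (s k).1 W := by
  rw [AddSubmonoidClass.coe_finsetSum, Finset.sum_apply]

lemma sum_splitModProj {m : ℕ} (hG : ∀ x : M, ∃ U : Opens M, x ∈ U ∧ G.IsFreeOn m U) {U : Opens M}
    (s : G.splitModSec S₀ S₁ U) : ∑ k ∈ Finset.range (m + 1), splitModProj k U s = s := by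
  refine (splitMod_isSheaf G S₀ S₁).sep' fun x hx => ?_
  obtain ⟨V, hxV, hV⟩ := hG x
  refine ⟨U ⊓ V, inf_le_left, ⟨hx, hxV⟩, Subtype.ext (funext fun W => ?_)⟩
  change (∑ k ∈ Finset.range (m + 1), splitModProj k U s).1 ⟨W.1, W.2.1.trans inf_le_left, W.2.2⟩ =
    s.1 ⟨W.1, W.2.1.trans inf_le_left, W.2.2⟩
  rw [splitModSec_sum_val]
  exact sum_tensProj (hV.mono (W.2.1.trans inf_le_right)) m.lt_succ_self _

lemma exists_allTriv {m p q : ℕ} (hG : ∀ x : M, ∃ U : Opens M, x ∈ U ∧ G.IsFreeOn m U)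
    (h₀ : ∀ x : M, ∃ U : Opens M, x ∈ U ∧ S₀.IsFreeOn p U)
    (h₁ : ∀ x : M, ∃ U : Opens M, x ∈ U ∧ S₁.IsFreeOn q U) (x : M) :
    ∃ U : Opens M, x ∈ U ∧ G.IsFreeOn m U ∧ S₀.IsFreeOn p U ∧ S₁.IsFreeOn q U := by
  obtain ⟨U, hU, h⟩ := hG x
  obtain ⟨V, hV, k⟩ := h₀ x
  obtain ⟨W, hW, l⟩ := h₁ x
  exact ⟨U ⊓ (V ⊓ W), ⟨hU, hV, hW⟩, h.mono inf_le_left,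
    k.mono (inf_le_right.trans inf_le_left), l.mono (inf_le_right.trans inf_le_right)⟩

lemma mem_splitMod_filt (h : ∀ x : M, ∃ U : Opens M, x ∈ U ∧ AllTriv G S₀ S₁ U)
    (k : ℕ) (U : Opens M) (s : (G.splitMod S₀ S₁).sec U) (hs : s ∈ G.splitModGrading S₀ S₁ k U) :
    s ∈ (G.splitMod S₀ S₁).filt k U := fun x hx => by
  obtain ⟨V, hxV, hV⟩ := h x
  have ht : AllTriv G S₀ S₁ (U ⊓ V) := hV.mono inf_le_right
  exact ⟨U ⊓ V, inf_le_left, ⟨hx, hxV⟩,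
    res_mem_preFilt inf_le_left ht s (hs ⟨U ⊓ V, inf_le_left, ht⟩)⟩

lemma smul_mem_splitModGrading {j k : ℕ} {U : Opens M} {f : G.splitAlg.sec U}
    {s : (G.splitMod S₀ S₁).sec U} (hf : f ∈ G.splitAlgGrading j U)
    (hs : s ∈ G.splitModGrading S₀ S₁ k U) : f • s ∈ G.splitModGrading S₀ S₁ (j + k) U :=
  fun W => smul_mem_tensGr (hf ⟨W.1, W.2.1, W.2.2.1⟩) (hs W)

/-- The projections onto the homogeneous components, for the grading of `⋀ G ⊗ S`. -/
noncomputable def splitModGradingData {m p q : ℕ}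
    (hG : ∀ x : M, ∃ U : Opens M, x ∈ U ∧ G.IsFreeOn m U)
    (h₀ : ∀ x : M, ∃ U : Opens M, x ∈ U ∧ S₀.IsFreeOn p U)
    (h₁ : ∀ x : M, ∃ U : Opens M, x ∈ U ∧ S₁.IsFreeOn q U) :
    ModGradingData (G.splitMod S₀ S₁) G.splitAlgGrading (G.splitModGrading S₀ S₁) (m + 1) where
  isSheaf := splitMod_isSheaf G S₀ S₁
  proj k U := splitModProj k U
  proj_res _ _ _ _ _ := rfl
  proj_mem k U s W := tensProj_mem k W.1 (s.1 W)
  proj_self k U s hs := Subtype.ext (funext fun W => tensProj_self k W.1 (hs W))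
  proj_ne j k U h s hs := Subtype.ext (funext fun W => tensProj_ne h W.1 (hs W))
  sum_proj U s := sum_splitModProj hG s
  smul_mem j k U f hf s hs := smul_mem_splitModGrading hf hs
  σ_mem k U s hs W := tensσ_mem (hs W)
  le_filt k U s hs := mem_splitMod_filt (fun x => by
    obtain ⟨U, hU, h, h', h''⟩ := exists_allTriv hG h₀ h₁ x
    exact ⟨U, hU, ⟨m, h⟩, ⟨p, h'⟩, ⟨q, h''⟩⟩) k U s hs

end HolMod

/-! ### Local triviality and its transport along local isomorphisms. -/

section LocalModels

variable {n : ℕ} {M : Type u} [TopologicalSpace M]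

/-- The isomorphism of free sheaves of modules induced by an isomorphism of sheaves of
superalgebras. -/
def AlgIso.freeMod {U : Opens M} {A B : SuperAlg M} (φ : AlgIso U A B) (p q : ℕ) :
    QuasiIso U ⟨A, SuperGeom.freeMod A p q⟩ ⟨B, SuperGeom.freeMod B p q⟩ where
  toAlgIso := φ
  toModEquiv V k := (AddEquiv.piCongrRight fun _ => (φ.toEquiv V k).toAddEquiv).prodCongr
    (AddEquiv.piCongrRight fun _ => (φ.toEquiv V k).toAddEquiv)
  mod_res h k v := Prod.ext (funext fun i => φ.map_res h k (v.1 i))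
    (funext fun j => φ.map_res h k (v.2 j))
  mod_σ V k v := Prod.ext (funext fun i => φ.map_σ V k (v.1 i))
    (funext fun j => (congrArg Neg.neg (φ.map_σ V k (v.2 j))).trans (map_neg _ _).symm)
  mod_smul V k f v := Prod.ext (funext fun i => map_mul (φ.toEquiv V k) f (v.1 i))
    (funext fun j => map_mul (φ.toEquiv V k) f (v.2 j))

variable [ChartedSpace (EuclideanSpace ℂ (Fin n)) M]

/-- A trivialization of the module is followed by the map of free modules induced by a chart of the
supermanifold. All pairs of the same dimension and rank thus share one local model. -/
lemma SuperMod.IsLocallyFree.exists_quasiIso {X : SuperPair M} {m p q : ℕ}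
    (hA : IsSupermanifold n m X.alg) (hE : X.mod.IsLocallyFree p q) (x : M) :
    ∃ U : Opens M, x ∈ U ∧ Nonempty (QuasiIso U X
      ⟨modelAlg n M m, freeMod (modelAlg n M m) p q⟩) := by
  obtain ⟨U, hxU, ⟨φ⟩⟩ := hA.2 x
  obtain ⟨V, hxV, ψ, -⟩ := hE.2 x
  exact ⟨U ⊓ V, ⟨hxU, hxV⟩, ⟨(ψ.restrict inf_le_right).trans
    ((φ.restrict inf_le_left).freeMod p q)⟩⟩

/-- A quasi-isomorphism with a pair whose module is free trivializes the module. -/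
lemma QuasiIso.exists_trivialization {X Y : SuperPair M} {p q : ℕ} {U : Opens M}
    (φ : QuasiIso U X Y)
    (ψ : QuasiIso U Y ⟨Y.alg, freeMod Y.alg p q⟩) (hψ : ψ.toAlgIso = AlgIso.refl U Y.alg) :
    ∃ χ : QuasiIso U X ⟨X.alg, freeMod X.alg p q⟩, χ.toAlgIso = AlgIso.refl U X.alg := by
  -- The last factor brings the free module over `Y.alg` back to `X.alg`, so that the total map on
  -- the algebra is `φ` followed by its inverse.
  refine ⟨(φ.trans ψ).trans (φ.toAlgIso.symm.freeMod p q), ?_⟩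
  change (φ.toAlgIso.trans ψ.toAlgIso).trans φ.toAlgIso.symm = _
  rw [hψ]
  exact AlgIso.ext' fun V k f => (φ.toEquiv V k).symm_apply_apply f

namespace HolMod

variable {G S₀ S₁ : HolMod n M} {m p q : ℕ}

lemma splitAlg_isSupermanifold (hG : G.IsLocallyFree m) : IsSupermanifold n m G.splitAlg :=
  ⟨G.splitAlg_isSheaf, fun x => by
    obtain ⟨U, hxU, hU⟩ := hG.2 x
    exact ⟨U, hxU, hU.nonempty_algIso⟩⟩

lemma splitMod_isLocallyFree (hG : G.IsLocallyFree m) (h₀ : S₀.IsLocallyFree p)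
    (h₁ : S₁.IsLocallyFree q) : (G.splitMod S₀ S₁).IsLocallyFree p q :=
  ⟨splitMod_isSheaf G S₀ S₁, fun x => by
    obtain ⟨U, hxU, h, h', h''⟩ := exists_allTriv hG.2 h₀.2 h₁.2 x
    exact ⟨U, hxU, exists_quasiIso_freeMod ⟨m, h⟩ h' h''⟩⟩

end HolMod

/-- A sheaf locally isomorphic to the structure sheaf of a supermanifold is one. -/
lemma IsSupermanifold.of_local {m : ℕ} {A B : SuperAlg M} (hB : IsSupermanifold n m B)
    (hA : A.IsSheaf) (h : ∀ x : M, ∃ U : Opens M, x ∈ U ∧ Nonempty (AlgIso U A B)) :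
    IsSupermanifold n m A :=
  ⟨hA, fun x => by
    obtain ⟨U, hxU, ⟨φ⟩⟩ := h x
    obtain ⟨V, hxV, ⟨ψ⟩⟩ := hB.2 x
    exact ⟨U ⊓ V, ⟨hxU, hxV⟩, ⟨(φ.restrict inf_le_left).trans (ψ.restrict inf_le_right)⟩⟩⟩

omit [ChartedSpace (EuclideanSpace ℂ (Fin n)) M] in
lemma SuperMod.IsLocallyFree.of_local {p q : ℕ} {X Y : SuperPair M}
    (hY : Y.mod.IsLocallyFree p q) (hX : X.mod.IsSheaf)
    (h : ∀ x : M, ∃ U : Opens M, x ∈ U ∧ Nonempty (QuasiIso U X Y)) :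
    X.mod.IsLocallyFree p q :=
  ⟨hX, fun x => by
    obtain ⟨U, hxU, ⟨φ⟩⟩ := h x
    obtain ⟨V, hxV, ψ, hψ⟩ := hY.2 x
    exact ⟨U ⊓ V, ⟨hxU, hxV⟩, (φ.restrict inf_le_left).exists_trivialization
      (ψ.restrict inf_le_right) (congrArg (AlgIso.restrict inf_le_right) hψ)⟩⟩

end LocalModels


/-! ### The two classifying bijections and their compatibility. -/

section Classification

variable {n : ℕ} {M : Type u} [TopologicalSpace M] [ChartedSpace (EuclideanSpace ℂ (Fin n)) M]
  {G S₀ S₁ : HolMod n M} {m p q : ℕ}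

/-- Both sheaves have the same local model, hence are locally isomorphic; the given isomorphism of
retracts corrects the local isomorphisms to an atlas. -/
lemma SupermanifoldWithRetract.nonempty_algAtlas (hG : G.IsLocallyFree m)
    (A : SupermanifoldWithRetract G m) : Nonempty (AlgAtlas A.alg G.splitAlg) := by
  obtain ⟨r⟩ := A.retract
  refine AlgAtlas.nonempty_of_retractIso r (HolMod.splitAlgGradingData hG.2) fun x => ?_
  obtain ⟨U, hxU, ⟨φ⟩⟩ := A.isSupermanifold.2 x
  obtain ⟨V, hxV, ⟨ψ⟩⟩ := (HolMod.splitAlg_isSupermanifold hG).2 x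
  exact ⟨U ⊓ V, ⟨hxU, hxV⟩, ⟨(ψ.restrict inf_le_right).trans (φ.restrict inf_le_left).symm⟩⟩

lemma SheafWithRetract.nonempty_atlas (hG : G.IsLocallyFree m) (h₀ : S₀.IsLocallyFree p)
    (h₁ : S₁.IsLocallyFree q) (X : SheafWithRetract G S₀ S₁ m p q) :
    Nonempty (Atlas X.pair (G.splitPair S₀ S₁)) := by
  obtain ⟨r⟩ := X.retract
  refine Atlas.nonempty_of_retractIso r (HolMod.splitAlgGradingData hG.2)
    (HolMod.splitModGradingData hG.2 h₀.2 h₁.2) fun x => ?_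
  obtain ⟨U, hxU, ⟨φ⟩⟩ := X.isLocallyFree.exists_quasiIso X.isSupermanifold x
  obtain ⟨V, hxV, ⟨ψ⟩⟩ := SuperMod.IsLocallyFree.exists_quasiIso (X := G.splitPair S₀ S₁)
    (HolMod.splitAlg_isSupermanifold hG) (HolMod.splitMod_isLocallyFree hG h₀ h₁) x
  exact ⟨U ⊓ V, ⟨hxU, hxV⟩, ⟨(ψ.restrict inf_le_right).trans (φ.restrict inf_le_left).symm⟩⟩

/-- Pulling `t'` back along `φ` leaves its cocycle unchanged and reduces the claim to two atlases of
one sheaf, whose classes differ by a graded automorphism. -/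
lemma AlgAtlas.mk_cocycle_eq {A A' : SuperAlg M} (hG : G.IsLocallyFree m)
    (t : AlgAtlas A G.splitAlg) (t' : AlgAtlas A' G.splitAlg) (φ : AlgIso ⊤ A A') :
    (Quotient.mk _ (H1.mk t.cocycle) : GreenSet G) = Quotient.mk _ (H1.mk t'.cocycle) := by
  obtain ⟨a, ha⟩ := AlgAtlas.exists_smul_eq (HolMod.splitAlgGradingData hG.2) t (t'.comap φ)
  rw [AlgAtlas.cocycle_comap] at ha
  exact Quotient.sound ⟨a, ha⟩

lemma Atlas.mk_cocycle_eq {X X' : SuperPair M} (hG : G.IsLocallyFree m) (h₀ : S₀.IsLocallyFree p)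
    (h₁ : S₁.IsLocallyFree q) (t : Atlas X (G.splitPair S₀ S₁))
    (t' : Atlas X' (G.splitPair S₀ S₁)) (φ : QuasiIso ⊤ X X') :
    (Quotient.mk _ (H1.mk t.cocycle) : SheafOrbits G S₀ S₁) =
      Quotient.mk _ (H1.mk t'.cocycle) := by
  obtain ⟨a, ha⟩ := Atlas.exists_smul_eq (HolMod.splitAlgGradingData hG.2)
    (HolMod.splitModGradingData hG.2 h₀.2 h₁.2) t (t'.comap φ)
  rw [Atlas.cocycle_comap] at ha
  exact Quotient.sound ⟨a, ha⟩

/-- The map that sends the class of a supermanifold to the orbit of the class of its cocycle. -/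
noncomputable def greenMap (hG : G.IsLocallyFree m) : SupermanifoldClass G m → GreenSet G :=
  Quotient.lift (fun A => Quotient.mk _ (H1.mk (A.nonempty_algAtlas hG).some.cocycle))
    fun _ _ ⟨φ⟩ => AlgAtlas.mk_cocycle_eq hG _ _ φ

/-- The atlas chosen in the definition is immaterial: any two atlases of the same sheaf give the
same orbit. -/
lemma greenMap_mk (hG : G.IsLocallyFree m) (A : SupermanifoldWithRetract G m)
    (t : AlgAtlas A.alg G.splitAlg) :
    greenMap hG (Quotient.mk _ A) = Quotient.mk _ (H1.mk t.cocycle) :=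
  AlgAtlas.mk_cocycle_eq hG _ _ (AlgIso.refl _ _)

/-- Equality of orbits moves one cocycle to another by an automorphism, and cohomologous cocycles
come from isomorphic sheaves; every cocycle is realised by the sheaf it glues. -/
lemma greenMap_bijective (hG : G.IsLocallyFree m) : Function.Bijective (greenMap hG) := by
  constructor
  · intro x y hxy
    obtain ⟨A, rfl⟩ := Quotient.exists_rep x
    obtain ⟨A', rfl⟩ := Quotient.exists_rep y
    obtain ⟨t⟩ := A.nonempty_algAtlas hG
    obtain ⟨t'⟩ := A'.nonempty_algAtlas hG
    rw [greenMap_mk hG A t, greenMap_mk hG A' t'] at hxy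
    obtain ⟨a, ha⟩ := Quotient.exact hxy.symm
    exact Quotient.sound (AlgAtlas.nonempty_iso_of_smul_eq A.isSupermanifold.1
      A'.isSupermanifold.1 t t' a.1 ha)
  · intro y
    obtain ⟨x, rfl⟩ := Quotient.exists_rep y
    obtain ⟨c, rfl⟩ := Quot.exists_rep x
    refine ⟨Quotient.mk _ ⟨c.glueAlg, (HolMod.splitAlg_isSupermanifold hG).of_local
      (c.glueAlg_isSheaf G.splitAlg_isSheaf) fun x => ?_,
      -- The atlas of the glued sheaf itself supplies the isomorphism of its retract with the split
      -- model.
      ⟨c.glueAtlas.retractIso (HolMod.splitAlgGradingData hG.2)⟩⟩, ?_⟩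
    · obtain ⟨i, hi⟩ := c.cover x
      exact ⟨c.U i, hi, ⟨c.glueChart i⟩⟩
    · refine (greenMap_mk hG _ c.glueAtlas).trans ?_
      rw [c.cocycle_glueAtlas]
      rfl

/-- The map that sends the class of a locally free sheaf to the orbit of the class of its
cocycle. -/
noncomputable def sheafMap (hG : G.IsLocallyFree m) (h₀ : S₀.IsLocallyFree p)
    (h₁ : S₁.IsLocallyFree q) : SheafClass G S₀ S₁ m p q → SheafOrbits G S₀ S₁ :=
  Quotient.lift (fun X => Quotient.mk _ (H1.mk (X.nonempty_atlas hG h₀ h₁).some.cocycle))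
    fun _ _ ⟨φ⟩ => Atlas.mk_cocycle_eq hG h₀ h₁ _ _ φ

lemma sheafMap_mk (hG : G.IsLocallyFree m) (h₀ : S₀.IsLocallyFree p) (h₁ : S₁.IsLocallyFree q)
    (X : SheafWithRetract G S₀ S₁ m p q) (t : Atlas X.pair (G.splitPair S₀ S₁)) :
    sheafMap hG h₀ h₁ (Quotient.mk _ X) = Quotient.mk _ (H1.mk t.cocycle) :=
  Atlas.mk_cocycle_eq hG h₀ h₁ _ _ (QuasiIso.refl _ _)

/-- The argument is that of `greenMap_bijective`, with gluing of pairs in place of gluing of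
algebras. -/
lemma sheafMap_bijective (hG : G.IsLocallyFree m) (h₀ : S₀.IsLocallyFree p)
    (h₁ : S₁.IsLocallyFree q) : Function.Bijective (sheafMap hG h₀ h₁) := by
  constructor
  · intro x y hxy
    obtain ⟨X, rfl⟩ := Quotient.exists_rep x
    obtain ⟨X', rfl⟩ := Quotient.exists_rep y
    obtain ⟨t⟩ := X.nonempty_atlas hG h₀ h₁
    obtain ⟨t'⟩ := X'.nonempty_atlas hG h₀ h₁
    rw [sheafMap_mk hG h₀ h₁ X t, sheafMap_mk hG h₀ h₁ X' t'] at hxy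
    obtain ⟨a, ha⟩ := Quotient.exact hxy.symm
    exact Quotient.sound (Atlas.nonempty_iso_of_smul_eq X.isSupermanifold.1
      X'.isSupermanifold.1 X.isLocallyFree.1 X'.isLocallyFree.1 t t' a.1 ha)
  · intro y
    obtain ⟨x, rfl⟩ := Quotient.exists_rep y
    obtain ⟨c, rfl⟩ := Quot.exists_rep x
    have hloc : ∀ x : M, ∃ U : Opens M, x ∈ U ∧
        Nonempty (QuasiIso U c.gluePair (G.splitPair S₀ S₁)) := fun x => by
      obtain ⟨i, hi⟩ := c.cover x
      exact ⟨c.U i, hi, ⟨c.glueModChart i⟩⟩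
    refine ⟨Quotient.mk _ ⟨c.gluePair, (HolMod.splitAlg_isSupermanifold hG).of_local
      (Cocycle.glueAlg_isSheaf _ G.splitAlg_isSheaf) fun x => ?_,
      SuperMod.IsLocallyFree.of_local (X := c.gluePair) (Y := G.splitPair S₀ S₁)
        (HolMod.splitMod_isLocallyFree hG h₀ h₁)
        (c.glueMod_isSheaf (HolMod.splitMod_isSheaf G S₀ S₁)) hloc,
      ⟨c.glueModAtlas.retractIso (HolMod.splitAlgGradingData hG.2)
        (HolMod.splitModGradingData hG.2 h₀.2 h₁.2)⟩⟩, ?_⟩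
    · obtain ⟨U, hxU, ⟨φ⟩⟩ := hloc x
      exact ⟨U, hxU, ⟨φ.toAlgIso⟩⟩
    · refine (sheafMap_mk hG h₀ h₁ _ c.glueModAtlas).trans ?_
      rw [c.cocycle_glueModAtlas]
      rfl

/-- The algebra part of an atlas of the pair is an atlas of its structure sheaf, and its cocycle is
the image of the cocycle of the pair under `Φ_Ψ ↦ Ψ`. -/
lemma Ftilde_sheafMap (hG : G.IsLocallyFree m) (h₀ : S₀.IsLocallyFree p)
    (h₁ : S₁.IsLocallyFree q) (c : SheafClass G S₀ S₁ m p q) :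
    Ftilde G S₀ S₁ (sheafMap hG h₀ h₁ c) = greenMap hG c.base := by
  obtain ⟨X, rfl⟩ := Quotient.exists_rep c
  obtain ⟨t⟩ := X.nonempty_atlas hG h₀ h₁
  rw [sheafMap_mk hG h₀ h₁ X t]
  exact (greenMap_mk hG ⟨X.pair.alg, X.isSupermanifold,
    X.retract.map RetractIso.toAlgRetractIso⟩ t.toAlgAtlas).symm

omit [ChartedSpace (EuclideanSpace ℂ (Fin n)) M] in
-- Homomorphisms preserve the unit. Conjugation by a global quasi-automorphism being one, the unit
-- class is fixed by the action.
lemma H1.map_unit {P Q : (Opens M)ᵒᵖ ⥤ GrpCat.{u}} (α : P ⟶ Q) :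
    H1.map α (H1.unit P) = H1.unit Q :=
  congrArg H1.mk (Cocycle.mk_congr fun i j T a b => map_one (α.app (op T)).hom)

end Classification

end SuperGeom

theorem theorem2 {n m p q : ℕ} {M : Type u} [TopologicalSpace M]
    [ChartedSpace (EuclideanSpace ℂ (Fin n)) M]
    [IsManifold 𝓘(ℂ, EuclideanSpace ℂ (Fin n)) ω M]
    (G S₀ S₁ : SuperGeom.HolMod n M) (hG : G.IsLocallyFree m)
    (hS₀ : S₀.IsLocallyFree p) (hS₁ : S₁.IsLocallyFree q) :
    ∃ β : SuperGeom.SheafClass G S₀ S₁ m p q ≃ SuperGeom.SheafOrbits G S₀ S₁,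
      -- the bijection sends the class of `E` to the orbit of the class of the cocycle of `E`
      (∀ X : SuperGeom.SheafWithRetract G S₀ S₁ m p q,
        Nonempty (SuperGeom.Atlas X.pair (G.splitPair S₀ S₁)) ∧
        ∀ t : SuperGeom.Atlas X.pair (G.splitPair S₀ S₁),
          β (Quotient.mk _ X) = Quotient.mk _ (SuperGeom.H1.mk t.cocycle)) ∧
      -- the unit class is fixed
      (∀ a : SuperGeom.qautZero (G.splitPair S₀ S₁) G.splitAlgGrading (G.splitModGrading S₀ S₁),
        a • SuperGeom.H1.unit (SuperGeom.qautSheaf (G.splitPair S₀ S₁) 1 2) =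
          SuperGeom.H1.unit (SuperGeom.qautSheaf (G.splitPair S₀ S₁) 1 2)) ∧
      -- the correspondence `a ↦ [(M, 𝒪)]`, and the fibre of `F̃` over `a`
      ∃ γ : SuperGeom.SupermanifoldClass G m ≃ SuperGeom.GreenSet G,
        (∀ A : SuperGeom.SupermanifoldWithRetract G m,
          Nonempty (SuperGeom.AlgAtlas A.alg G.splitAlg) ∧
          ∀ t : SuperGeom.AlgAtlas A.alg G.splitAlg,
            γ (Quotient.mk _ A) = Quotient.mk _ (SuperGeom.H1.mk t.cocycle)) ∧
        ∀ a : SuperGeom.GreenSet G,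
          Set.BijOn β {c | c.base = γ.symm a} (SuperGeom.Ftilde G S₀ S₁ ⁻¹' {a}) := by
  let β := Equiv.ofBijective _ (SuperGeom.sheafMap_bijective hG hS₀ hS₁)
  let γ := Equiv.ofBijective _ (SuperGeom.greenMap_bijective hG)
  have hF : ∀ c, SuperGeom.Ftilde G S₀ S₁ (β c) = γ c.base :=
    SuperGeom.Ftilde_sheafMap hG hS₀ hS₁
  refine ⟨β, fun X => ⟨X.nonempty_atlas hG hS₀ hS₁, SuperGeom.sheafMap_mk hG hS₀ hS₁ X⟩,
    fun a => SuperGeom.H1.map_unit _, γ,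
    fun A => ⟨A.nonempty_algAtlas hG, SuperGeom.greenMap_mk hG A⟩, fun a => ?_⟩
  -- Since `F̃ ∘ β = γ ∘ base` and `γ` is bijective, the classes over `γ.symm a` are exactly the
  -- preimage under `β` of the fibre over `a`.
  refine ⟨fun c hc => ?_, β.injective.injOn, fun y hy => ⟨β.symm y, ?_, β.apply_symm_apply y⟩⟩
  · change SuperGeom.Ftilde G S₀ S₁ (β c) = a
    rw [hF, show c.base = γ.symm a from hc, γ.apply_symm_apply]
  · change (β.symm y).base = γ.symm a
    rw [Equiv.eq_symm_apply, ← hF, β.apply_symm_apply]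
    exact hy
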